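/- Let $L,T,\kappa,a_0,a_1>0$, let $w\in AC([0,T];H^1(\mathbb R))$, and write $\dot w(t)$ for its (weak) time derivative, which exists in $H^1(\mathbb R)$ for a.e. $t$. Let $K=[-\sqrt{2\kappa a_0},\sqrt{2\kappa a_0}]$. For a Borel set $X\subset\mathbb R$, $\mathcal M(X)$ is the space of bounded (signed) Radon measures on $X$ with the total variation norm. For $\varepsilon>0$ with $\varepsilon a_0<a_1$, a *quasi-static evolution of homogenized brittle damage* is a triple $$(u_\varepsilon,\Theta_\varepsilon,a_\varepsilon):[0,T]\to H^1((0,L))\times L^\infty((0,L);[0,1])\times L^\infty((0,L)),\qquad a_\varepsilon=\Big(\frac{1-\Theta_\varepsilon}{\varepsilon a_0}+\frac{\Theta_\varepsilon}{a_1}\Big)^{-1},$$ all weakly-* measurable in time, such that: * (Dirichlet condition) $u_\varepsilon(t)\in w(t)+H^1_0((0,L))$ for all $t\in[0,T]$; * (initial minimality) for all $v\in w(0)+H^1_0((0,L))$ and $\theta\in L^\infty((0,L);[0,1])$, $$\int_0^L\Big(\tfrac12a_\varepsilon(0)|u_\varepsilon'(0)|^2+\tfrac\kappa\varepsilon(1-\Theta_\varepsilon(0))\Big)dx\le\int_0^L\Big(\tfrac12\frac{\varepsilon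 a_0a_1}{\theta a_1+(1-\theta)\varepsilon a_0}|v'|^2+\tfrac\kappa\varepsilon\theta\Big)dx;$$ * (monotonicity) for $0\le s\le t\le T$, $a_\varepsilon(t)\le a_\varepsilon(s)$ and $\Theta_\varepsilon(t)\le\Theta_\varepsilon(s)$ a.e. in $(0,L)$; * (one-sided minimality) for all $t\in[0,T]$, $v\in w(t)+H^1_0((0,L))$ and $\theta\in L^\infty((0,L);[0,1])$, $$\tfrac12\int_0^La_\varepsilon(t)|u_\varepsilon'(t)|^2dx\le\tfrac12\int_0^L\frac{\varepsilon a_0a_\varepsilon(t)}{\theta a_\varepsilon(t)+(1-\theta)\varepsilon a_0}|v'|^2dx+\tfrac\kappa\varepsilon\int_0^L\theta\,\Theta_\varepsilon(t)\,dx;$$ * (energy balance) with $\mathcal E_\varepsilon(t)=\tfrac12\int_0^La_\varepsilon(t)|u_\varepsilon'(t)|^2dx+\tfrac\kappa\varepsilon\int_0^L(1-\Theta_\varepsilon(t))\,dx$, for all $t\in[0,T]$, $$\mathcal E_\varepsilon(t)=\mathcal E_\varepsilon(0)+\int_0^t\int_0^La_\varepsilon(s)u_\varepsilon'(s)\dot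 w'(s)\,dx\,ds.$$ **Theorem.** Let $\varepsilon$ run through a sequence of positive numbers with $\varepsilon a_0<a_1$ that tends to $0$, and for each such $\varepsilon$ let $(u_\varepsilon,\Theta_\varepsilon,a_\varepsilon)$ be a quasi-static evolution as above. For all $\varepsilon$ and all $t\in[0,T]$ the stress $\sigma_\varepsilon(t)=a_\varepsilon(t)u_\varepsilon'(t)$ is constant in space, hence identified with a real number. There exist a subsequence of $\varepsilon\to0$, independent of $t$ (not relabeled), and absolutely continuous functions $$(u,e,p,\sigma,\mu):[0,T]\to BV((0,L))\times\mathbb R\times\mathcal M([0,L])\times K\times\mathcal M([0,L])$$ such that for all $t\in[0,T]$, along the subsequence, $$\begin{aligned} &u_\varepsilon(t)\rightharpoonup u(t)&&\text{weakly-* in }BV((0,L)),\\ &\mu_\varepsilon(t):=\tfrac{1-\Theta_\varepsilon(t)}\varepsilon\,\mathcal L^1\llcorner(0,L)\rightharpoonup\mu(t)&&\text{weakly-* in }\mathcal M([0,L]),\\ &\sigma_\varepsilon(t)\to\sigma(t)&&\text{in }\mathbb R,\\ &e_\varepsilon(t):=\tfrac{\sigma_\varepsilon(t)}{a_1}\Theta_\varepsilon(t)\rightharpoonup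 e(t)&&\text{weakly in }L^2((0,L)),\\ &p_\varepsilon(t):=\tfrac{\sigma_\varepsilon(t)}{a_0}\mu_\varepsilon(t)\rightharpoonup p(t)&&\text{weakly-* in }\mathcal M([0,L]), \end{aligned}$$ and for all $t\in[0,T]$: 1. (additive decomposition) $Du(t)=e(t)\,\mathcal L^1\llcorner(0,L)+p(t)\llcorner(0,L)$ in $\mathcal M((0,L))$; 2. (relaxed Dirichlet condition) $p(t)\llcorner\{0,L\}=(w(t)-u(t))(\delta_L-\delta_0)$ in $\mathcal M(\{0,L\})$, with the inner traces of $u(t)$ and the values of the continuous representative of $w(t)$ at $0$ and $L$; 3. (constitutive equation) $\sigma(t)=a_1e(t)$; 4. (equilibrium equation) $\sigma'(t)=0$ in $H^{-1}((0,L))$; 5. (stress constraint) $\sigma(t)\in K$. Furthermore, the effective compliance $c(t)=\frac{\mu(t)}{a_0}+\frac1{a_1}\mathcal L^1\llcorner(0,L)$ is a non-negative measure in $\mathcal M([0,L])$, is non-decreasing in $t\in[0,T]$, and satisfies 6. (constitutive equation) $Du(t)=\sigma(t)\,c(t)\llcorner(0,L)$ in $\mathcal M((0,L))$ for all $t\in[0,T]$;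 7. (Griffith evolution law) for a.e. $t\in[0,T]$ the weak-* limit $\dot c(t)$ in $\mathcal M([0,L])$ of $\frac{c(s)-c(t)}{s-t}$ as $s\to t$ exists, is non-negative, and $\dot c(t)\,(2\kappa a_0-\sigma(t)^2)=0$. -/

import Mathlib

open Set Filter Topology MeasureTheory

noncomputable section

namespace BrittleDamage

/-! ### One-dimensional Sobolev spaces -/

/-- The open interval `(0, L)`. -/
def body (L : ℝ) : TopologicalSpace.Opens ℝ := ⟨Ioo 0 L, isOpen_Ioo⟩

/-- Smooth compactly supported test functions on the open set `Ω`. -/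
abbrev Test (Ω : TopologicalSpace.Opens ℝ) : Type := TestFunction Ω ℝ ⊤

/-- Lebesgue measure on the open set `Ω`. -/
abbrev leb (Ω : TopologicalSpace.Opens ℝ) : Measure ℝ := volume.restrict (Ω : Set ℝ)

theorem test_memLp {Ω : TopologicalSpace.Opens ℝ} (φ : Test Ω) :
    MemLp (fun x => φ x) 2 (leb Ω) :=
  ((TestFunctionClass.map_contDiff φ).continuous.memLp_of_hasCompactSupport
    (TestFunctionClass.map_hasCompactSupport φ)).restrict _

theorem test_deriv_memLp {Ω : TopologicalSpace.Opens ℝ} (φ : Test Ω) :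
    MemLp (fun x => deriv φ x) 2 (leb Ω) :=
  (((TestFunctionClass.map_contDiff φ).continuous_deriv
    (by norm_num)).memLp_of_hasCompactSupport
    (TestFunctionClass.map_hasCompactSupport φ).deriv).restrict _

/-- The Hilbert space `H¹(Ω)`, realised as the set of pairs `(v, v')` in `L²(Ω) × L²(Ω)` such that
`v'` is the weak derivative of `v`, with the norm `(‖v‖² + ‖v'‖²)^(1/2)`. -/
def H1Submodule (Ω : TopologicalSpace.Opens ℝ) :
    Submodule ℝ (WithLp 2 (Lp ℝ 2 (leb Ω) × Lp ℝ 2 (leb Ω))) where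
  carrier := {F | ∀ φ : Test Ω,
    ∫ x in (Ω : Set ℝ), F.fst x * deriv φ x = -∫ x in (Ω : Set ℝ), F.snd x * φ x}
  zero_mem' := by
    intro φ
    have h0 : ((0 : Lp ℝ 2 (leb Ω)) : ℝ → ℝ) =ᵐ[leb Ω] 0 := Lp.coeFn_zero ℝ 2 (leb Ω)
    have h1 : ∫ x in (Ω : Set ℝ), (0 : Lp ℝ 2 (leb Ω)) x * deriv φ x = 0 :=
      integral_eq_zero_of_ae (h0.mono fun x hx => by simp only [hx, Pi.zero_apply, zero_mul])
    have h2 : ∫ x in (Ω : Set ℝ), (0 : Lp ℝ 2 (leb Ω)) x * φ x = 0 :=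
      integral_eq_zero_of_ae (h0.mono fun x hx => by simp only [hx, Pi.zero_apply, zero_mul])
    simp only [WithLp.zero_fst, WithLp.zero_snd]
    rw [h1, h2, neg_zero]
  add_mem' := by
    intro F G hF hG φ
    have hadd : ∀ (f g : Lp ℝ 2 (leb Ω)) (ψ : ℝ → ℝ), MemLp ψ 2 (leb Ω) →
        ∫ x in (Ω : Set ℝ), (f + g) x * ψ x =
          (∫ x in (Ω : Set ℝ), f x * ψ x) + ∫ x in (Ω : Set ℝ), g x * ψ x := by
      intro f g ψ hψ
      have hf : Integrable (fun x => f x * ψ x) (leb Ω) := (Lp.memLp f).integrable_mul hψ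
      have hg : Integrable (fun x => g x * ψ x) (leb Ω) := (Lp.memLp g).integrable_mul hψ
      rw [← integral_add hf hg]
      exact integral_congr_ae ((Lp.coeFn_add f g).mono fun x hx => by
        simp only [hx, Pi.add_apply]; ring)
    have hF' := hF φ
    have hG' := hG φ
    simp only [WithLp.add_fst, WithLp.add_snd]
    rw [hadd _ _ _ (test_deriv_memLp φ), hadd _ _ _ (test_memLp φ), hF', hG']
    ring
  smul_mem' := by
    intro c F hF φ
    have hsm : ∀ (f : Lp ℝ 2 (leb Ω)) (ψ : ℝ → ℝ),
        ∫ x in (Ω : Set ℝ), (c • f) x * ψ x = c * ∫ x in (Ω : Set ℝ), f x * ψ x := by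
      intro f ψ
      rw [← integral_const_mul]
      exact integral_congr_ae ((Lp.coeFn_smul c f).mono fun x hx => by
        simp only [hx, Pi.smul_apply, smul_eq_mul]; ring)
    have hF' := hF φ
    simp only [WithLp.smul_fst, WithLp.smul_snd]
    rw [hsm, hsm, hF']
    ring

/-- The Hilbert space `H¹(Ω)`, with the inner product and norm inherited from `L²(Ω) × L²(Ω)`. -/
abbrev H1 (Ω : TopologicalSpace.Opens ℝ) : Type := H1Submodule Ω

/-- The function underlying an element of `H¹(Ω)` (defined up to null sets). -/
def H1.val {Ω : TopologicalSpace.Opens ℝ} (v : H1 Ω) : Lp ℝ 2 (leb Ω) :=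
  (v : WithLp 2 (Lp ℝ 2 (leb Ω) × Lp ℝ 2 (leb Ω))).fst

/-- The weak derivative of an element of `H¹(Ω)`. -/
def H1.der {Ω : TopologicalSpace.Opens ℝ} (v : H1 Ω) : Lp ℝ 2 (leb Ω) :=
  (v : WithLp 2 (Lp ℝ 2 (leb Ω) × Lp ℝ 2 (leb Ω))).snd

/-- `H¹₀(Ω)`: the closure of the test functions in `H¹(Ω)`. -/
def H10 (Ω : TopologicalSpace.Opens ℝ) : Set (H1 Ω) :=
  closure {v | ∃ φ : Test Ω, ∀ᵐ x ∂leb Ω, v.val x = φ x}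

/-- `v ∈ w + H¹₀((0, L))`, for `v ∈ H¹((0, L))` and `w ∈ H¹(ℝ)`. -/
def DirichletClass {L : ℝ} (w : H1 ⊤) (v : H1 (body L)) : Prop :=
  ∃ z ∈ H10 (body L), ∀ᵐ x ∂leb (body L), v.val x = w.val x + z.val x

/-! ### Time derivatives -/

/-- `f'` is the weak limit in `H` of the difference quotients of `f` at `t`. As the Hilbert space
`H` is its own dual, weak and weak-* limits coincide. -/
def HasWeakTimeDerivAt {H : Type*} [NormedAddCommGroup H] [InnerProductSpace ℝ H]
    (f : ℝ → H) (f' : H) (t : ℝ) : Prop :=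
  ∀ h : H, Tendsto (fun s => inner ℝ h ((s - t)⁻¹ • (f s - f t))) (𝓝[≠] t) (𝓝 (inner ℝ h f'))

open Classical in
/-- The weak time derivative, with value `0` where it does not exist. -/
def weakTimeDeriv {H : Type*} [NormedAddCommGroup H] [InnerProductSpace ℝ H]
    (f : ℝ → H) (t : ℝ) : H :=
  if h : ∃ f', HasWeakTimeDerivAt f f' t then h.choose else 0

/-- Absolute continuity on `[a, b]` of a function with values in a set `X` with distance `d`. When
`d` is the distance of a metric space, this is `AbsolutelyContinuousOnInterval f a b`: the sum of
the distances `d (f aᵢ) (f bᵢ)` over a finite disjoint family of subintervals `(aᵢ, bᵢ)` tends to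
`0` as their total length does. -/
def AbsContWith {X : Type*} (d : X → X → ℝ) (f : ℝ → X) (a b : ℝ) : Prop :=
  Tendsto (fun E : ℕ × (ℕ → ℝ × ℝ) => ∑ i ∈ Finset.range E.1, d (f (E.2 i).1) (f (E.2 i).2))
    (AbsolutelyContinuousOnInterval.totalLengthFilter ⊓
      𝓟 (AbsolutelyContinuousOnInterval.disjWithin a b)) (𝓝 0)

/-! ### Bounded Radon measures

For a Borel set `X` of the line, a bounded Radon measure on `X` is represented by the signed Borel
measure on the line that is concentrated on `X`. -/

/-- `ν` is a measure on `X`, that is, it is concentrated on `X`. -/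
def IsMeasureOn (X : Set ℝ) (ν : SignedMeasure ℝ) : Prop := ν.restrict X = ν

/-- The distance of the total variation norm. -/
def tvDist (μ ν : SignedMeasure ℝ) : ℝ := (μ - ν).variation.real univ

/-- Lebesgue measure on `(0, L)`, as a signed measure. -/
def lebSigned (L : ℝ) : SignedMeasure ℝ := (volume.restrict (Ioo 0 L)).toSignedMeasure

/-- `φ` belongs to `C₀(X)` for a bounded set `X` that is open or closed: `φ` is continuous and
vanishes on the part of the boundary of `X` that is not in `X`. -/
def IsC0 (X : Set ℝ) (φ : ℝ → ℝ) : Prop :=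
  Continuous φ ∧ ∀ x ∈ frontier X \ X, φ x = 0

/-- Weak-* convergence of measures on `X`, in duality with `C₀(X)`. -/
def WeakStarTendsto (X : Set ℝ) (ν : ℕ → SignedMeasure ℝ) (ν' : SignedMeasure ℝ) : Prop :=
  ∀ φ : ℝ → ℝ, IsC0 X φ →
    Tendsto (fun n => ∫ᵛ x, φ x ∂<•(ν n)) atTop (𝓝 (∫ᵛ x, φ x ∂<•ν'))

/-- The measure `ν'` is the weak-* limit of the difference quotients at time `t` of the family
`ν` of measures on `X`. -/
def HasWeakStarTimeDerivAt (X : Set ℝ) (ν : ℝ → SignedMeasure ℝ) (ν' : SignedMeasure ℝ)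
    (t : ℝ) : Prop :=
  ∀ φ : ℝ → ℝ, IsC0 X φ →
    Tendsto (fun s => ∫ᵛ x, φ x ∂<•((s - t)⁻¹ • (ν s - ν t))) (𝓝[≠] t) (𝓝 (∫ᵛ x, φ x ∂<•ν'))

/-! ### Functions of bounded variation -/

/-- The space `BV(Ω)`: integrable functions on `Ω` whose distributional derivative `D` (uniquely
determined by the function) is a bounded measure on `Ω`. -/
structure BV (Ω : TopologicalSpace.Opens ℝ) where
  /-- the function -/
  val : Lp ℝ 1 (leb Ω)
  /-- its distributional derivative -/
  D : SignedMeasure ℝ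
  isMeasureOn_D : IsMeasureOn Ω D
  integral_eq : ∀ φ : Test Ω, ∫ x in (Ω : Set ℝ), val x * deriv φ x = -∫ᵛ x, φ x ∂<•D

/-- The distance of the norm `‖u‖_{L¹} + |Du|(Ω)`. -/
def BV.distance {Ω : TopologicalSpace.Opens ℝ} (u v : BV Ω) : ℝ :=
  ‖u.val - v.val‖ + tvDist u.D v.D

/-- Weak-* convergence in `BV((0, L))` of a sequence of `H¹` functions `uₙ`: `uₙ → u` in `L¹`, and
the derivatives, which are the measures of density `uₙ'`, converge weakly-* to `Du`. -/
def BVWeakStarTendsto {L : ℝ} (u : ℕ → H1 (body L)) (u' : BV (body L)) : Prop :=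
  Tendsto (fun n => ∫ x in Ioo 0 L, |(u n).val x - u'.val x|) atTop (𝓝 0) ∧
  WeakStarTendsto (Ioo 0 L)
    (fun n => (volume.restrict (Ioo 0 L)).withDensityᵥ (fun x => (u n).der x)) u'.D

/-- The inner trace of `f : Ω → ℝ` at the boundary point `x₀` of `Ω` is `α`: the averages of
`|f - α|` over `Ω ∩ B(x₀, r)` tend to `0` with `r`. -/
def HasTrace (Ω : Set ℝ) (f : ℝ → ℝ) (x₀ α : ℝ) : Prop :=
  Tendsto (fun r : ℝ => r⁻¹ * ∫ x in Ω ∩ Metric.ball x₀ r, |f x - α|) (𝓝[>] 0) (𝓝 0)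

/-- `W` is the continuous representative of `w ∈ H¹(ℝ)`. -/
def IsContinuousRep (w : H1 ⊤) (W : ℝ → ℝ) : Prop :=
  Continuous W ∧ ∀ᵐ x, w.val x = W x

/-! ### The brittle damage evolutions -/

/-- `θ ∈ L^∞((0, L); [0, 1])`. -/
def IsVolumeFraction (L : ℝ) (θ : ℝ → ℝ) : Prop :=
  AEMeasurable θ (volume.restrict (Ioo 0 L)) ∧ ∀ᵐ x ∂volume.restrict (Ioo 0 L), θ x ∈ Icc 0 1

/-- The stiffness of the mixture of the materials `α` and `β` in proportions `θ` and `1 - θ`. -/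
def mix (α β θ : ℝ) : ℝ := α * β / (θ * β + (1 - θ) * α)

/-- The elastic energy `½ ∫ a |v'|²` on `(0, L)`. -/
def elasticEnergy {L : ℝ} (a : ℝ → ℝ) (v : H1 (body L)) : ℝ :=
  1 / 2 * ∫ x in Ioo 0 L, a x * v.der x ^ 2

/-- `(u, Θ, a)` is a quasi-static evolution of homogenized brittle damage on the time interval
`[0, T]`, for the body `(0, L)`, with damaged and sound stiffnesses `α < β`, toughness `k` and
boundary displacement `w`. -/
structure IsBrittleEvolution (L T k α β : ℝ) (w : ℝ → H1 ⊤)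
    (u : ℝ → H1 (body L)) (Θ a : ℝ → ℝ → ℝ) : Prop where
  /-- `Θ` takes its values in `L^∞((0, L); [0, 1])`. -/
  volumeFraction : ∀ t ∈ Icc 0 T, IsVolumeFraction L (Θ t)
  /-- The stiffness of the mixture of volume fractions `Θ` of sound and `1 - Θ` of damaged
  material. -/
  stiffness : ∀ t ∈ Icc 0 T, ∀ᵐ x ∂volume.restrict (Ioo 0 L),
    a t x = ((1 - Θ t x) / α + Θ t x / β)⁻¹
  /-- Weak-* measurability in time of `u`, `Θ` and `a`. -/
  measurable_u : ∀ h : H1 (body L),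
    AEMeasurable (fun t => inner ℝ h (u t)) (volume.restrict (Icc 0 T))
  measurable_Θ : ∀ g : ℝ → ℝ, IntegrableOn g (Ioo 0 L) →
    AEMeasurable (fun t => ∫ x in Ioo 0 L, g x * Θ t x) (volume.restrict (Icc 0 T))
  measurable_a : ∀ g : ℝ → ℝ, IntegrableOn g (Ioo 0 L) →
    AEMeasurable (fun t => ∫ x in Ioo 0 L, g x * a t x) (volume.restrict (Icc 0 T))
  dirichlet : ∀ t ∈ Icc 0 T, DirichletClass (w t) (u t)
  initial_minimality : ∀ v : H1 (body L), DirichletClass (w 0) v →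
    ∀ θ : ℝ → ℝ, IsVolumeFraction L θ →
      elasticEnergy (a 0) (u 0) + k * ∫ x in Ioo 0 L, (1 - Θ 0 x) ≤
        elasticEnergy (fun x => mix α β (θ x)) v + k * ∫ x in Ioo 0 L, θ x
  monotone : ∀ s ∈ Icc 0 T, ∀ t ∈ Icc 0 T, s ≤ t → ∀ᵐ x ∂volume.restrict (Ioo 0 L),
    a t x ≤ a s x ∧ Θ t x ≤ Θ s x
  one_sided_minimality : ∀ t ∈ Icc 0 T, ∀ v : H1 (body L), DirichletClass (w t) v →
    ∀ θ : ℝ → ℝ, IsVolumeFraction L θ →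
      elasticEnergy (a t) (u t) ≤
        elasticEnergy (fun x => mix α (a t x) (θ x)) v + k * ∫ x in Ioo 0 L, θ x * Θ t x
  energy_balance : ∀ t ∈ Icc 0 T,
    elasticEnergy (a t) (u t) + k * ∫ x in Ioo 0 L, (1 - Θ t x) =
      elasticEnergy (a 0) (u 0) + k * (∫ x in Ioo 0 L, (1 - Θ 0 x)) +
        ∫ s in (0)..t, ∫ x in Ioo 0 L, a s x * (u s).der x * (weakTimeDeriv w s).der x

/-- The measure `(1 - Θ) / ε` on `(0, L)`. -/
def damageMeasure (L ε : ℝ) (Θ : ℝ → ℝ) : SignedMeasure ℝ :=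
  (volume.restrict (Ioo 0 L)).withDensityᵥ (fun x => (1 - Θ x) / ε)

/-- The compliance `μ / a₀ + (1 / a₁) 𝓛¹` on `(0, L)`. -/
def compliance (L a₀ a₁ : ℝ) (μ : SignedMeasure ℝ) : SignedMeasure ℝ :=
  a₀⁻¹ • μ + a₁⁻¹ • lebSigned L

end BrittleDamage

end

open scoped ContDiff

namespace BrittleDamage

/-! ### Absolute continuity and limits of families of functions -/

/-! The problem is one-dimensional, so each evolution is governed by two scalars: the imposed
elongation `d(t) = stretch L (w t)` and the total compliance `C(t)`, the integral of `1 / a`.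
One-sided minimality without added damage forces equilibrium: the stress is the constant `d / C` and
the elastic energy is `d² / (2C)` (`der_eq`, `elasticEnergy_eq`). Adding a small uniform proportion
of damage and taking the first variation gives the threshold `d² ≤ lam C²` (`stretch_sq_le`), where
`lam` tends to `2κa₀`. The energy balance becomes a scalar identity for `d² / C + lam C`
(`balance`).

Let `V` be the variation of `d` and `R` a bound for `|d|`. Freezing `C` at time `s` in the power of
the external forces and using that `C` is non-decreasing turns the balance into `(C t - C s) (lam C
s C t - d(t)² - 2R (V t - V s)) ≤ 0` (`sub_mul_threshold_le`). Hence either `C` does not move, or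
`lam C s C t` is at most `d(t)²` plus a multiple of the increment of `V`. With the threshold at time
`s`, the increments of `C` are bounded by those of `V`, uniformly in `ε` (`lam_mul_sub_le`,
`damagedVolume_div_sub_le`).

After rescaling, `C` is an affine function of the mass of the damage measure `(1 - Θ) / ε`. These
measures are non-decreasing in time, so the difference of two of them is a positive measure up to
sign, and control of the masses is control in total variation. A Helly argument gives one
subsequence converging weakly at all times (`exists_subseq_tendsto_of_monotone`,
`exists_limit_damage`). The threshold and the Griffith inequality contain no time derivatives of `C`
and are closed under pointwise limits, so the limit measure `m` inherits them (`IsLimitDamage`).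

Everything else is a formula in `m`. The stress is `σ = d / S`, with `S` the mass of the effective
compliance `c`; `e = σ / a₁` because `Θ → 1`; `p = (σ / a₀) m`; and `u` is the boundary value of `w`
at `0` plus `σ` times the distribution function of `c`. The approximate displacements have the same
form (`val_eq`), so their convergence follows from that of the measures. The atoms of `m` at `0` and
`L` are exactly what the traces of `u` miss, which is the relaxed Dirichlet condition. If `σ(t)² <
2κa₀`, the bracket in the Griffith inequality is positive near `t`, so the mass, and with it the
measure, is constant near `t` (`eventually_damage_eq`); otherwise the factor `2κa₀ - σ(t)²`
vanishes. The weak-* rate exists almost everywhere because the difference quotients are positive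
measures of bounded mass, converging on a countable dense set of test functions
(`ae_exists_tendsto_slope_of_monotone`). -/

/-- Domination of increments is the only route to absolute continuity needed for the `BV` and total
variation distances. Two comparison functions are allowed since the displacement depends on `w`
itself as well as on the variation of its elongation. -/
theorem AbsContWith.of_le_add {X Y Z : Type*} [PseudoMetricSpace Y] [PseudoMetricSpace Z]
    {d : X → X → ℝ} {f : ℝ → X} {g : ℝ → Y} {h : ℝ → Z} {a b C : ℝ}
    (hg : AbsolutelyContinuousOnInterval g a b) (hh : AbsolutelyContinuousOnInterval h a b)
    (hd : ∀ x y, 0 ≤ d x y)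
    (hle : ∀ s ∈ uIcc a b, ∀ t ∈ uIcc a b,
      d (f s) (f t) ≤ C * (dist (g s) (g t) + dist (h s) (h t))) :
    AbsContWith d f a b := by
  have h1 : Tendsto (fun E : ℕ × (ℕ → ℝ × ℝ) => C *
      (∑ i ∈ Finset.range E.1, dist (g (E.2 i).1) (g (E.2 i).2) +
        ∑ i ∈ Finset.range E.1, dist (h (E.2 i).1) (h (E.2 i).2)))
      (AbsolutelyContinuousOnInterval.totalLengthFilter ⊓
        𝓟 (AbsolutelyContinuousOnInterval.disjWithin a b)) (𝓝 0) := by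
    simpa using (Tendsto.add hg hh).const_mul C
  refine squeeze_zero' (Eventually.of_forall fun E => Finset.sum_nonneg fun i _ => hd _ _) ?_ h1
  have h2 : ∀ᶠ E : ℕ × (ℕ → ℝ × ℝ) in AbsolutelyContinuousOnInterval.totalLengthFilter ⊓
      𝓟 (AbsolutelyContinuousOnInterval.disjWithin a b),
      E ∈ AbsolutelyContinuousOnInterval.disjWithin a b :=
    eventually_inf_principal.mpr (by simp)
  filter_upwards [h2] with E hE
  rw [← Finset.sum_add_distrib, Finset.mul_sum]
  exact Finset.sum_le_sum fun i hi => hle _ (hE.1 i hi).1 _ (hE.1 i hi).2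

theorem _root_.AbsolutelyContinuousOnInterval.comp_lipschitz {X Y : Type*} [PseudoMetricSpace X]
    [PseudoMetricSpace Y] {f : ℝ → X} {g : X → Y} {a b : ℝ} {K : NNReal}
    (hf : AbsolutelyContinuousOnInterval f a b) (hg : LipschitzWith K g) :
    AbsolutelyContinuousOnInterval (fun t => g (f t)) a b := by
  have h : AbsContWith dist (fun t => g (f t)) a b := by
    refine AbsContWith.of_le_add (C := K) hf hf (fun _ _ => dist_nonneg) fun s _ t _ => ?_
    refine (hg.dist_le_mul _ _).trans (mul_le_mul_of_nonneg_left ?_ K.coe_nonneg)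
    linarith [dist_nonneg (x := f s) (y := f t)]
  exact h

/-- The increments of a function are bounded by those of its variation. -/
theorem dist_le_abs_variationOnFromTo {X : Type*} [PseudoMetricSpace X] {f : ℝ → X} {S : Set ℝ}
    (hf : LocallyBoundedVariationOn f S) {a s t : ℝ} (ha : a ∈ S) (hs : s ∈ S) (ht : t ∈ S) :
    dist (f s) (f t) ≤ |variationOnFromTo f S a s - variationOnFromTo f S a t| := by
  wlog hst : t ≤ s generalizing s t
  · rw [dist_comm, abs_sub_comm]
    exact this ht hs (le_of_not_ge hst)
  rw [variationOnFromTo.sub_right hf ha hs ht, abs_of_nonneg (variationOnFromTo.nonneg_of_le f S hst),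
    variationOnFromTo.eq_of_le f S hst, dist_edist]
  exact ENNReal.toReal_mono (hf t s ht hs)
    (eVariationOn.edist_le f ⟨hs, right_mem_Icc.2 hst⟩ ⟨ht, left_mem_Icc.2 hst⟩)

/-- A family of eventually equi-Lipschitz functions that converges on a dense set converges
everywhere. -/
theorem exists_tendsto_of_dense {ι X : Type*} [PseudoMetricSpace X] {l : Filter ι} [l.NeBot]
    {f : ι → X → ℝ} {C : ℝ} (hC : ∀ᶠ i in l, ∀ x y, dist (f i x) (f i y) ≤ C * dist x y)
    {D : Set X} (hD : Dense D) (h : ∀ x ∈ D, ∃ c, Tendsto (fun i => f i x) l (𝓝 c)) (x : X) :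
    ∃ c, Tendsto (fun i => f i x) l (𝓝 c) := by
  refine CompleteSpace.complete (f := map (fun i => f i x) l) ?_
  rw [Metric.cauchy_iff]
  refine ⟨inferInstance, fun ε hε => ?_⟩
  -- The sign of `C` is not known, so `|C| + 1` serves as a positive Lipschitz constant. Passing
  -- from `x` to `y` costs `ε / 4`, and the convergence at `y` another `ε / 4`.
  have hpos : 0 < ε / (4 * (|C| + 1)) := by positivity
  obtain ⟨y, hyD, hy⟩ := hD.exists_dist_lt x hpos
  obtain ⟨c, hc⟩ := h y hyD
  have hev : ∀ᶠ i in l, dist (f i x) c < ε / 2 := by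
    filter_upwards [hC, Metric.tendsto_nhds.1 hc (ε / 4) (by positivity)] with i hi1 hi2
    have h1 : C * dist x y ≤ (|C| + 1) * (ε / (4 * (|C| + 1))) :=
      mul_le_mul (by linarith [le_abs_self C]) hy.le dist_nonneg (by positivity)
    have h2 : (|C| + 1) * (ε / (4 * (|C| + 1))) = ε / 4 := by
      have : |C| + 1 ≠ 0 := by positivity
      field_simp
    linarith [dist_triangle (f i x) (f i y) c, hi1 x y]
  refine ⟨(fun i => f i x) '' {i | dist (f i x) c < ε / 2}, image_mem_map hev, ?_⟩
  rintro _ ⟨i, hi, rfl⟩ _ ⟨j, hj, rfl⟩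
  have hi' : dist (f i x) c < ε / 2 := hi
  have hj' : dist (f j x) c < ε / 2 := hj
  linarith [dist_triangle_right (f i x) (f j x) c]

/-! ### Weak time derivatives -/

section WeakDeriv

variable {H : Type*} [NormedAddCommGroup H] [InnerProductSpace ℝ H]

theorem HasWeakTimeDerivAt.unique {f : ℝ → H} {f' f'' : H} {t : ℝ}
    (h' : HasWeakTimeDerivAt f f' t) (h'' : HasWeakTimeDerivAt f f'' t) : f' = f'' :=
  ext_inner_left ℝ fun h => tendsto_nhds_unique (h' h) (h'' h)

theorem HasWeakTimeDerivAt.weakTimeDeriv_eq {f : ℝ → H} {f' : H} {t : ℝ}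
    (h : HasWeakTimeDerivAt f f' t) : weakTimeDeriv f t = f' := by
  have h' : ∃ f', HasWeakTimeDerivAt f f' t := ⟨f', h⟩
  rw [weakTimeDeriv, dif_pos h']
  exact h'.choose_spec.unique h

variable [CompleteSpace H]

/-- A continuous linear functional of a weakly differentiable function is differentiable. -/
theorem HasWeakTimeDerivAt.hasDerivAt {f : ℝ → H} {f' : H} {t : ℝ}
    (h : HasWeakTimeDerivAt f f' t) (ℓ : H →L[ℝ] ℝ) :
    HasDerivAt (fun s => ℓ (f s)) (ℓ f') t := by
  rw [hasDerivAt_iff_tendsto_slope]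
  have h1 := h ((InnerProductSpace.toDual ℝ H).symm ℓ)
  simp only [InnerProductSpace.toDual_symm_apply] at h1
  refine h1.congr fun s => ?_
  simp [slope, map_sub]

/-- Bounded vectors that converge weakly against a dense set of test vectors converge weakly. -/
theorem exists_weak_limit {ι : Type*} {l : Filter ι} [l.NeBot] {q : ι → H} {C : ℝ}
    (hC : ∀ᶠ i in l, ‖q i‖ ≤ C) {D : Set H} (hD : Dense D)
    (h : ∀ x ∈ D, ∃ c, Tendsto (fun i => inner ℝ x (q i)) l (𝓝 c)) :
    ∃ q', ∀ x, Tendsto (fun i => inner ℝ x (q i)) l (𝓝 (inner ℝ x q')) := by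
  have hall : ∀ x, ∃ c, Tendsto (fun i => inner ℝ x (q i)) l (𝓝 c) := by
    refine exists_tendsto_of_dense (C := C) ?_ hD h
    filter_upwards [hC] with i hi x y
    rw [Real.dist_eq, ← inner_sub_left, dist_eq_norm, mul_comm]
    exact (abs_real_inner_le_norm _ _).trans (mul_le_mul_of_nonneg_left hi (norm_nonneg _))
  choose ℓ hℓ using hall
  -- The limits depend linearly on the test vector by uniqueness of limits and are bounded by `C`,
  -- so the Riesz theorem represents them by a vector.
  let Λ : H →ₗ[ℝ] ℝ :=
    { toFun := ℓ
      map_add' := fun x y => tendsto_nhds_unique (hℓ (x + y))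
        (((hℓ x).add (hℓ y)).congr fun i => (inner_add_left x y (q i)).symm)
      map_smul' := fun c x => tendsto_nhds_unique (hℓ (c • x))
        (((hℓ x).const_mul c).congr fun i => (real_inner_smul_left x (q i) c).symm) }
  have hΛ : ∀ x, ‖Λ x‖ ≤ C * ‖x‖ := fun x => by
    refine le_of_tendsto (hℓ x).norm ?_
    filter_upwards [hC] with i hi
    rw [mul_comm]
    exact (norm_inner_le_norm x (q i)).trans (mul_le_mul_of_nonneg_left hi (norm_nonneg _))
  refine ⟨(InnerProductSpace.toDual ℝ H).symm (Λ.mkContinuous C hΛ), fun x => ?_⟩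
  rw [real_inner_comm, InnerProductSpace.toDual_symm_apply]
  exact hℓ x

/-- An absolutely continuous function with values in a separable Hilbert space is weakly
differentiable almost everywhere. -/
theorem ae_hasWeakTimeDerivAt [SecondCountableTopology H] {f : ℝ → H} {a b : ℝ} (hab : a ≤ b)
    (hf : AbsolutelyContinuousOnInterval f a b) :
    ∀ᵐ t, t ∈ Ioo a b → HasWeakTimeDerivAt f (weakTimeDeriv f t) t := by
  have hbv : BoundedVariationOn f (Icc a b) := uIcc_of_le hab ▸ hf.boundedVariationOn
  have hlbv := hbv.locallyBoundedVariationOn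
  have hmono := variationOnFromTo.monotoneOn hlbv (left_mem_Icc.2 hab)
  -- Where the variation of `f` is differentiable, it bounds the difference quotients of `f`. Where
  -- the pairings with a countable dense set of vectors are differentiable too, these bounded
  -- quotients converge weakly.
  have h1 := hmono.ae_differentiableWithinAt_of_mem
  have h2 : ∀ᵐ t, ∀ k, t ∈ uIcc a b →
      DifferentiableAt ℝ (fun s => inner ℝ (TopologicalSpace.denseSeq H k) (f s)) t := by
    rw [ae_all_iff]
    intro k
    exact (hf.comp_lipschitz
      ((innerSL ℝ (TopologicalSpace.denseSeq H k)).lipschitz)).ae_differentiableAt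
  filter_upwards [h1, h2] with t ht1 ht2 htm
  have htI : t ∈ Icc a b := Ioo_subset_Icc_self htm
  have hnhds : Icc a b ∈ 𝓝 t := Icc_mem_nhds htm.1 htm.2
  have hV := (ht1 htI).differentiableAt hnhds
  obtain ⟨C, hC⟩ : ∃ C, ∀ᶠ s in 𝓝[≠] t, ‖(s - t)⁻¹ • (f s - f t)‖ ≤ C := by
    have h3 := (hasDerivAt_iff_tendsto_slope.1 hV.hasDerivAt).norm
    refine ⟨‖deriv (variationOnFromTo f (Icc a b) a) t‖ + 1, ?_⟩
    filter_upwards [nhdsWithin_le_nhds hnhds, h3.eventually_lt_const (lt_add_one _)] with s hs hlt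
    refine le_trans ?_ hlt.le
    rw [slope_def_field, norm_div, div_eq_inv_mul, norm_smul, norm_inv]
    refine mul_le_mul_of_nonneg_left ?_ (by positivity)
    rw [← dist_eq_norm]
    exact dist_le_abs_variationOnFromTo hlbv (left_mem_Icc.2 hab) hs htI
  obtain ⟨q', hq'⟩ := exists_weak_limit (H := H) hC (TopologicalSpace.denseRange_denseSeq H) (by
    rintro _ ⟨k, rfl⟩
    refine ⟨_, (hasDerivAt_iff_tendsto_slope.1 (ht2 k
      (uIcc_of_le hab ▸ htI)).hasDerivAt).congr fun s => ?_⟩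
    rw [slope_def_field, real_inner_smul_right, inner_sub_right, div_eq_inv_mul])
  have h4 : HasWeakTimeDerivAt f q' t := hq'
  rwa [h4.weakTimeDeriv_eq]

end WeakDeriv

/-! ### Weak derivatives on an interval -/

/-- A smooth function with compact support in an interval and zero mean is the derivative of such
a function. -/
theorem exists_deriv_eq_of_integral_eq_zero {I : Set ℝ} (hI : I.OrdConnected) {χ : ℝ → ℝ}
    (hχ : ContDiff ℝ ∞ χ) (hc : HasCompactSupport χ) (hs : tsupport χ ⊆ I)
    (h0 : ∫ x, χ x = 0) :
    ∃ φ : ℝ → ℝ, ContDiff ℝ ∞ φ ∧ HasCompactSupport φ ∧ tsupport φ ⊆ I ∧ deriv φ = χ := by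
  rcases (tsupport χ).eq_empty_or_nonempty with he | hne
  · have hz : χ = 0 := tsupport_eq_empty_iff.1 he
    refine ⟨0, contDiff_const, HasCompactSupport.zero, by simp [tsupport], ?_⟩
    rw [hz]
    exact deriv_const' 0
  set a := sInf (tsupport χ)
  set b := sSup (tsupport χ)
  have hK : IsCompact (tsupport χ) := hc
  have ha : a ∈ tsupport χ := hK.sInf_mem hne
  have hb : b ∈ tsupport χ := hK.sSup_mem hne
  have hab : tsupport χ ⊆ Icc a b := fun x hx =>
    ⟨csInf_le hK.bddBelow hx, le_csSup hK.bddAbove hx⟩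
  -- The lower limit lies strictly to the left of the support, so the primitive vanishes to the left
  -- of `a`; to the right of `b` it is the full integral, which is zero.
  have hderiv : ∀ x, HasDerivAt (fun x => ∫ t in (a - 1)..x, χ t) (χ x) x := fun x =>
    (hχ.continuous.integral_hasStrictDerivAt (a - 1) x).hasDerivAt
  have hdeq : deriv (fun x => ∫ t in (a - 1)..x, χ t) = χ := funext fun x => (hderiv x).deriv
  have hzero : ∀ x, x ∉ Icc a b → ∫ t in (a - 1)..x, χ t = 0 := by
    intro x hx
    rcases lt_or_ge x a with hxa | hxa
    · rw [intervalIntegral.integral_congr (g := fun _ => (0 : ℝ)), intervalIntegral.integral_zero]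
      intro t ht
      refine image_eq_zero_of_notMem_tsupport fun h => ?_
      have h1 := (hab h).1
      have h2 : t ≤ max (a - 1) x := ht.2
      have h3 : max (a - 1) x < a := max_lt (by linarith) hxa
      linarith
    · have hxb : b < x := by
        by_contra h
        exact hx ⟨hxa, not_lt.1 h⟩
      rw [intervalIntegral.integral_eq_integral_of_support_subset, h0]
      intro t ht
      have h1 := hab (subset_tsupport χ ht)
      exact ⟨by linarith [h1.1], by linarith [h1.2]⟩
  have hsup : tsupport (fun x => ∫ t in (a - 1)..x, χ t) ⊆ Icc a b :=
    closure_minimal (fun x hx => by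
      by_contra h
      exact hx (hzero x h)) isClosed_Icc
  refine ⟨fun x => ∫ t in (a - 1)..x, χ t, ?_, ?_, hsup.trans (hI.out (hs ha) (hs hb)), hdeq⟩
  · rw [contDiff_infty_iff_deriv, hdeq]
    exact ⟨fun x => (hderiv x).differentiableAt, hχ⟩
  · exact HasCompactSupport.of_support_subset_isCompact isCompact_Icc
      ((subset_tsupport _).trans hsup)

/-- The lemma of du Bois-Reymond. -/
theorem ae_eq_const_of_integral_mul_deriv_eq_zero {I : Set ℝ} (hI : IsOpen I)
    (hoc : I.OrdConnected) (hne : I.Nonempty) {f : ℝ → ℝ} (hf : LocallyIntegrableOn f I)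
    (h : ∀ φ : ℝ → ℝ, ContDiff ℝ ∞ φ → HasCompactSupport φ → tsupport φ ⊆ I →
      ∫ x, f x * deriv φ x = 0) :
    ∃ c, ∀ᵐ x, x ∈ I → f x = c := by
  obtain ⟨x₀, hx₀⟩ := hne
  obtain ⟨r, hr, hrI⟩ := Metric.nhds_basis_closedBall.mem_iff.1 (hI.mem_nhds hx₀)
  let B : ContDiffBump x₀ := ⟨r / 2, r, by positivity, by linarith⟩
  set ρ : ℝ → ℝ := B.normed volume with hρ
  have hρs : ContDiff ℝ ∞ ρ := B.contDiff_normed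
  have hρc : HasCompactSupport ρ := B.hasCompactSupport_normed
  have hρI : tsupport ρ ⊆ I := by
    rw [hρ, B.tsupport_normed_eq]
    exact hrI
  have hρ1 : ∫ x, ρ x = 1 := B.integral_normed
  have hint : ∀ g : ℝ → ℝ, Continuous g → HasCompactSupport g → tsupport g ⊆ I →
      Integrable (fun x => f x * g x) := by
    intro g hg hgc hgI
    have h1 := (hf.integrableOn_compact_subset hgI hgc).mul_continuousOn hg.continuousOn hgc
    refine (integrableOn_iff_integrable_of_support_subset ?_).1 h1
    intro x hx
    exact subset_tsupport g fun h0 => hx (by simp [h0])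
  -- A test function `g` with integral `m` equals `m ρ` plus the derivative of a test function,
  -- because `g - m ρ` has zero mean. Hence `f` tested against `g` gives `m c`, the same as the
  -- constant `c`.
  set c := ∫ x, f x * ρ x with hc
  refine ⟨c, ?_⟩
  have key : ∀ᵐ x, x ∈ I → f x - c = 0 := by
    refine hI.ae_eq_zero_of_integral_contDiff_smul_eq_zero
      (hf.sub ((locallyIntegrable_const c).locallyIntegrableOn I)) ?_
    intro g hg hgc hgI
    set m := ∫ x, g x with hm
    have hgi : Integrable g := hg.continuous.integrable_of_hasCompactSupport hgc
    have hρi : Integrable ρ := hρs.continuous.integrable_of_hasCompactSupport hρc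
    have hsub : tsupport (fun x => g x - m * ρ x) ⊆ tsupport g ∪ tsupport ρ := by
      refine closure_minimal (fun x hx => ?_) ((isClosed_tsupport _).union (isClosed_tsupport _))
      by_contra hcon
      rw [mem_union, not_or] at hcon
      exact hx (by simp [image_eq_zero_of_notMem_tsupport hcon.1,
        image_eq_zero_of_notMem_tsupport hcon.2])
    obtain ⟨φ, hφ1, hφ2, hφ3, hφ4⟩ := exists_deriv_eq_of_integral_eq_zero hoc
      (χ := fun x => g x - m * ρ x) (hg.sub (contDiff_const.mul hρs))
      (HasCompactSupport.of_support_subset_isCompact (hgc.union hρc)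
        ((subset_tsupport _).trans hsub)) (hsub.trans (union_subset hgI hρI)) (by
        rw [integral_sub hgi (hρi.const_mul m), integral_const_mul, hρ1]
        ring)
    have h1 := h φ hφ1 hφ2 hφ3
    rw [hφ4] at h1
    have i1 := hint g hg.continuous hgc hgI
    have i2 := hint ρ hρs.continuous hρc hρI
    have h2 : ∫ x, f x * (g x - m * ρ x) = (∫ x, f x * g x) - m * c := by
      rw [hc, ← integral_const_mul, ← integral_sub i1 (i2.const_mul m)]
      exact integral_congr_ae (Eventually.of_forall fun x => by ring)
    have h3 : ∫ x, g x • (f x - c) = (∫ x, f x * g x) - c * m := by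
      rw [hm, ← integral_const_mul, ← integral_sub i1 (hgi.const_mul c)]
      exact integral_congr_ae (Eventually.of_forall fun x => by simp only [smul_eq_mul]; ring)
    have h1' : ∫ x, f x * (g x - m * ρ x) = 0 := h1
    linarith
  filter_upwards [key] with x hx hxI using sub_eq_zero.1 (hx hxI)

/-- Integration by parts of a primitive against a test function. -/
theorem integral_primitive_mul_deriv {g : ℝ → ℝ} (hg : LocallyIntegrable g) (c : ℝ) {φ : ℝ → ℝ}
    (hφ : ContDiff ℝ ∞ φ) (hφc : HasCompactSupport φ) :
    ∫ x, (c + ∫ t in (0)..x, g t) * deriv φ x = -∫ x, g x * φ x := by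
  obtain ⟨R, hR⟩ := hφc.isCompact.isBounded.subset_ball 0
  -- The maximum makes `r` positive even when `φ = 0`, so that the base point `0` lies in the
  -- interval.
  set r := max R 1
  have hr : 0 < r := lt_max_of_lt_right one_pos
  have hsub : tsupport φ ⊆ Ioo (-r) r := by
    intro x hx
    have h1 : |x| < R := by simpa using hR hx
    exact abs_lt.1 (h1.trans_le (le_max_left _ _))
  have hsupp : ∀ ψ : ℝ → ℝ, (∀ x, φ x = 0 → deriv φ x = 0 → ψ x = 0) →
      ∫ x, ψ x = ∫ x in (-r)..r, ψ x := by
    intro ψ hψ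
    refine (intervalIntegral.integral_eq_integral_of_support_subset fun x hx => ?_).symm
    by_contra hcon
    have hx' : x ∉ tsupport φ := fun h => hcon (Ioo_subset_Ioc_self (hsub h))
    exact hx (hψ x (image_eq_zero_of_notMem_tsupport hx') (image_eq_zero_of_notMem_tsupport
      fun h => hx' (tsupport_deriv_subset h)))
  have hint : IntervalIntegrable g volume (-r) r :=
    (hg.integrableOn_isCompact isCompact_uIcc).intervalIntegrable
  have hG0 := hint.absolutelyContinuousOnInterval_intervalIntegral (c := 0)
    (by rw [uIcc_of_le (by linarith)]; exact ⟨by linarith, hr.le⟩)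
  have hC : AbsolutelyContinuousOnInterval (fun _ : ℝ => c) (-r) r :=
    (LipschitzWith.const c).lipschitzOnWith.absolutelyContinuousOnInterval
  have hG : AbsolutelyContinuousOnInterval (fun x => c + ∫ t in (0)..x, g t) (-r) r := hC.add hG0
  have hΦ : AbsolutelyContinuousOnInterval φ (-r) r :=
    (hφ.of_le (by simp)).contDiffOn.absolutelyContinuousOnInterval
  rw [hsupp _ fun x _ h => by simp [h], hsupp _ fun x h _ => by simp [h],
    hG.integral_mul_deriv_eq_deriv_mul hΦ]
  have e1 : φ r = 0 := image_eq_zero_of_notMem_tsupport fun h => lt_irrefl _ (hsub h).2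
  have e2 : φ (-r) = 0 := image_eq_zero_of_notMem_tsupport fun h => lt_irrefl _ (hsub h).1
  rw [e1, e2, mul_zero, mul_zero, sub_zero, zero_sub]
  congr 1
  refine intervalIntegral.integral_congr_ae ?_
  filter_upwards [LocallyIntegrable.ae_hasDerivAt_integral hg] with x hx _
  have h1 := ((hx 0).const_add c).deriv
  rw [h1]

/-! ### The space `H¹` -/

section H1Basic

variable {Ω : TopologicalSpace.Opens ℝ}

/-- The weak derivative as a continuous linear map. -/
noncomputable def derCLM (Ω : TopologicalSpace.Opens ℝ) : H1 Ω →L[ℝ] Lp ℝ 2 (leb Ω) :=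
  (WithLp.sndL 2 ℝ _ _).comp (H1Submodule Ω).subtypeL

/-- The underlying function as a continuous linear map. -/
noncomputable def valCLM (Ω : TopologicalSpace.Opens ℝ) : H1 Ω →L[ℝ] Lp ℝ 2 (leb Ω) :=
  (WithLp.fstL 2 ℝ _ _).comp (H1Submodule Ω).subtypeL

theorem derCLM_apply (v : H1 Ω) : derCLM Ω v = v.der := rfl

theorem valCLM_apply (v : H1 Ω) : valCLM Ω v = v.val := rfl

theorem integral_mul_eq_inner (f : Lp ℝ 2 (leb Ω)) {ψ : ℝ → ℝ} (hψ : MemLp ψ 2 (leb Ω)) :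
    ∫ x in (Ω : Set ℝ), f x * ψ x = inner ℝ (hψ.toLp ψ) f := by
  rw [L2.inner_def]
  refine integral_congr_ae ?_
  filter_upwards [hψ.coeFn_toLp] with x hx
  simp [hx]

/-- Each test function imposes the equality of two continuous functionals on `L² × L²`, so the space
is an intersection of closed sets. The resulting completeness provides the Riesz representation used
for weak time derivatives. -/
theorem isClosed_H1Submodule (Ω : TopologicalSpace.Opens ℝ) :
    IsClosed (H1Submodule Ω : Set (WithLp 2 (Lp ℝ 2 (leb Ω) × Lp ℝ 2 (leb Ω)))) := by
  have h : (H1Submodule Ω : Set (WithLp 2 (Lp ℝ 2 (leb Ω) × Lp ℝ 2 (leb Ω)))) =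
      ⋂ φ : Test Ω, {F | inner ℝ ((test_deriv_memLp φ).toLp _) (WithLp.fstL 2 ℝ _ _ F) =
        -inner ℝ ((test_memLp φ).toLp _) (WithLp.sndL 2 ℝ _ _ F)} := by
    ext F
    simp only [mem_iInter, mem_ofPred_eq]
    exact forall_congr' fun φ => by
      rw [← integral_mul_eq_inner, ← integral_mul_eq_inner]
      rfl
  rw [h]
  exact isClosed_iInter fun φ => isClosed_eq
    (continuous_const.inner (ContinuousLinearMap.continuous _))
    (continuous_const.inner (ContinuousLinearMap.continuous _)).neg

instance : CompleteSpace (H1 Ω) := (isClosed_H1Submodule Ω).completeSpace_coe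

instance : SecondCountableTopology (H1 Ω) := by
  have : Fact ((1 : ENNReal) ≤ 2) := ⟨by norm_num⟩
  have : Fact ((2 : ENNReal) ≠ ⊤) := ⟨by norm_num⟩
  infer_instance

/-- A smooth function with compact support in `Ω`, as a test function. -/
def mkTest (φ : ℝ → ℝ) (h1 : ContDiff ℝ ∞ φ) (h2 : HasCompactSupport φ)
    (h3 : tsupport φ ⊆ Ω) : Test Ω := ⟨φ, h1, h2, h3⟩

theorem test_contDiff (φ : Test Ω) : ContDiff ℝ ∞ (fun x => φ x) := TestFunctionClass.map_contDiff φ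

theorem test_hasCompactSupport (φ : Test Ω) : HasCompactSupport (fun x => φ x) :=
  TestFunctionClass.map_hasCompactSupport φ

theorem test_tsupport_subset (φ : Test Ω) : tsupport (fun x => φ x) ⊆ Ω :=
  TestFunctionClass.tsupport_map_subset φ

theorem setIntegral_eq_of_tsupport_subset {ψ f : ℝ → ℝ} (h : tsupport ψ ⊆ (Ω : Set ℝ)) :
    ∫ x in (Ω : Set ℝ), f x * ψ x = ∫ x, f x * ψ x := by
  refine setIntegral_eq_integral_of_forall_compl_eq_zero fun x hx => ?_
  rw [image_eq_zero_of_notMem_tsupport fun h' => hx (h h'), mul_zero]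

theorem locallyIntegrableOn_coeFn (f : Lp ℝ 2 (leb Ω)) : LocallyIntegrableOn f Ω :=
  locallyIntegrableOn_of_locallyIntegrable_restrict ((Lp.memLp f).locallyIntegrable (by norm_num))

/-- The weak derivative is determined by the function. -/
theorem H1.der_eq {u v : H1 Ω} (h : u.val = v.val) : u.der = v.der := by
  have h0 : (u - v).val = 0 := by
    rw [← valCLM_apply, map_sub, valCLM_apply, valCLM_apply, h, sub_self]
  suffices hd : (u - v).der = 0 by
    rw [← derCLM_apply, map_sub, derCLM_apply, derCLM_apply] at hd
    exact sub_eq_zero.1 hd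
  have key : ∀ᵐ x, x ∈ (Ω : Set ℝ) → (u - v).der x = 0 := by
    refine Ω.isOpen.ae_eq_zero_of_integral_contDiff_smul_eq_zero
      (locallyIntegrableOn_coeFn _) fun g h1 h2 h3 => ?_
    have h4 := (u - v).2 (mkTest g h1 h2 h3)
    have h5 : ∫ x in (Ω : Set ℝ), (u - v).val x * deriv g x = 0 := by
      refine integral_eq_zero_of_ae ?_
      filter_upwards [Lp.coeFn_zero ℝ 2 (leb Ω)] with x hx
      rw [h0, hx]
      simp
    have h6 : ∫ x in (Ω : Set ℝ), (u - v).val x * deriv g x =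
      -∫ x in (Ω : Set ℝ), (u - v).der x * g x := h4
    rw [h5, setIntegral_eq_of_tsupport_subset h3] at h6
    rw [← neg_zero, h6, neg_neg]
    exact integral_congr_ae (Eventually.of_forall fun x => mul_comm _ _)
  refine Lp.ext ?_
  filter_upwards [(ae_restrict_iff' Ω.isOpen.measurableSet).2 key,
    Lp.coeFn_zero ℝ 2 (leb Ω)] with x hx h'
  rw [hx, h']
  rfl

/-- The element of `H¹(Ω)` with given function and weak derivative. -/
theorem exists_H1 {f g : ℝ → ℝ} (hf : MemLp f 2 (leb Ω)) (hg : MemLp g 2 (leb Ω))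
    (h : ∀ φ : Test Ω, ∫ x in (Ω : Set ℝ), f x * deriv φ x = -∫ x in (Ω : Set ℝ), g x * φ x) :
    ∃ v : H1 Ω, v.val = hf.toLp f ∧ v.der = hg.toLp g := by
  refine ⟨⟨WithLp.toLp 2 (hf.toLp f, hg.toLp g), fun φ => ?_⟩, rfl, rfl⟩
  have h1 : ∫ x in (Ω : Set ℝ), hf.toLp f x * deriv φ x = ∫ x in (Ω : Set ℝ), f x * deriv φ x :=
    integral_congr_ae (hf.coeFn_toLp.mono fun x hx => by simp only [hx])
  have h2 : ∫ x in (Ω : Set ℝ), hg.toLp g x * φ x = ∫ x in (Ω : Set ℝ), g x * φ x :=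
    integral_congr_ae (hg.coeFn_toLp.mono fun x hx => by simp only [hx])
  exact h1.trans ((h φ).trans (by rw [← h2]; rfl))

theorem integral_test_mul_deriv (φ ψ : Test Ω) :
    ∫ x in (Ω : Set ℝ), φ x * deriv ψ x = -∫ x in (Ω : Set ℝ), deriv φ x * ψ x := by
  have h1 : tsupport (deriv ψ) ⊆ (Ω : Set ℝ) :=
    (tsupport_deriv_subset (f := ψ)).trans (test_tsupport_subset ψ)
  rw [setIntegral_eq_of_tsupport_subset h1,
    setIntegral_eq_of_tsupport_subset (test_tsupport_subset ψ)]
  have c1 := (test_contDiff φ).continuous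
  have c2 := (test_contDiff ψ).continuous
  have d1 : Continuous (deriv φ) := (test_contDiff φ).continuous_deriv (by simp)
  have d2 : Continuous (deriv ψ) := (test_contDiff ψ).continuous_deriv (by simp)
  refine integral_mul_deriv_eq_deriv_mul_of_integrable (fun x _ => ?_) (fun x _ => ?_) ?_ ?_ ?_
  · exact ((test_contDiff φ).differentiable (by simp) x).hasDerivAt
  · exact ((test_contDiff ψ).differentiable (by simp) x).hasDerivAt
  · exact (c1.mul d2).integrable_of_hasCompactSupport (test_hasCompactSupport ψ).deriv.mul_left
  · exact (d1.mul c2).integrable_of_hasCompactSupport (test_hasCompactSupport ψ).mul_left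
  · exact (c1.mul c2).integrable_of_hasCompactSupport (test_hasCompactSupport ψ).mul_left

/-- A test function as an element of `H¹(Ω)`. -/
theorem exists_H1_test (φ : Test Ω) :
    ∃ v : H1 Ω, v.val = (test_memLp φ).toLp _ ∧ v.der = (test_deriv_memLp φ).toLp _ :=
  exists_H1 _ _ (integral_test_mul_deriv φ)

/-- Integration over a measurable set of finite measure, as a functional on `L²`. -/
noncomputable def setInt (m : Measure ℝ) {s : Set ℝ} (hs : MeasurableSet s) (hm : m s ≠ ⊤) :
    Lp ℝ 2 m →L[ℝ] ℝ := innerSL ℝ (indicatorConstLp 2 hs hm (1 : ℝ))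

theorem setInt_apply {m : Measure ℝ} {s : Set ℝ} (hs : MeasurableSet s) (hm : m s ≠ ⊤)
    (g : Lp ℝ 2 m) : setInt m hs hm g = ∫ x in s, g x ∂m :=
  L2.inner_indicatorConstLp_one hs hm g

/-- Cauchy–Schwarz against an indicator. The bounds for primitives and boundary values rest on it.
-/
theorem abs_setIntegral_le {m : Measure ℝ} {s : Set ℝ} (hs : MeasurableSet s) (hm : m s ≠ ⊤)
    (g : Lp ℝ 2 m) : |∫ x in s, g x ∂m| ≤ √(m.real s) * ‖g‖ := by
  rw [← setInt_apply hs hm]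
  refine (abs_real_inner_le_norm (indicatorConstLp 2 hs hm (1 : ℝ)) g).trans (le_of_eq ?_)
  rw [norm_indicatorConstLp (by norm_num) (by norm_num), Real.sqrt_eq_rpow]
  simp

theorem norm_der_le (v : H1 Ω) : ‖v.der‖ ≤ ‖v‖ := WithLp.norm_snd_le _ v.1

theorem norm_val_le (v : H1 Ω) : ‖v.val‖ ≤ ‖v‖ := WithLp.norm_fst_le _ v.1

end H1Basic

/-! ### Primitives of `L²` functions on `(0, L)` -/

section Primitive

variable {L : ℝ}

theorem coe_body (L : ℝ) : (body L : Set ℝ) = Ioo 0 L := rfl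

instance : IsFiniteMeasure (leb (body L)) :=
  ⟨by rw [leb, Measure.restrict_apply_univ, coe_body]; exact measure_Ioo_lt_top⟩

theorem leb_real_le (hL : 0 < L) (s : Set ℝ) : (leb (body L)).real s ≤ L := by
  refine (measureReal_mono (subset_univ s)).trans ?_
  rw [measureReal_restrict_apply_univ, coe_body, Real.volume_real_Ioo]
  simp [hL.le]

/-- The primitive vanishing at `0` of a function on `(0, L)`. -/
noncomputable def prim (L : ℝ) (g : ℝ → ℝ) (x : ℝ) : ℝ := ∫ t in (0)..x, (Ioo 0 L).indicator g t

theorem prim_eq (g : ℝ → ℝ) {x : ℝ} (hx : 0 ≤ x) :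
    prim L g x = ∫ t in Ioc 0 x, g t ∂leb (body L) := by
  rw [prim, intervalIntegral.integral_of_le hx, setIntegral_indicator measurableSet_Ioo,
    Measure.restrict_restrict measurableSet_Ioc, coe_body]

theorem integrable_indicator_Ioo (g : Lp ℝ 2 (leb (body L))) :
    Integrable ((Ioo 0 L).indicator g) := by
  rw [integrable_indicator_iff measurableSet_Ioo]
  exact (Lp.memLp g).integrable (by norm_num)

theorem continuous_prim (g : Lp ℝ 2 (leb (body L))) : Continuous (prim L g) :=
  intervalIntegral.continuous_primitive (fun _ _ => (integrable_indicator_Ioo g).intervalIntegrable)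
    0

theorem abs_prim_le (hL : 0 < L) (g : Lp ℝ 2 (leb (body L))) {x : ℝ} (hx : 0 ≤ x) :
    |prim L g x| ≤ √L * ‖g‖ := by
  rw [prim_eq _ hx]
  refine (abs_setIntegral_le measurableSet_Ioc (measure_ne_top _ _) g).trans ?_
  exact mul_le_mul_of_nonneg_right (Real.sqrt_le_sqrt (leb_real_le hL _)) (norm_nonneg _)

theorem ae_body : ∀ᵐ x ∂leb (body L), x ∈ Ioo 0 L := ae_restrict_mem measurableSet_Ioo

theorem memLp_prim (hL : 0 < L) (g : Lp ℝ 2 (leb (body L))) : MemLp (prim L g) 2 (leb (body L)) :=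
  MemLp.of_bound (continuous_prim g).aestronglyMeasurable (√L * ‖g‖)
    (ae_body.mono fun _ hx => abs_prim_le hL g hx.1.le)

/-- The operator that maps a function to its primitive vanishing at `0`. -/
noncomputable def primCLM (hL : 0 < L) : Lp ℝ 2 (leb (body L)) →L[ℝ] Lp ℝ 2 (leb (body L)) :=
  LinearMap.mkContinuous
    { toFun := fun g => (memLp_prim hL g).toLp _
      map_add' := fun f g => by
        refine Lp.ext ?_
        filter_upwards [(memLp_prim hL (f + g)).coeFn_toLp, (memLp_prim hL f).coeFn_toLp,
          (memLp_prim hL g).coeFn_toLp, Lp.coeFn_add ((memLp_prim hL f).toLp _)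
          ((memLp_prim hL g).toLp _), ae_body (L := L)] with x h1 h2 h3 h4 hx
        rw [h1, h4, Pi.add_apply, h2, h3, prim_eq _ hx.1.le, prim_eq _ hx.1.le, prim_eq _ hx.1.le,
          ← setInt_apply measurableSet_Ioc (measure_ne_top _ _),
          ← setInt_apply measurableSet_Ioc (measure_ne_top _ _),
          ← setInt_apply measurableSet_Ioc (measure_ne_top _ _), map_add]
      map_smul' := fun c g => by
        refine Lp.ext ?_
        filter_upwards [(memLp_prim hL (c • g)).coeFn_toLp,
          (memLp_prim hL g).coeFn_toLp, Lp.coeFn_smul c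
          ((memLp_prim hL g).toLp _), ae_body (L := L)] with x h1 h3 h4 hx
        rw [h1, RingHom.id_apply, h4, Pi.smul_apply, h3, prim_eq _ hx.1.le, prim_eq _ hx.1.le,
          ← setInt_apply measurableSet_Ioc (measure_ne_top _ _),
          ← setInt_apply measurableSet_Ioc (measure_ne_top _ _), map_smul] }
    (measureUnivNNReal (leb (body L)) ^ (2 : ENNReal).toReal⁻¹ * √L) fun g => by
      rw [mul_assoc]
      refine Lp.norm_le_of_ae_bound (by positivity) ?_
      filter_upwards [(memLp_prim hL g).coeFn_toLp, ae_body (L := L)] with x h1 hx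
      simp only [LinearMap.coe_mk, AddHom.coe_mk]
      rw [h1]
      exact abs_prim_le hL g hx.1.le

theorem coeFn_primCLM (hL : 0 < L) (g : Lp ℝ 2 (leb (body L))) :
    primCLM hL g =ᵐ[leb (body L)] prim L g := (memLp_prim hL g).coeFn_toLp

/-- Every `L²` function is the weak derivative of its primitives. -/
theorem exists_H1_prim (hL : 0 < L) (c : ℝ) (g : Lp ℝ 2 (leb (body L))) :
    ∃ v : H1 (body L), (∀ᵐ x ∂leb (body L), v.val x = c + prim L g x) ∧ v.der = g := by
  have hm : MemLp (fun x => c + prim L g x) 2 (leb (body L)) :=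
    (memLp_const c).add (memLp_prim hL g)
  obtain ⟨v, hv1, hv2⟩ := exists_H1 hm (Lp.memLp g) fun φ => by
    have hd : tsupport (deriv φ) ⊆ (body L : Set ℝ) :=
      (tsupport_deriv_subset (f := φ)).trans (test_tsupport_subset φ)
    rw [setIntegral_eq_of_tsupport_subset hd]
    refine (integral_primitive_mul_deriv (integrable_indicator_Ioo g).locallyIntegrable c
      (test_contDiff φ) (test_hasCompactSupport φ)).trans ?_
    rw [coe_body, ← integral_indicator measurableSet_Ioo]
    congr 2 with x
    by_cases hx : x ∈ Ioo 0 L <;> simp [hx]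
  refine ⟨v, ?_, hv2.trans (Lp.toLp_coeFn _ _)⟩
  rw [hv1]
  exact hm.coeFn_toLp

theorem prim_deriv_test (φ : Test (body L)) (x : ℝ) : prim L (deriv φ) x = φ x := by
  have h0 : φ 0 = 0 := image_eq_zero_of_notMem_tsupport (f := φ) fun h =>
    lt_irrefl _ (test_tsupport_subset φ h).1
  rw [prim, intervalIntegral.integral_congr (g := deriv φ), intervalIntegral.integral_deriv_eq_sub,
    h0, sub_zero]
  · exact fun y _ => (test_contDiff φ).differentiable (by simp) y
  · exact ((test_contDiff φ).continuous_deriv (by simp)).intervalIntegrable _ _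
  · intro y _
    by_cases h : y ∈ Ioo 0 L
    · simp [h]
    · rw [indicator_of_notMem h]
      exact (image_eq_zero_of_notMem_tsupport fun h' =>
        h (test_tsupport_subset φ (tsupport_deriv_subset (f := φ) h'))).symm

theorem setIntegral_deriv_test (φ : Test (body L)) : ∫ x, deriv φ x ∂leb (body L) = 0 := by
  -- The constant function `1` is a primitive of zero; integrating by parts against it gives the
  -- mean of the derivative.
  have h := integral_primitive_mul_deriv (g := fun _ => 0) (by
    exact (integrable_zero ℝ ℝ volume).locallyIntegrable) 1 (test_contDiff φ)
    (test_hasCompactSupport φ)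
  have hd : tsupport (deriv φ) ⊆ (body L : Set ℝ) :=
    (tsupport_deriv_subset (f := φ)).trans (test_tsupport_subset φ)
  have h1 := setIntegral_eq_of_tsupport_subset (f := fun _ => 1) hd
  simp only [one_mul] at h1
  simp only [intervalIntegral.integral_zero, add_zero, one_mul, zero_mul, integral_zero,
    neg_zero] at h
  exact h1.trans h

/-- Integration over `(0, L)`. -/
noncomputable def totalInt (L : ℝ) : Lp ℝ 2 (leb (body L)) →L[ℝ] ℝ :=
  setInt (leb (body L)) MeasurableSet.univ (measure_ne_top _ _)

theorem totalInt_apply (g : Lp ℝ 2 (leb (body L))) : totalInt L g = ∫ x in Ioo 0 L, g x := by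
  rw [totalInt, setInt_apply, Measure.restrict_univ]
  rfl

/-- Elements of `H¹₀` are primitives of functions with zero mean. -/
theorem H10.val_eq (hL : 0 < L) {z : H1 (body L)} (hz : z ∈ H10 (body L)) :
    z.val = primCLM hL z.der ∧ totalInt L z.der = 0 := by
  -- Both conditions are continuous in the `H¹` norm, so it is enough to check them on test
  -- functions, whose closure is `H10`.
  let C : Set (H1 (body L)) := {z | valCLM _ z = primCLM hL (derCLM _ z) ∧
    totalInt L (derCLM _ z) = 0}
  have hC : IsClosed C :=
    (isClosed_eq (valCLM _).continuous ((primCLM hL).comp (derCLM _)).continuous).inter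
      (isClosed_eq ((totalInt L).comp (derCLM _)).continuous continuous_const)
  refine closure_minimal (t := C) ?_ hC hz
  rintro v ⟨φ, hφ⟩
  obtain ⟨v', h1, h2⟩ := exists_H1_test φ
  have hval : v.val = v'.val := by
    rw [h1]
    refine Lp.ext ?_
    filter_upwards [hφ, (test_memLp φ).coeFn_toLp] with x hx h'
    rw [hx, h']
  have hder : v.der = (test_deriv_memLp φ).toLp _ := (H1.der_eq hval).trans h2
  have hae : ∀ᵐ x ∂leb (body L), v.der x = deriv φ x := by
    rw [hder]
    exact (test_deriv_memLp φ).coeFn_toLp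
  constructor
  · change v.val = primCLM hL v.der
    refine Lp.ext ?_
    filter_upwards [hφ, coeFn_primCLM hL v.der, ae_body (L := L)] with x hx h' hxm
    rw [hx, h', ← prim_deriv_test φ x, prim_eq _ hxm.1.le, prim_eq _ hxm.1.le]
    exact (integral_congr_ae (ae_restrict_of_ae hae)).symm
  · change totalInt L v.der = 0
    rw [totalInt_apply]
    exact (integral_congr_ae hae).trans (setIntegral_deriv_test φ)

/-- The elements of `H¹(Ω)` that are test functions. -/
def testSubmodule (Ω : TopologicalSpace.Opens ℝ) : Submodule ℝ (H1 Ω) where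
  carrier := {v | ∃ φ : Test Ω, ∀ᵐ x ∂leb Ω, v.val x = φ x}
  zero_mem' := ⟨0, (Lp.coeFn_zero ℝ 2 (leb Ω)).mono fun x hx => hx⟩
  add_mem' := by
    rintro u v ⟨φ, hφ⟩ ⟨ψ, hψ⟩
    refine ⟨φ + ψ, ?_⟩
    filter_upwards [hφ, hψ, Lp.coeFn_add u.val v.val] with x h1 h2 h3
    rw [← valCLM_apply, map_add, valCLM_apply, valCLM_apply, h3, Pi.add_apply, h1, h2]
    rfl
  smul_mem' := by
    rintro c v ⟨φ, hφ⟩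
    refine ⟨c • φ, ?_⟩
    filter_upwards [hφ, Lp.coeFn_smul c v.val] with x h1 h3
    rw [← valCLM_apply, map_smul, valCLM_apply, h3, Pi.smul_apply, h1]
    rfl

/-- A square integrable function that is orthogonal to the derivatives of the test functions is
constant. -/
theorem ae_eq_const_of_orthogonal (hL : 0 < L) {h : Lp ℝ 2 (leb (body L))}
    (hh : ∀ φ : Test (body L), ∫ x in Ioo 0 L, h x * deriv φ x = 0) :
    ∃ c, ∀ᵐ x ∂leb (body L), h x = c := by
  obtain ⟨c, hc⟩ := ae_eq_const_of_integral_mul_deriv_eq_zero isOpen_Ioo ordConnected_Ioo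
    (nonempty_Ioo.2 hL) (locallyIntegrableOn_coeFn h) fun φ h1 h2 h3 => by
      have h4 := hh (mkTest φ h1 h2 h3)
      rw [← h4]
      exact (setIntegral_eq_of_tsupport_subset (Ω := body L) (tsupport_deriv_subset.trans h3)).symm
  exact ⟨c, (ae_restrict_iff' measurableSet_Ioo).2 hc⟩

/-- Every square integrable function with zero mean is the derivative of an element of `H¹₀`. -/
theorem exists_H10_der_eq (hL : 0 < L) {g : Lp ℝ 2 (leb (body L))} (hg : totalInt L g = 0) :
    ∃ z ∈ H10 (body L), z.der = g := by
  set N : Submodule ℝ (Lp ℝ 2 (leb (body L))) :=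
    (testSubmodule (body L)).map (derCLM (body L)).toLinearMap with hN
  -- Density by duality: a function orthogonal to the derivatives of all test functions is constant,
  -- hence orthogonal to `g`, which has zero mean. So `g` is in the double orthogonal.
  have hgN : g ∈ N.topologicalClosure := by
    rw [← Submodule.orthogonal_orthogonal_eq_closure, Submodule.mem_orthogonal]
    intro h hh
    obtain ⟨c, hc⟩ := ae_eq_const_of_orthogonal hL (h := h) fun φ => by
      obtain ⟨v, h1, h2⟩ := exists_H1_test φ
      have hv : v ∈ testSubmodule (body L) := ⟨φ, h1 ▸ (test_memLp φ).coeFn_toLp⟩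
      have h3 := (Submodule.mem_orthogonal _ _).1 hh v.der (Submodule.mem_map_of_mem hv)
      rw [h2, ← integral_mul_eq_inner] at h3
      exact h3
    rw [L2.inner_def]
    have h4 : ∫ x in Ioo 0 L, g x * c = 0 := by
      rw [integral_mul_const, ← totalInt_apply, hg, zero_mul]
    rw [← h4]
    exact integral_congr_ae (hc.mono fun x hx => by simp [hx])
  obtain ⟨q, hqN, hq⟩ := mem_closure_iff_seq_limit.1 hgN
  choose v hv hvq using hqN
  have hvH : ∀ n, v n ∈ H10 (body L) := fun n => subset_closure (hv n)
  obtain ⟨z, hz1, hz2⟩ := exists_H1_prim hL 0 g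
  have hz3 : z.val = primCLM hL g := by
    refine Lp.ext ?_
    filter_upwards [hz1, coeFn_primCLM hL g] with x h1 h2
    rw [h1, h2, zero_add]
  refine ⟨z, ?_, hz2⟩
  -- Only the derivatives of the approximations are known to converge. Their values are primitives
  -- of these derivatives, and the primitive operator is continuous on `L²`, so convergence holds in
  -- `H¹`.
  have hlim : Tendsto v atTop (𝓝 z) := by
    rw [tendsto_subtype_rng]
    have h1 : Tendsto (fun n => WithLp.toLp 2 (primCLM hL (q n), q n)) atTop
        (𝓝 (WithLp.toLp 2 (primCLM hL g, g))) :=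
      ((WithLp.prod_continuous_toLp 2 _ _).tendsto _).comp
        ((((primCLM hL).continuous.tendsto g).comp hq).prodMk_nhds hq)
    have h2 : ∀ n, (v n : WithLp 2 (Lp ℝ 2 (leb (body L)) × Lp ℝ 2 (leb (body L)))) =
        WithLp.toLp 2 (primCLM hL (q n), q n) := fun n => by
      have h3 : (v n).der = q n := hvq n
      have h4 := (H10.val_eq hL (hvH n)).1
      rw [h3] at h4
      rw [← h4, ← h3]
      rfl
    have h5 : (z : WithLp 2 (Lp ℝ 2 (leb (body L)) × Lp ℝ 2 (leb (body L)))) =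
        WithLp.toLp 2 (primCLM hL g, g) := by
      rw [← hz3, ← hz2]
      rfl
    rw [h5]
    exact h1.congr fun n => (h2 n).symm
  exact isClosed_closure.mem_of_tendsto hlim (Eventually.of_forall hvH)

end Primitive

/-! ### Boundary values -/

section Boundary

variable {L : ℝ}

theorem prim_eq_setInt (g : Lp ℝ 2 (leb (body L))) {x : ℝ} (hx : 0 ≤ x) :
    prim L g x = setInt (leb (body L)) measurableSet_Ioc (measure_ne_top _ (Ioc 0 x)) g := by
  rw [prim_eq _ hx, setInt_apply]

theorem leb_top : leb ⊤ = volume := by simp [leb]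

theorem ae_of_ae_leb_top {p : ℝ → Prop} (h : ∀ᵐ x ∂leb ⊤, p x) : ∀ᵐ x, p x := by
  rwa [leb_top] at h

theorem memLp_volume (f : Lp ℝ 2 (leb ⊤)) : MemLp f 2 (volume : Measure ℝ) := by
  have h : ∀ g : ℝ → ℝ, MemLp g 2 (leb ⊤) → MemLp g 2 (volume : Measure ℝ) := fun g hg => by
    rwa [leb_top] at hg
  exact h _ (Lp.memLp f)

theorem setIntegral_leb_top (s : Set ℝ) (f : ℝ → ℝ) : ∫ x in s, f x ∂leb ⊤ = ∫ x in s, f x := by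
  rw [leb_top]

theorem locallyIntegrable_coeFn (f : Lp ℝ 2 (leb ⊤)) : LocallyIntegrable f volume :=
  (memLp_volume f).locallyIntegrable (by norm_num)

/-- An element of `H¹(ℝ)` is a primitive of its weak derivative. -/
theorem exists_ae_eq_primitive (w : H1 ⊤) :
    ∃ c, ∀ᵐ x, w.val x = c + ∫ t in (0)..x, w.der t := by
  have hg := locallyIntegrable_coeFn w.der
  have hv := locallyIntegrable_coeFn w.val
  have hcont : Continuous fun x => ∫ t in (0)..x, w.der t :=
    intervalIntegral.continuous_primitive (fun a b =>
      (hg.integrableOn_isCompact isCompact_uIcc).intervalIntegrable) 0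
  obtain ⟨c, hc⟩ := ae_eq_const_of_integral_mul_deriv_eq_zero isOpen_univ ordConnected_univ
    univ_nonempty (f := fun x => w.val x - ∫ t in (0)..x, w.der t)
    ((hv.sub hcont.locallyIntegrable).locallyIntegrableOn univ) fun φ h1 h2 h3 => by
      have h4 := w.2 (mkTest (Ω := ⊤) φ h1 h2 (subset_univ _))
      have h5 : ∫ x, w.val x * deriv φ x = -∫ x, w.der x * φ x := by
        have h6 : ∫ x in ((⊤ : TopologicalSpace.Opens ℝ) : Set ℝ), w.val x * deriv φ x =
          -∫ x in ((⊤ : TopologicalSpace.Opens ℝ) : Set ℝ), w.der x * φ x := h4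
        simpa using h6
      have h7 := integral_primitive_mul_deriv hg 0 h1 h2
      simp only [zero_add] at h7
      have hd : Continuous (deriv φ) := h1.continuous_deriv (by simp)
      have i1 : Integrable fun x => w.val x * deriv φ x := by
        simpa [mul_comm] using hv.integrable_smul_left_of_hasCompactSupport hd h2.deriv
      have i2 : Integrable fun x => (∫ t in (0)..x, w.der t) * deriv φ x :=
        (hcont.mul hd).integrable_of_hasCompactSupport h2.deriv.mul_left
      simp only [sub_mul]
      rw [integral_sub i1 i2, h5, h7, sub_self]
  refine ⟨c, ?_⟩
  filter_upwards [hc] with x hx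
  linarith [hx (mem_univ x)]

/-- The value at `0` of the continuous representative. -/
noncomputable def trace0 (w : H1 ⊤) : ℝ := (exists_ae_eq_primitive w).choose

/-- The continuous representative. -/
noncomputable def rep (w : H1 ⊤) (x : ℝ) : ℝ := trace0 w + ∫ t in (0)..x, w.der t

theorem val_ae_eq_rep (w : H1 ⊤) : ∀ᵐ x, w.val x = rep w x :=
  (exists_ae_eq_primitive w).choose_spec

theorem isContinuousRep_rep (w : H1 ⊤) : IsContinuousRep w (rep w) :=
  ⟨continuous_const.add (intervalIntegral.continuous_primitive (fun _ _ =>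
    ((locallyIntegrable_coeFn w.der).integrableOn_isCompact isCompact_uIcc).intervalIntegrable) 0),
    val_ae_eq_rep w⟩

theorem rep_zero (w : H1 ⊤) : rep w 0 = trace0 w := by simp [rep]

/-- The elongation of `(0, L)` under a displacement of the line. -/
noncomputable def stretch (L : ℝ) : H1 ⊤ →L[ℝ] ℝ :=
  (setInt (leb ⊤) (measurableSet_Ioo (a := 0) (b := L))
    (by rw [leb_top]; exact measure_Ioo_lt_top.ne)).comp (derCLM ⊤)

theorem stretch_apply (w : H1 ⊤) : stretch L w = ∫ x in Ioo 0 L, w.der x := by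
  have h : stretch L w = ∫ x in Ioo 0 L, w.der x ∂leb ⊤ := setInt_apply _ _ _
  rw [h, setIntegral_leb_top]

theorem rep_right (hL : 0 < L) (w : H1 ⊤) : rep w L = trace0 w + stretch L w := by
  rw [rep, stretch_apply, intervalIntegral.integral_of_le hL.le, integral_Ioc_eq_integral_Ioo]

theorem abs_setIntegral_top_le (hL : 0 < L) {s : Set ℝ} (hs : MeasurableSet s) (hsL : s ⊆ Ioc 0 L)
    (g : Lp ℝ 2 (leb ⊤)) : |∫ x in s, g x| ≤ √L * ‖g‖ := by
  have hle : volume s ≤ ENNReal.ofReal L := by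
    simpa using measure_mono (μ := volume) hsL
  have hm : (leb ⊤) s ≠ ⊤ := by
    rw [leb_top]
    exact ne_top_of_le_ne_top ENNReal.ofReal_ne_top hle
  have h := abs_setIntegral_le hs hm g
  have hr : (leb ⊤).real s ≤ L := by
    rw [leb_top, measureReal_def]
    exact ENNReal.toReal_le_of_le_ofReal hL.le hle
  have h' : |∫ x in s, g x| ≤ √((leb ⊤).real s) * ‖g‖ := by
    rwa [setIntegral_leb_top] at h
  exact h'.trans (mul_le_mul_of_nonneg_right (Real.sqrt_le_sqrt hr) (norm_nonneg _))

/-- The constant `trace0` comes from an existence statement, so linearity has to be read off from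
the representations. These hold almost everywhere, and comparing them at one common point suffices.
-/
theorem trace0_sub (v w : H1 ⊤) : trace0 (v - w) = trace0 v - trace0 w := by
  have h1 : ∀ᵐ x, (v - w).val x = v.val x - w.val x := 
    ae_of_ae_leb_top (Lp.coeFn_sub v.val w.val)
  have h2 : ∀ᵐ x, (v - w).der x = v.der x - w.der x := 
    ae_of_ae_leb_top (Lp.coeFn_sub v.der w.der)
  obtain ⟨x, e1, e2, e3, e4⟩ :=
    (h1.and ((val_ae_eq_rep (v - w)).and ((val_ae_eq_rep v).and (val_ae_eq_rep w)))).exists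
  have e5 : ∫ t in (0)..x, (v - w).der t = (∫ t in (0)..x, v.der t) - ∫ t in (0)..x, w.der t := by
    rw [← intervalIntegral.integral_sub]
    · exact intervalIntegral.integral_congr_ae (h2.mono fun y hy _ => hy)
    · exact ((locallyIntegrable_coeFn _).integrableOn_isCompact isCompact_uIcc).intervalIntegrable
    · exact ((locallyIntegrable_coeFn _).integrableOn_isCompact isCompact_uIcc).intervalIntegrable
  rw [e2, e3, e4, rep, rep, rep, e5] at e1
  linarith

/-- Averaging over `(0, L)` the representation of `w` as a constant plus a primitive isolates the
constant; the two remaining integrals are bounded by Cauchy–Schwarz. This is the Sobolev embedding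
at one point, and it carries the absolute continuity of `w` over to its boundary value. -/
theorem abs_trace0_le (hL : 0 < L) (w : H1 ⊤) : |trace0 w| ≤ (√L / L + √L) * ‖w‖ := by
  have hprim : ∀ x ∈ Ioo 0 L, |∫ t in (0)..x, w.der t| ≤ √L * ‖w‖ := fun x hx => by
    rw [intervalIntegral.integral_of_le hx.1.le]
    exact (abs_setIntegral_top_le hL measurableSet_Ioc (Ioc_subset_Ioc_right hx.2.le) _).trans
      (mul_le_mul_of_nonneg_left (norm_der_le w) (Real.sqrt_nonneg _))
  have h1 : |∫ x in Ioo 0 L, w.val x| ≤ √L * ‖w‖ :=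
    (abs_setIntegral_top_le hL measurableSet_Ioo Ioo_subset_Ioc_self _).trans
      (mul_le_mul_of_nonneg_left (norm_val_le w) (Real.sqrt_nonneg _))
  have hcont := (isContinuousRep_rep w).1.sub (continuous_const (y := trace0 w))
  have hcont' : Continuous fun x => ∫ t in (0)..x, w.der t := by
    refine hcont.congr fun x => ?_
    simp [rep]
  have h2 : ∫ x in Ioo 0 L, w.val x =
      L * trace0 w + ∫ x in Ioo 0 L, ∫ t in (0)..x, w.der t := by
    rw [integral_congr_ae (ae_restrict_of_ae (val_ae_eq_rep w))]
    simp only [rep]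
    rw [integral_add (integrable_const _)
      ((hcont'.integrableOn_Icc (a := 0) (b := L)).mono_set Ioo_subset_Icc_self)]
    simp [hL.le]
  have h3 : ‖∫ x in Ioo 0 L, ∫ t in (0)..x, w.der t‖ ≤
      (√L * ‖w‖) * volume.real (Ioo 0 L) :=
    norm_setIntegral_le_of_norm_le_const measure_Ioo_lt_top fun x hx => hprim x hx
  have h4 : volume.real (Ioo 0 L) = L := by simp [hL.le]
  rw [h4, Real.norm_eq_abs] at h3
  have h5 : L * |trace0 w| ≤ √L * ‖w‖ + √L * ‖w‖ * L := by
    rw [← abs_of_pos hL, ← abs_mul, abs_of_pos hL]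
    have h6 : L * trace0 w = (∫ x in Ioo 0 L, w.val x) -
      ∫ x in Ioo 0 L, ∫ t in (0)..x, w.der t := by linarith
    rw [h6]
    exact (abs_sub _ _).trans (add_le_add h1 h3)
  have h7 : (√L / L + √L) * ‖w‖ = (√L * ‖w‖ + √L * ‖w‖ * L) / L := by
    field_simp
  rw [h7, le_div_iff₀ hL]
  linarith

theorem abs_trace0_sub_le (hL : 0 < L) (v w : H1 ⊤) :
    |trace0 v - trace0 w| ≤ (√L / L + √L) * dist v w := by
  rw [← trace0_sub, dist_eq_norm]
  exact abs_trace0_le hL _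

/-- The weak derivative of a function on the line, restricted to `(0, L)`. -/
noncomputable def derBody (L : ℝ) (w : H1 ⊤) : Lp ℝ 2 (leb (body L)) :=
  ((memLp_volume w.der).restrict (Ioo 0 L)).toLp _

theorem coeFn_derBody (w : H1 ⊤) : derBody L w =ᵐ[leb (body L)] w.der :=
  ((memLp_volume w.der).restrict (Ioo 0 L)).coeFn_toLp

theorem totalInt_derBody (w : H1 ⊤) : totalInt L (derBody L w) = stretch L w := by
  rw [totalInt_apply, stretch_apply]
  exact integral_congr_ae (coeFn_derBody w)

theorem rep_eq_prim (w : H1 ⊤) {x : ℝ} (hx : x ∈ Ioo 0 L) :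
    rep w x = trace0 w + prim L (derBody L w) x := by
  rw [rep, prim_eq _ hx.1.le, intervalIntegral.integral_of_le hx.1.le]
  congr 1
  rw [integral_congr_ae (ae_restrict_of_ae (coeFn_derBody w)),
    Measure.restrict_restrict measurableSet_Ioc, coe_body,
    inter_eq_left.2 (show Ioc 0 x ⊆ Ioo 0 L from fun y hy => ⟨hy.1, hy.2.trans_lt hx.2⟩)]

/-- An admissible displacement is a primitive of its derivative, with the boundary values of the
imposed displacement. -/
theorem DirichletClass.val_eq (hL : 0 < L) {w : H1 ⊤} {v : H1 (body L)} (h : DirichletClass w v) :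
    (∀ᵐ x ∂leb (body L), v.val x = trace0 w + prim L v.der x) ∧
      totalInt L v.der = stretch L w := by
  obtain ⟨z, hz, hzv⟩ := h
  obtain ⟨hz1, hz2⟩ := H10.val_eq hL hz
  obtain ⟨v', h1, h2⟩ := exists_H1_prim hL (trace0 w) (derBody L w + z.der)
  have hval : v.val = v'.val := by
    refine Lp.ext ?_
    filter_upwards [hzv, h1, ae_restrict_of_ae (val_ae_eq_rep w), coeFn_primCLM hL z.der,
      ae_body (L := L)] with x e1 e2 e3 e4 hx
    rw [e1, e2, e3, hz1, e4, rep_eq_prim w hx, prim_eq_setInt _ hx.1.le, prim_eq_setInt _ hx.1.le,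
      prim_eq_setInt _ hx.1.le, map_add, add_assoc]
  have hder : v.der = derBody L w + z.der := (H1.der_eq hval).trans h2
  refine ⟨?_, ?_⟩
  · rw [hval, hder]
    exact h1
  · rw [hder, map_add, hz2, add_zero, totalInt_derBody]

/-- There is an admissible displacement with any given derivative with the right mean. -/
theorem exists_dirichletClass (hL : 0 < L) {w : H1 ⊤} {g : Lp ℝ 2 (leb (body L))}
    (hg : totalInt L g = stretch L w) :
    ∃ v : H1 (body L), DirichletClass w v ∧ v.der = g := by
  obtain ⟨z, hz, hzd⟩ := exists_H10_der_eq hL (g := g - derBody L w)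
    (by rw [map_sub, hg, totalInt_derBody, sub_self])
  obtain ⟨v, h1, h2⟩ := exists_H1_prim hL (trace0 w) g
  refine ⟨v, ⟨z, hz, ?_⟩, h2⟩
  have hz1 := (H10.val_eq hL hz).1
  filter_upwards [h1, ae_restrict_of_ae (val_ae_eq_rep w), coeFn_primCLM hL z.der,
      ae_body (L := L)] with x e1 e3 e4 hx
  rw [e1, e3, hz1, e4, hzd, rep_eq_prim w hx, prim_eq_setInt _ hx.1.le, prim_eq_setInt _ hx.1.le,
      prim_eq_setInt _ hx.1.le, map_sub]
  ring

end Boundary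

/-! ### The scalar evolution of the compliance -/

section Scalar

/-- The variation of an absolutely continuous function. -/
noncomputable def absVar (d : ℝ → ℝ) (t : ℝ) : ℝ := ∫ s in (0)..t, |deriv d s|

variable {d C : ℝ → ℝ} {T : ℝ}

theorem _root_.AbsolutelyContinuousOnInterval.mono_Icc (hd : AbsolutelyContinuousOnInterval d 0 T)
    {s t : ℝ} (hs : s ∈ Icc 0 T) (ht : t ∈ Icc 0 T) : AbsolutelyContinuousOnInterval d s t :=
  hd.mono (by
    rw [uIcc_of_le (hs.1.trans hs.2)]
    exact ordConnected_Icc.uIcc_subset hs ht)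

theorem intervalIntegrable_abs_deriv (hd : AbsolutelyContinuousOnInterval d 0 T) {s t : ℝ}
    (hs : s ∈ Icc 0 T) (ht : t ∈ Icc 0 T) :
    IntervalIntegrable (fun r => |deriv d r|) volume s t :=
  (hd.mono_Icc hs ht).intervalIntegrable_deriv.abs

theorem absVar_sub (hd : AbsolutelyContinuousOnInterval d 0 T) {s t : ℝ} (hs : s ∈ Icc 0 T)
    (ht : t ∈ Icc 0 T) : absVar d t - absVar d s = ∫ r in s..t, |deriv d r| := by
  have h0 : (0 : ℝ) ∈ Icc 0 T := left_mem_Icc.2 (hs.1.trans hs.2)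
  exact intervalIntegral.integral_interval_sub_left (intervalIntegrable_abs_deriv hd h0 ht)
    (intervalIntegrable_abs_deriv hd h0 hs)

theorem absVar_mono (hd : AbsolutelyContinuousOnInterval d 0 T) {s t : ℝ} (hs : s ∈ Icc 0 T)
    (ht : t ∈ Icc 0 T) (hst : s ≤ t) : absVar d s ≤ absVar d t := by
  rw [← sub_nonneg, absVar_sub hd hs ht]
  exact intervalIntegral.integral_nonneg hst fun _ _ => abs_nonneg _

theorem absVar_absolutelyContinuous (hT : 0 ≤ T) (hd : AbsolutelyContinuousOnInterval d 0 T) :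
    AbsolutelyContinuousOnInterval (absVar d) 0 T :=
  (intervalIntegrable_abs_deriv hd (left_mem_Icc.2 hT)
    (right_mem_Icc.2 hT)).absolutelyContinuousOnInterval_intervalIntegral left_mem_uIcc

theorem abs_sub_le_absVar_sub (hd : AbsolutelyContinuousOnInterval d 0 T) {s t : ℝ}
    (hs : s ∈ Icc 0 T) (ht : t ∈ Icc 0 T) (hst : s ≤ t) : |d t - d s| ≤ absVar d t - absVar d s := by
  rw [absVar_sub hd hs ht, ← (hd.mono_Icc hs ht).integral_deriv_eq_sub]
  exact intervalIntegral.abs_integral_le_integral_abs hst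

theorem dist_le_dist_absVar (hd : AbsolutelyContinuousOnInterval d 0 T) {s t : ℝ}
    (hs : s ∈ Icc 0 T) (ht : t ∈ Icc 0 T) : dist (d s) (d t) ≤ dist (absVar d s) (absVar d t) := by
  rcases le_total s t with h | h
  · rw [dist_comm, dist_comm (absVar d s)]
    exact (abs_sub_le_absVar_sub hd hs ht h).trans (le_abs_self _)
  · exact (abs_sub_le_absVar_sub hd ht hs h).trans (le_abs_self _)

/-- The evolution of a non-decreasing compliance `C` with the energy balance of the elastic energy
`d² / (2 C)` and the dissipated energy `lam C / 2`. -/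
theorem sub_mul_threshold_le {lam R c₀ : ℝ} (hd : AbsolutelyContinuousOnInterval d 0 T)
    (hR : ∀ t ∈ Icc 0 T, |d t| ≤ R) (hC : MonotoneOn C (Icc 0 T)) (hc₀ : 0 < c₀)
    (hCpos : ∀ t ∈ Icc 0 T, c₀ ≤ C t)
    (hbal : ∀ t ∈ Icc 0 T, d t ^ 2 / C t + lam * C t =
      d 0 ^ 2 / C 0 + lam * C 0 + 2 * ∫ r in (0)..t, d r / C r * deriv d r)
    {s t : ℝ} (hs : s ∈ Icc 0 T) (ht : t ∈ Icc 0 T) (hst : s ≤ t) :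
    (C t - C s) * (lam * (C s * C t) - d t ^ 2 - 2 * R * (absVar d t - absVar d s)) ≤ 0 := by
  have h0 : (0 : ℝ) ∈ Icc 0 T := left_mem_Icc.2 (hs.1.trans hs.2)
  -- No continuity of `C` is available. Monotonicity alone makes `1 / C` measurable, and the lower
  -- bound `c₀` makes it bounded, so the power is integrable.
  have hanti : AntitoneOn (fun r => (C r)⁻¹) (Icc 0 T) := fun x hx y hy hxy =>
    inv_anti₀ (hc₀.trans_le (hCpos x hx)) (hC hx hy hxy)
  have hint : ∀ x ∈ Icc 0 T, ∀ y ∈ Icc 0 T,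
      IntervalIntegrable (fun r => d r / C r * deriv d r) volume x y := by
    intro x hx y hy
    have hsub : uIcc x y ⊆ Icc 0 T := ordConnected_Icc.uIcc_subset hx hy
    have h1 : IntervalIntegrable (fun r => deriv d r * d r) volume x y :=
      (hd.mono_Icc hx hy).intervalIntegrable_deriv.mul_continuousOn (hd.mono_Icc hx hy).continuousOn
    rw [intervalIntegrable_iff] at h1 ⊢
    have hsub' : uIoc x y ⊆ Icc 0 T := uIoc_subset_uIcc.trans hsub
    have hm : AEStronglyMeasurable (fun r => (C r)⁻¹) (volume.restrict (uIoc x y)) :=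
      (aemeasurable_restrict_of_antitoneOn measurableSet_uIoc
        (hanti.mono hsub')).aestronglyMeasurable
    have h2 : IntegrableOn (fun r => (C r)⁻¹ * (deriv d r * d r)) (uIoc x y) := by
      refine Integrable.bdd_mul (c := c₀⁻¹) h1 hm ?_
      filter_upwards [ae_restrict_mem measurableSet_uIoc] with r hr
      have hpos := hc₀.trans_le (hCpos r (hsub' hr))
      rw [Real.norm_eq_abs, abs_of_pos (inv_pos.2 hpos)]
      exact inv_anti₀ hc₀ (hCpos r (hsub' hr))
    refine h2.congr (Eventually.of_forall fun r => ?_)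
    simp only [div_eq_mul_inv]
    ring
  have hdd : AbsolutelyContinuousOnInterval d s t := hd.mono_Icc hs ht
  have hsub : Icc s t ⊆ Icc 0 T := Icc_subset_Icc hs.1 ht.2
  have hsq : ∫ r in s..t, 2 * (d r * deriv d r) = d t ^ 2 - d s ^ 2 := by
    have h := hdd.integral_deriv_mul_eq_sub hdd
    rw [sq, sq, ← h]
    exact intervalIntegral.integral_congr fun r _ => by ring
  have i1 : IntervalIntegrable (fun r => 2 * (d r * deriv d r)) volume s t :=
    ((hdd.intervalIntegrable_deriv.mul_continuousOn hdd.continuousOn).congr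
      (fun r _ => mul_comm _ _)).const_mul 2
  have hdiff : d t ^ 2 / C t + lam * C t - (d s ^ 2 / C s + lam * C s) =
      2 * ∫ r in s..t, d r / C r * deriv d r := by
    rw [hbal t ht, hbal s hs, ← intervalIntegral.integral_interval_sub_left (hint 0 h0 t ht)
      (hint 0 h0 s hs)]
    ring
  have hCs := hc₀.trans_le (hCpos s hs)
  have hCt := hc₀.trans_le (hCpos t ht)
  -- Replacing `1 / C r` by `1 / C s` in the power turns its integral into `(d(t)² - d(s)²) / C s`.
  -- By monotonicity the error is at most the oscillation of `1 / C` times `2R` times the variation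
  -- of `d`.
  have hbound : |∫ r in s..t, 2 * (d r / C r * deriv d r) - (C s)⁻¹ * (2 * (d r * deriv d r))| ≤
      ((C s)⁻¹ - (C t)⁻¹) * (2 * R * (absVar d t - absVar d s)) := by
    rw [absVar_sub hd hs ht, ← intervalIntegral.integral_const_mul,
      ← intervalIntegral.integral_const_mul, ← Real.norm_eq_abs]
    refine intervalIntegral.norm_integral_le_of_norm_le hst (Eventually.of_forall fun r hr => ?_)
      (((intervalIntegrable_abs_deriv hd hs ht).const_mul _).const_mul _)
    have hr' : r ∈ Icc 0 T := hsub (Ioc_subset_Icc_self hr)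
    have e1 : (C t)⁻¹ ≤ (C r)⁻¹ := hanti hr' ht hr.2
    have e2 : (C r)⁻¹ ≤ (C s)⁻¹ := hanti hs hr' hr.1.le
    have e3 : 2 * (d r / C r * deriv d r) - (C s)⁻¹ * (2 * (d r * deriv d r)) =
        -(((C s)⁻¹ - (C r)⁻¹) * (2 * d r * deriv d r)) := by
      rw [div_eq_mul_inv]
      ring
    rw [e3, norm_neg, Real.norm_eq_abs, abs_mul, abs_mul, abs_mul,
      abs_of_nonneg (sub_nonneg.2 e2), abs_two]
    have e4 : 2 * |d r| * |deriv d r| ≤ 2 * R * |deriv d r| :=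
      mul_le_mul_of_nonneg_right (by linarith [hR r hr']) (abs_nonneg _)
    exact mul_le_mul (by linarith) e4 (by positivity) (by linarith)
  rw [intervalIntegral.integral_sub ((hint s hs t ht).const_mul 2) (i1.const_mul _),
    intervalIntegral.integral_const_mul, intervalIntegral.integral_const_mul, hsq, ← hdiff] at hbound
  have h1 := (le_abs_self _).trans hbound
  -- The terms in `d s` cancel, leaving `d(t)² (1 / C t - 1 / C s) + lam (C t - C s)` and the error
  -- bound. After multiplication by `C s * C t` every term contains the factor `C t - C s`.
  have h2 : (d t ^ 2 / C t + lam * C t - (d s ^ 2 / C s + lam * C s) -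
      (C s)⁻¹ * (d t ^ 2 - d s ^ 2) - ((C s)⁻¹ - (C t)⁻¹) *
      (2 * R * (absVar d t - absVar d s))) * (C s * C t) =
      (C t - C s) * (lam * (C s * C t) - d t ^ 2 - 2 * R * (absVar d t - absVar d s)) := by
    field_simp
    ring
  rw [← h2]
  exact mul_nonpos_of_nonpos_of_nonneg (by linarith) (by positivity)

/-- Under the stress constraint the increments of the compliance are controlled by the variation of
the imposed elongation. -/
theorem lam_mul_sub_le {lam R c₀ : ℝ} (hlam : 0 < lam)
    (hd : AbsolutelyContinuousOnInterval d 0 T)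
    (hR : ∀ t ∈ Icc 0 T, |d t| ≤ R) (hC : MonotoneOn C (Icc 0 T)) (hc₀ : 0 < c₀)
    (hCpos : ∀ t ∈ Icc 0 T, c₀ ≤ C t)
    (hthr : ∀ t ∈ Icc 0 T, d t ^ 2 ≤ lam * C t ^ 2) {s t : ℝ} (hs : s ∈ Icc 0 T)
    (ht : t ∈ Icc 0 T) (hst : s ≤ t)
    (h : (C t - C s) * (lam * (C s * C t) - d t ^ 2 - 2 * R * (absVar d t - absVar d s)) ≤ 0) :
    lam * (C t - C s) ≤ 4 * R / c₀ * (absVar d t - absVar d s) := by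
  have hV := absVar_mono hd hs ht hst
  have hR0 : 0 ≤ R := (abs_nonneg _).trans (hR s hs)
  rcases (hC hs ht hst).eq_or_lt with heq | hlt
  · rw [heq, sub_self, mul_zero]
    have : 0 ≤ absVar d t - absVar d s := by linarith
    positivity
  -- When the compliance strictly increases, the factor `C t - C s` can be divided out.
  have h1 : lam * (C s * C t) - d t ^ 2 - 2 * R * (absVar d t - absVar d s) ≤ 0 := by
    by_contra hcon
    exact absurd h (not_le.2 (mul_pos (by linarith) (not_le.1 hcon)))
  have h2 : d t ^ 2 - d s ^ 2 ≤ 2 * R * (absVar d t - absVar d s) := by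
    have e1 := abs_sub_le_absVar_sub hd hs ht hst
    have e2 : d t ^ 2 - d s ^ 2 = (d t + d s) * (d t - d s) := by ring
    rw [e2]
    refine (le_abs_self _).trans ?_
    rw [abs_mul]
    refine mul_le_mul ?_ e1 (abs_nonneg _) (by positivity)
    linarith [abs_add_le (d t) (d s), hR t ht, hR s hs]
  -- The threshold at time `s` bounds `- lam C s²` by `- d(s)²`; what remains is `d(t)² - d(s)²`
  -- plus the error term, each at most `2R` times the increment of the variation.
  have h3 : lam * (C t - C s) * C s ≤ 4 * R * (absVar d t - absVar d s) := by
    nlinarith [hthr s hs]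
  have h4 : lam * (C t - C s) * c₀ ≤ lam * (C t - C s) * C s :=
    mul_le_mul_of_nonneg_left (hCpos s hs) (mul_nonneg hlam.le (by linarith))
  rw [div_mul_eq_mul_div, le_div_iff₀ hc₀]
  linarith

end Scalar

/-! ### Equilibrium of a bar of given compliance -/

section Bar

variable {L : ℝ} {γ a : ℝ → ℝ} {m M C : ℝ} {w : H1 ⊤}

/-- The compliance of the mixture of volume fractions `θ` of a material of stiffness `β` and
`1 - θ` of a material of stiffness `α`. -/
noncomputable def mixCompliance (α β θ : ℝ) : ℝ := (1 - θ) / α + θ / β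

theorem integrable_of_mem_Icc (hγ : AEMeasurable γ (leb (body L)))
    (hb : ∀ᵐ x ∂leb (body L), γ x ∈ Icc m M) : Integrable γ (leb (body L)) :=
  Integrable.of_mem_Icc m M hγ hb

theorem memLp_of_mem_Icc (hγ : AEMeasurable γ (leb (body L)))
    (hb : ∀ᵐ x ∂leb (body L), γ x ∈ Icc m M) : MemLp γ 2 (leb (body L)) :=
  MemLp.of_bound hγ.aestronglyMeasurable (max |m| |M|)
    (hb.mono fun _ hx => abs_le_max_abs_abs hx.1 hx.2)

/-- When the strain is a constant stress times the compliance `γ`, the energy density is the square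
of the stress times `γ`, so only the total compliance matters. -/
theorem elasticEnergy_of_der_eq {v : H1 (body L)} (hm : 0 < m)
    (hb : ∀ᵐ x ∂leb (body L), γ x ∈ Icc m M) (ha : ∀ᵐ x ∂leb (body L), a x = (γ x)⁻¹)
    (hC : ∫ x in Ioo 0 L, γ x = C) (hCpos : 0 < C) {d : ℝ}
    (hv : ∀ᵐ x ∂leb (body L), v.der x = d / C * γ x) :
    elasticEnergy a v = 1 / 2 * (d ^ 2 / C) := by
  have h : ∫ x in Ioo 0 L, a x * v.der x ^ 2 = ∫ x in Ioo 0 L, (d / C) ^ 2 * γ x := by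
    refine integral_congr_ae ?_
    filter_upwards [hb, ha, hv] with x h1 h2 h3
    have : γ x ≠ 0 := (hm.trans_le h1.1).ne'
    rw [h2, h3]
    field_simp
  rw [elasticEnergy, h, integral_const_mul, hC]
  field_simp

/-- Any multiple of `γ` is a strain of constant stress; the imposed elongation fixes the factor.
This is the displacement used in all minimality tests. -/
theorem exists_dirichletClass_equilibrium (hL : 0 < L) (hγ : AEMeasurable γ (leb (body L)))
    (hb : ∀ᵐ x ∂leb (body L), γ x ∈ Icc m M) (hC : ∫ x in Ioo 0 L, γ x = C) (hCpos : 0 < C) :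
    ∃ v : H1 (body L), DirichletClass w v ∧
      ∀ᵐ x ∂leb (body L), v.der x = stretch L w / C * γ x := by
  have hmem : MemLp (fun x => stretch L w / C * γ x) 2 (leb (body L)) :=
    (memLp_of_mem_Icc hγ hb).const_mul _
  obtain ⟨v, h1, h2⟩ := exists_dirichletClass hL (w := w) (g := hmem.toLp _) (by
    rw [totalInt_apply]
    refine (integral_congr_ae hmem.coeFn_toLp).trans ?_
    change ∫ x in Ioo 0 L, stretch L w / C * γ x = _
    rw [integral_const_mul, hC, div_mul_cancel₀ _ hCpos.ne'])
  refine ⟨v, h1, ?_⟩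
  rw [h2]
  exact hmem.coeFn_toLp

/-- The minimizers of the elastic energy have a homogeneous stress. -/
theorem der_eq_of_elasticEnergy_le (hL : 0 < L) {u : H1 (body L)}
    (hγ : AEMeasurable γ (leb (body L))) (hm : 0 < m)
    (hb : ∀ᵐ x ∂leb (body L), γ x ∈ Icc m M) (ha : ∀ᵐ x ∂leb (body L), a x = (γ x)⁻¹)
    (hC : ∫ x in Ioo 0 L, γ x = C) (hCpos : 0 < C) (hu : DirichletClass w u)
    (hle : elasticEnergy a u ≤ 1 / 2 * (stretch L w ^ 2 / C)) :
    ∀ᵐ x ∂leb (body L), u.der x = stretch L w / C * γ x := by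
  set σ := stretch L w / C with hσ
  have hu2 : Integrable (fun x => u.der x ^ 2) (leb (body L)) := (Lp.memLp u.der).integrable_sq
  have hu1 : Integrable u.der (leb (body L)) := (Lp.memLp u.der).integrable (by norm_num)
  have hγi : Integrable γ (leb (body L)) := integrable_of_mem_Icc hγ hb
  have hγinv : ∀ᵐ x ∂leb (body L), ‖(γ x)⁻¹‖ ≤ m⁻¹ := hb.mono fun x hx => by
    rw [Real.norm_eq_abs, abs_of_pos (inv_pos.2 (hm.trans_le hx.1))]
    exact inv_anti₀ hm hx.1
  have hi1 : Integrable (fun x => (γ x)⁻¹ * u.der x ^ 2) (leb (body L)) :=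
    hu2.bdd_mul hγ.inv.aestronglyMeasurable hγinv
  -- Completing the square: the integral of this weighted square is twice the excess of the energy
  -- of `u` over `d² / (2C)`, with `d` the imposed elongation. The hypothesis makes the excess
  -- non-positive, so the square vanishes.
  have hexp : ∀ᵐ x ∂leb (body L), (γ x)⁻¹ * (u.der x - σ * γ x) ^ 2 =
      (γ x)⁻¹ * u.der x ^ 2 - 2 * σ * u.der x + σ ^ 2 * γ x := hb.mono fun x hx => by
    have : γ x ≠ 0 := (hm.trans_le hx.1).ne'
    field_simp
    ring
  have hi2 : Integrable (fun x => (γ x)⁻¹ * u.der x ^ 2 - 2 * σ * u.der x) (leb (body L)) :=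
    hi1.sub (hu1.const_mul _)
  have hi : Integrable (fun x => (γ x)⁻¹ * (u.der x - σ * γ x) ^ 2) (leb (body L)) :=
    (hi2.add (hγi.const_mul _)).congr (hexp.mono fun x hx => hx.symm)
  have hen : ∫ x in Ioo 0 L, (γ x)⁻¹ * u.der x ^ 2 ≤ stretch L w ^ 2 / C := by
    have h : ∫ x in Ioo 0 L, a x * u.der x ^ 2 = ∫ x in Ioo 0 L, (γ x)⁻¹ * u.der x ^ 2 :=
      integral_congr_ae (ha.mono fun x hx => by simp only [hx])
    rw [elasticEnergy, h] at hle
    linarith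
  have htot : ∫ x in Ioo 0 L, u.der x = stretch L w := by
    rw [← totalInt_apply]
    exact (hu.val_eq hL).2
  have hval : ∫ x, (γ x)⁻¹ * (u.der x - σ * γ x) ^ 2 ∂leb (body L) =
      (∫ x in Ioo 0 L, (γ x)⁻¹ * u.der x ^ 2) - stretch L w ^ 2 / C := by
    rw [integral_congr_ae hexp, integral_add hi2 (hγi.const_mul _),
      integral_sub hi1 (hu1.const_mul _), integral_const_mul, integral_const_mul]
    change (∫ x in Ioo 0 L, (γ x)⁻¹ * u.der x ^ 2) - 2 * σ * (∫ x in Ioo 0 L, u.der x) +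
      σ ^ 2 * (∫ x in Ioo 0 L, γ x) = _
    rw [htot, hC, hσ]
    field_simp
    ring
  have hnn : 0 ≤ᵐ[leb (body L)] fun x => (γ x)⁻¹ * (u.der x - σ * γ x) ^ 2 :=
    hb.mono fun x hx => mul_nonneg (inv_nonneg.2 (hm.trans_le hx.1).le) (sq_nonneg _)
  have hz := (integral_eq_zero_iff_of_nonneg_ae hnn hi).1
    (le_antisymm (by rw [hval]; linarith) (integral_nonneg_of_ae hnn))
  filter_upwards [hz, hb] with x hx hx'
  have : (γ x)⁻¹ ≠ 0 := inv_ne_zero (hm.trans_le hx'.1).ne'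
  have h0 : (γ x)⁻¹ * (u.der x - σ * γ x) ^ 2 = 0 := hx
  have h1 := pow_eq_zero_iff two_ne_zero |>.1 ((mul_eq_zero.1 h0).resolve_left this)
  linarith

end Bar

/-! ### Evolutions of homogenized brittle damage -/

section Evolution

variable {L T k α β : ℝ} {w : ℝ → H1 ⊤} {u : ℝ → H1 (body L)} {Θ a : ℝ → ℝ → ℝ}

/-- The volume of damaged material. -/
noncomputable def damagedVolume (L : ℝ) (θ : ℝ → ℝ) : ℝ := ∫ x in Ioo 0 L, (1 - θ x)

theorem integral_body_const (hL : 0 < L) (c : ℝ) : ∫ _ in Ioo 0 L, c = L * c := by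
  simp [hL.le]

theorem IsVolumeFraction.mixCompliance_mem {θ : ℝ → ℝ} (hθ : IsVolumeFraction L θ) (hα : 0 < α)
    (hαβ : α < β) : ∀ᵐ x ∂leb (body L), mixCompliance α β (θ x) ∈ Icc β⁻¹ α⁻¹ := by
  filter_upwards [hθ.2] with x hx
  have h1 : β⁻¹ ≤ α⁻¹ := inv_anti₀ hα hαβ.le
  rw [mixCompliance, div_eq_mul_inv, div_eq_mul_inv]
  constructor <;> nlinarith [hx.1, hx.2]

theorem IsVolumeFraction.aemeasurable_mixCompliance {θ : ℝ → ℝ} (hθ : IsVolumeFraction L θ)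
    (α β : ℝ) : AEMeasurable (fun x => mixCompliance α β (θ x)) (leb (body L)) :=
  ((aemeasurable_const.sub hθ.1).div_const α).add (hθ.1.div_const β)

theorem IsVolumeFraction.integrable {θ : ℝ → ℝ} (hθ : IsVolumeFraction L θ) :
    Integrable θ (leb (body L)) := integrable_of_mem_Icc hθ.1 hθ.2

theorem IsVolumeFraction.integrable_one_sub {θ : ℝ → ℝ} (hθ : IsVolumeFraction L θ) :
    IntegrableOn (fun x => 1 - θ x) (Ioo 0 L) := (integrable_const (1 : ℝ)).sub hθ.integrable

theorem IsVolumeFraction.integral_mixCompliance (hL : 0 < L) {θ : ℝ → ℝ}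
    (hθ : IsVolumeFraction L θ) (α β : ℝ) :
    ∫ x in Ioo 0 L, mixCompliance α β (θ x) = L / β + (1 / α - 1 / β) * damagedVolume L θ := by
  have h1 : ∀ x, mixCompliance α β (θ x) = 1 / β + (1 / α - 1 / β) * (1 - θ x) := fun x => by
    rw [mixCompliance]
    ring
  have hi : IntegrableOn (fun x => 1 - θ x) (Ioo 0 L) := hθ.integrable_one_sub
  simp only [h1]
  rw [integral_add (integrable_const _) (hi.const_mul _), integral_const_mul,
    integral_body_const hL, damagedVolume]
  ring

theorem IsVolumeFraction.integral_eq (hL : 0 < L) {θ : ℝ → ℝ} (hθ : IsVolumeFraction L θ) :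
    ∫ x in Ioo 0 L, θ x = L - damagedVolume L θ := by
  have hi : IntegrableOn θ (Ioo 0 L) := hθ.integrable
  rw [damagedVolume, integral_sub (integrable_const _) hi, integral_body_const hL]
  ring

theorem IsVolumeFraction.damagedVolume_nonneg {θ : ℝ → ℝ} (hθ : IsVolumeFraction L θ) :
    0 ≤ damagedVolume L θ :=
  integral_nonneg_of_ae (hθ.2.mono fun _ hx => sub_nonneg.2 hx.2)

theorem IsVolumeFraction.damagedVolume_le (hL : 0 < L) {θ : ℝ → ℝ} (hθ : IsVolumeFraction L θ) :
    damagedVolume L θ ≤ L := by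
  have h : 0 ≤ ∫ x in Ioo 0 L, θ x := integral_nonneg_of_ae (hθ.2.mono fun _ hx => hx.1)
  rw [hθ.integral_eq hL] at h
  linarith

/-- The total compliance. -/
noncomputable def totalCompliance (L α β : ℝ) (θ : ℝ → ℝ) : ℝ :=
  L / β + (1 / α - 1 / β) * damagedVolume L θ

theorem isVolumeFraction_const (L : ℝ) {c : ℝ} (hc : c ∈ Icc (0 : ℝ) 1) :
    IsVolumeFraction L fun _ => c :=
  ⟨aemeasurable_const, Eventually.of_forall fun _ => hc⟩

variable (hL : 0 < L) (hα : 0 < α) (hαβ : α < β)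
include hL hα hαβ

omit hL in
theorem one_div_sub_pos : 0 < 1 / α - 1 / β := sub_pos.2 (one_div_lt_one_div_of_lt hα hαβ)

omit hL in
theorem IsVolumeFraction.le_totalCompliance {θ : ℝ → ℝ} (hθ : IsVolumeFraction L θ) :
    L / β ≤ totalCompliance L α β θ :=
  le_add_of_nonneg_right (mul_nonneg (one_div_sub_pos hα hαβ).le hθ.damagedVolume_nonneg)

theorem IsVolumeFraction.totalCompliance_pos {θ : ℝ → ℝ} (hθ : IsVolumeFraction L θ) :
    0 < totalCompliance L α β θ :=
  (div_pos hL (hα.trans hαβ)).trans_le (hθ.le_totalCompliance hα hαβ)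

-- Compliances mix linearly: a proportion `c` of damaged material added to a mixture with sound
-- fraction `θ` leaves the sound fraction `(1 - c) θ`. Competitors for one-sided minimality are thus
-- again mixtures of the two original phases.
omit hL in
theorem mix_eq_inv {a θ c : ℝ} (hθ : θ ∈ Icc (0 : ℝ) 1) (hc : c ∈ Icc (0 : ℝ) 1)
    (ha : a = (mixCompliance α β θ)⁻¹) :
    mix α a c = (mixCompliance α β ((1 - c) * θ))⁻¹ := by
  have hβ := hα.trans hαβ
  have hp : 0 < (1 - θ) * β + θ * α := by
    rcases hθ.1.eq_or_lt with h | h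
    · rw [← h]
      linarith
    · nlinarith [mul_pos h hα, mul_nonneg (sub_nonneg.2 hθ.2) hβ.le]
  have ha' : a = α * β / ((1 - θ) * β + θ * α) := by
    rw [ha, mixCompliance]
    field_simp
  have hp2 : 0 < (1 - (1 - c) * θ) * β + (1 - c) * θ * α := by
    have h1 : (1 - (1 - c) * θ) * β + (1 - c) * θ * α =
      (1 - θ) * β + θ * α + c * θ * (β - α) := by ring
    have := mul_nonneg (mul_nonneg hc.1 hθ.1) (sub_pos.2 hαβ).le
    linarith
  have hm : (mixCompliance α β ((1 - c) * θ))⁻¹ =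
      α * β / ((1 - (1 - c) * θ) * β + (1 - c) * θ * α) := by
    rw [mixCompliance]
    field_simp
  rw [hm, mix, ha']
  generalize hP : (1 - θ) * β + θ * α = P at *
  have hq : c * (α * β / P) + (1 - c) * α =
      α * ((1 - (1 - c) * θ) * β + (1 - c) * θ * α) / P := by
    rw [eq_div_iff hp.ne', add_mul, mul_assoc c, div_mul_cancel₀ _ hp.ne', ← hP]
    ring
  rw [hq]
  generalize (1 - (1 - c) * θ) * β + (1 - c) * θ * α = Q at *
  have := hp.ne'
  have := hp2.ne'
  field_simp

namespace IsBrittleEvolution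

variable (h : IsBrittleEvolution L T k α β w u Θ a)
include h

omit hL hα hαβ in
theorem stiffness_eq {t : ℝ} (ht : t ∈ Icc 0 T) :
    ∀ᵐ x ∂leb (body L), a t x = (mixCompliance α β (Θ t x))⁻¹ := h.stiffness t ht

/-- The test in one-sided minimality is a spatially constant added damage `c` with the displacement
of constant stress. Constant `c` suffices because only total compliance and damaged volume enter the
energies. The value `c = 0` yields equilibrium, and the limit `c → 0` the stress constraint. -/
theorem elasticEnergy_le {t : ℝ} (ht : t ∈ Icc 0 T) {c : ℝ} (hc : c ∈ Icc (0 : ℝ) 1) :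
    elasticEnergy (a t) (u t) ≤ 1 / 2 * (stretch L (w t) ^ 2 / (totalCompliance L α β (Θ t) +
      c * ((1 / α - 1 / β) * (L - damagedVolume L (Θ t))))) +
      k * (c * (L - damagedVolume L (Θ t))) := by
  have hΘ := h.volumeFraction t ht
  have hθ : IsVolumeFraction L fun x => (1 - c) * Θ t x := by
    refine ⟨hΘ.1.const_mul _, hΘ.2.mono fun x hx => ⟨?_, ?_⟩⟩
    · exact mul_nonneg (sub_nonneg.2 hc.2) hx.1
    · exact mul_le_one₀ (by linarith [hc.1]) hx.1 hx.2
  have hdv : damagedVolume L (fun x => (1 - c) * Θ t x) =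
      damagedVolume L (Θ t) + c * (L - damagedVolume L (Θ t)) := by
    have h1 := hθ.integral_eq hL
    rw [integral_const_mul, hΘ.integral_eq hL] at h1
    linarith
  have hC := hθ.integral_mixCompliance hL α β
  have hCpos := hθ.totalCompliance_pos hL hα hαβ
  have hb := hθ.mixCompliance_mem hα hαβ
  obtain ⟨v, hv1, hv2⟩ := exists_dirichletClass_equilibrium (w := w t) hL
    (hθ.aemeasurable_mixCompliance α β) hb hC hCpos
  have h2 := h.one_sided_minimality t ht v hv1 (fun _ => c) (isVolumeFraction_const L hc)
  have h3 := elasticEnergy_of_der_eq (a := fun x => mix α (a t x) c)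
    (inv_pos.2 (hα.trans hαβ)) hb (by
      filter_upwards [hΘ.2, h.stiffness_eq ht] with x hx hx'
      exact mix_eq_inv hα hαβ hx hc hx') hC hCpos hv2
  rw [h3, integral_const_mul, hΘ.integral_eq hL] at h2
  refine h2.trans (le_of_eq ?_)
  rw [hdv, totalCompliance]
  have h4 (B D : ℝ) : L / β + B * (D + c * (L - D)) = L / β + B * D + c * (B * (L - D)) := by
    ring
  rw [h4]

/-- The stress is homogeneous. -/
theorem der_eq {t : ℝ} (ht : t ∈ Icc 0 T) :
    ∀ᵐ x ∂leb (body L), (u t).der x =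
      stretch L (w t) / totalCompliance L α β (Θ t) * mixCompliance α β (Θ t x) := by
  have hΘ := h.volumeFraction t ht
  have h0 := h.elasticEnergy_le hL hα hαβ ht (c := 0) ⟨le_rfl, zero_le_one⟩
  simp only [zero_mul, add_zero, mul_zero] at h0
  exact der_eq_of_elasticEnergy_le hL (hΘ.aemeasurable_mixCompliance α β)
    (inv_pos.2 (hα.trans hαβ)) (hΘ.mixCompliance_mem hα hαβ) (h.stiffness_eq ht)
    (hΘ.integral_mixCompliance hL α β) (hΘ.totalCompliance_pos hL hα hαβ) (h.dirichlet t ht) h0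

theorem stress_eq {t : ℝ} (ht : t ∈ Icc 0 T) :
    ∀ᵐ x ∂leb (body L), a t x * (u t).der x =
      stretch L (w t) / totalCompliance L α β (Θ t) := by
  filter_upwards [h.der_eq hL hα hαβ ht, h.stiffness_eq ht,
    (h.volumeFraction t ht).mixCompliance_mem hα hαβ] with x h1 h2 h3
  have : mixCompliance α β (Θ t x) ≠ 0 := ((inv_pos.2 (hα.trans hαβ)).trans_le h3.1).ne'
  rw [h1, h2]
  field_simp

theorem elasticEnergy_eq {t : ℝ} (ht : t ∈ Icc 0 T) :
    elasticEnergy (a t) (u t) = 1 / 2 * (stretch L (w t) ^ 2 / totalCompliance L α β (Θ t)) :=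
  elasticEnergy_of_der_eq (inv_pos.2 (hα.trans hαβ))
    ((h.volumeFraction t ht).mixCompliance_mem hα hαβ) (h.stiffness_eq ht)
    ((h.volumeFraction t ht).integral_mixCompliance hL α β)
    ((h.volumeFraction t ht).totalCompliance_pos hL hα hαβ) (h.der_eq hL hα hαβ ht)

/-- The stress constraint, which complete damage satisfies only if the damaged material is weak
enough. -/
theorem stretch_sq_le {t : ℝ} (ht : t ∈ Icc 0 T)
    (hbig : stretch L (w t) ^ 2 * (1 / α - 1 / β) * α ^ 2 ≤ 2 * k * L ^ 2) :
    stretch L (w t) ^ 2 * (1 / α - 1 / β) ≤ 2 * k * totalCompliance L α β (Θ t) ^ 2 := by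
  have hΘ := h.volumeFraction t ht
  have hB := one_div_sub_pos hα hαβ
  set d := stretch L (w t)
  set C := totalCompliance L α β (Θ t) with hCdef
  set B := 1 / α - 1 / β with hBdef
  set D := damagedVolume L (Θ t) with hD
  have hCpos : 0 < C := hΘ.totalCompliance_pos hL hα hαβ
  -- In a completely damaged bar no damage can be added, so minimality says nothing. There `C = L /
  -- α`, and the claim is the hypothesis `hbig`.
  rcases (hΘ.damagedVolume_le hL).eq_or_lt with heq | hlt
  · have hCL : C = L / α := by
      rw [hCdef, totalCompliance, heq]
      ring
    rw [hCL, div_pow, mul_div_assoc', le_div_iff₀ (by positivity)]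
    exact hbig
  have hP : 0 < L - D := sub_pos.2 hlt
  have hineq : ∀ c ∈ Ioc (0 : ℝ) 1, d ^ 2 * B ≤ 2 * k * (C * (C + c * (B * (L - D)))) := by
    intro c hc
    have h1 := h.elasticEnergy_le hL hα hαβ ht (c := c) ⟨hc.1.le, hc.2⟩
    rw [h.elasticEnergy_eq hL hα hαβ ht] at h1
    have hq : 0 < C + c * (B * (L - D)) := by
      have := mul_pos hc.1 (mul_pos hB hP)
      linarith
    have h2 : 1 / 2 * (d ^ 2 / C) - 1 / 2 * (d ^ 2 / (C + c * (B * (L - D)))) ≤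
      k * (c * (L - D)) := by linarith
    have h3 : 1 / 2 * (d ^ 2 / C) - 1 / 2 * (d ^ 2 / (C + c * (B * (L - D)))) =
        (c * (L - D)) * (d ^ 2 * B) / (2 * (C * (C + c * (B * (L - D))))) := by
      have h4 : C + c * (B * (L - D)) - C = c * (B * (L - D)) := by ring
      generalize C + c * (B * (L - D)) = E at *
      rw [show c * (L - D) * (d ^ 2 * B) = d ^ 2 * (E - C) by rw [h4]; ring]
      have := hq.ne'
      field_simp
    rw [h3, div_le_iff₀ (by positivity)] at h2
    refine le_of_mul_le_mul_left (a := c * (L - D)) ?_ (mul_pos hc.1 hP)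
    linarith
  -- The common factor `c (L - D)` has been divided out, so the limit `c → 0` from the right gives
  -- the first-order condition.
  have hlim : Tendsto (fun c : ℝ => 2 * k * (C * (C + c * (B * (L - D))))) (𝓝[>] 0)
      (𝓝 (2 * k * (C * (C + 0 * (B * (L - D)))))) := by
    refine Tendsto.mono_left ?_ nhdsWithin_le_nhds
    exact Continuous.tendsto (by fun_prop) 0
  have := ge_of_tendsto hlim (by
    filter_upwards [Ioc_mem_nhdsGT (zero_lt_one (α := ℝ))] with c hc using hineq c hc)
  rw [zero_mul, add_zero, ← sq] at this
  exact this

/-- Initial minimality is compared with the undamaged bar, and the elastic energy of the initial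
state is dropped. -/
theorem initial_damagedVolume_le (hT : 0 < T) :
    k * damagedVolume L (Θ 0) ≤ 1 / 2 * (stretch L (w 0) ^ 2 / (L / β)) := by
  have h0 : (0 : ℝ) ∈ Icc 0 T := left_mem_Icc.2 hT.le
  have hβ := hα.trans hαβ
  have hb : ∀ᵐ x ∂leb (body L), (fun _ : ℝ => β⁻¹) x ∈ Icc β⁻¹ β⁻¹ :=
    Eventually.of_forall fun _ => ⟨le_rfl, le_rfl⟩
  have hC : ∫ _ in Ioo 0 L, β⁻¹ = L / β := by
    rw [integral_body_const hL, div_eq_mul_inv]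
  have hCpos : 0 < L / β := by positivity
  obtain ⟨v, hv1, hv2⟩ := exists_dirichletClass_equilibrium (w := w 0) hL
    aemeasurable_const hb hC hCpos
  -- In the competitor the volume fraction is that of damaged material, so `0` stands for the sound
  -- bar.
  have h1 := h.initial_minimality v hv1 (fun _ => 0)
    (isVolumeFraction_const L ⟨le_rfl, zero_le_one⟩)
  rw [elasticEnergy_of_der_eq (inv_pos.2 hβ) hb (Eventually.of_forall fun x => by
    rw [mix, inv_inv]
    field_simp
    ring) hC hCpos hv2] at h1
  have h2 : 0 ≤ elasticEnergy (a 0) (u 0) := by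
    rw [h.elasticEnergy_eq hL hα hαβ h0]
    have := (h.volumeFraction 0 h0).totalCompliance_pos hL hα hαβ
    positivity
  rw [integral_zero, mul_zero, add_zero] at h1
  have h3 : k * damagedVolume L (Θ 0) ≤
      elasticEnergy (a 0) (u 0) + k * damagedVolume L (Θ 0) := by linarith
  exact h3.trans h1

omit hL hα hαβ in
theorem damagedVolume_monotoneOn : MonotoneOn (fun t => damagedVolume L (Θ t)) (Icc 0 T) := by
  intro s hs t ht hst
  refine integral_mono_ae ((integrable_const _).sub (h.volumeFraction s hs).integrable)
    ((integrable_const _).sub (h.volumeFraction t ht).integrable) ?_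
  filter_upwards [h.monotone s hs t ht hst] with x hx
  exact sub_le_sub_left hx.2 1

omit hL in
theorem totalCompliance_monotoneOn :
    MonotoneOn (fun t => totalCompliance L α β (Θ t)) (Icc 0 T) := fun _ hs _ ht hst =>
  add_le_add le_rfl (mul_le_mul_of_nonneg_left (h.damagedVolume_monotoneOn hs ht hst)
    (one_div_sub_pos hα hαβ).le)

/-- The energy balance in terms of the total compliance. -/
theorem balance (hw : AbsolutelyContinuousOnInterval w 0 T) {t : ℝ} (ht : t ∈ Icc 0 T) :
    stretch L (w t) ^ 2 / totalCompliance L α β (Θ t) +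
        2 * k / (1 / α - 1 / β) * totalCompliance L α β (Θ t) =
      stretch L (w 0) ^ 2 / totalCompliance L α β (Θ 0) +
        2 * k / (1 / α - 1 / β) * totalCompliance L α β (Θ 0) +
      2 * ∫ r in (0)..t, stretch L (w r) / totalCompliance L α β (Θ r) *
        deriv (fun r => stretch L (w r)) r := by
  have hT : 0 ≤ T := ht.1.trans ht.2
  have h0 : (0 : ℝ) ∈ Icc 0 T := left_mem_Icc.2 hT
  have hB := one_div_sub_pos hα hαβ
  have h1 := h.energy_balance t ht
  rw [h.elasticEnergy_eq hL hα hαβ ht, h.elasticEnergy_eq hL hα hαβ h0] at h1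
  -- The stress is constant in space and leaves the inner integral. The rest is the elongation of
  -- the weak time derivative of `w`, which for almost every time is the derivative of the scalar
  -- elongation.
  have h2 : ∫ s in (0)..t, ∫ x in Ioo 0 L, a s x * (u s).der x * (weakTimeDeriv w s).der x =
      ∫ r in (0)..t, stretch L (w r) / totalCompliance L α β (Θ r) *
        deriv (fun r => stretch L (w r)) r := by
    refine intervalIntegral.integral_congr_ae ?_
    have hne : ∀ᵐ s : ℝ, s ≠ T := by simp [ae_iff, measure_singleton]
    filter_upwards [ae_hasWeakTimeDerivAt hT hw, hne] with s hs hsT hst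
    rw [uIoc_of_le ht.1] at hst
    have hsI : s ∈ Icc 0 T := ⟨hst.1.le, hst.2.trans ht.2⟩
    have h3 := (hs ⟨hst.1, lt_of_le_of_ne hsI.2 hsT⟩).hasDerivAt (stretch L)
    rw [h3.deriv, stretch_apply (weakTimeDeriv w s), ← integral_const_mul]
    refine integral_congr_ae ((h.stress_eq hL hα hαβ hsI).mono fun x hx => ?_)
    simp only [hx]
  rw [h2] at h1
  -- Up to a constant that cancels in the balance, twice the dissipated energy is a multiple of the
  -- total compliance.
  have hC : ∀ s, 2 * k / (1 / α - 1 / β) * totalCompliance L α β (Θ s) =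
      2 * k / (1 / α - 1 / β) * (L / β) + 2 * (k * damagedVolume L (Θ s)) := fun s => by
    rw [totalCompliance]
    generalize 1 / α - 1 / β = B at hB
    have := hB.ne'
    field_simp
  rw [hC, hC]
  have h4 : ∀ s, ∫ x in Ioo 0 L, (1 - Θ s x) = damagedVolume L (Θ s) := fun _ => rfl
  rw [h4, h4] at h1
  linarith

end IsBrittleEvolution

end Evolution

open scoped NNReal BoundedContinuousFunction

/-! ### Weak convergence of families of measures on a compact interval -/

section WeakConvergence

/-- `m` is a measure on `[0, L]` of mass at most `C`. -/
def IsBoundedOn (L : ℝ) (C : ℝ≥0) (m : FiniteMeasure ℝ) : Prop := m.mass ≤ C ∧ m (Icc 0 L)ᶜ = 0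

theorem isCompact_setOf_isBoundedOn (L : ℝ) (C : ℝ≥0) : IsCompact {m | IsBoundedOn L C m} :=
  isCompact_setOfPred_finiteMeasure_le_of_isCompact C isCompact_Icc

variable {L : ℝ} {C : ℝ≥0} {m m' : FiniteMeasure ℝ} {f g : ℝ → ℝ}

theorem IsBoundedOn.ae_mem (hm : IsBoundedOn L C m) : ∀ᵐ x ∂(m : Measure ℝ), x ∈ Icc 0 L := by
  rw [ae_iff]
  exact (FiniteMeasure.null_iff_toMeasure_null m _).1 hm.2

theorem IsBoundedOn.real_univ_le (hm : IsBoundedOn L C m) : (m : Measure ℝ).real univ ≤ C :=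
  NNReal.coe_le_coe.2 hm.1

theorem IsBoundedOn.of_le (hm : IsBoundedOn L C m) (h : (m' : Measure ℝ) ≤ m) :
    IsBoundedOn L C m' := by
  refine ⟨(ENNReal.toNNReal_mono (measure_ne_top _ _) (h univ)).trans hm.1, ?_⟩
  rw [FiniteMeasure.null_iff_toMeasure_null]
  exact le_antisymm ((h _).trans ((FiniteMeasure.null_iff_toMeasure_null m _).1 hm.2).le) bot_le

theorem IsBoundedOn.integrable (hm : IsBoundedOn L C m) (hf : Continuous f) :
    Integrable f (m : Measure ℝ) := by
  have h : IntegrableOn f (Icc 0 L) (m : Measure ℝ) := hf.continuousOn.integrableOn_compact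
    isCompact_Icc
  rwa [IntegrableOn, Measure.restrict_eq_self_of_ae_mem hm.ae_mem] at h

theorem IsBoundedOn.integral_congr (hm : IsBoundedOn L C m) (h : EqOn f g (Icc 0 L)) :
    ∫ x, f x ∂(m : Measure ℝ) = ∫ x, g x ∂(m : Measure ℝ) :=
  integral_congr_ae (hm.ae_mem.mono fun _ hx => h hx)

theorem IsBoundedOn.abs_integral_le (hm : IsBoundedOn L C m) {B : ℝ}
    (h : ∀ x ∈ Icc 0 L, |f x| ≤ B) :
    |∫ x, f x ∂(m : Measure ℝ)| ≤ B * (m : Measure ℝ).real univ :=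
  norm_integral_le_of_norm_le_const (f := f) (hm.ae_mem.mono h)

/-- A continuous function on `[0, L]`, extended by constants to a bounded function. -/
noncomputable def extendBounded (hL : 0 ≤ L) (g : C(Icc 0 L, ℝ)) : ℝ →ᵇ ℝ :=
  (BoundedContinuousFunction.mkOfCompact g).compContinuous ⟨projIcc 0 L hL, continuous_projIcc⟩

theorem extendBounded_of_mem (hL : 0 ≤ L) (g : C(Icc 0 L, ℝ)) {x : ℝ} (hx : x ∈ Icc 0 L) :
    extendBounded hL g x = g ⟨x, hx⟩ := by
  change g (projIcc 0 L hL x) = _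
  rw [projIcc_of_mem hL hx]

/-- The restriction of a continuous function to `[0, L]`. -/
def restrictIcc (L : ℝ) {f : ℝ → ℝ} (hf : Continuous f) : C(Icc 0 L, ℝ) :=
  ⟨fun x => f x, hf.comp continuous_subtype_val⟩

theorem IsBoundedOn.integral_extendBounded (hL : 0 ≤ L) (hm : IsBoundedOn L C m)
    (hf : Continuous f) :
    ∫ x, extendBounded hL (restrictIcc L hf) x ∂(m : Measure ℝ) = ∫ x, f x ∂(m : Measure ℝ) :=
  hm.integral_congr fun _ hx => extendBounded_of_mem hL _ hx

theorem IsBoundedOn.dist_integral_extendBounded_le (hL : 0 ≤ L) (hm : IsBoundedOn L C m)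
    (g g' : C(Icc 0 L, ℝ)) :
    dist (∫ x, extendBounded hL g x ∂(m : Measure ℝ))
      (∫ x, extendBounded hL g' x ∂(m : Measure ℝ)) ≤ C * dist g g' := by
  rw [Real.dist_eq, ← integral_sub (hm.integrable (extendBounded hL g).continuous)
    (hm.integrable (extendBounded hL g').continuous), mul_comm]
  refine (hm.abs_integral_le (B := dist g g') fun x hx => ?_).trans
    (mul_le_mul_of_nonneg_left hm.real_univ_le dist_nonneg)
  rw [extendBounded_of_mem hL _ hx, extendBounded_of_mem hL _ hx, ← Real.dist_eq]
  exact ContinuousMap.dist_apply_le_dist _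

/-- Weak convergence tests with bounded functions only. As the measures live on `[0, L]`, a
continuous `f` can be replaced by the bounded extension of its restriction. -/
theorem tendsto_integral_of_tendsto {ι : Type*} {l : Filter ι} {ν : ι → FiniteMeasure ℝ}
    (hL : 0 ≤ L) (hν : ∀ᶠ i in l, IsBoundedOn L C (ν i)) (hm : IsBoundedOn L C m)
    (h : Tendsto ν l (𝓝 m)) (hf : Continuous f) :
    Tendsto (fun i => ∫ x, f x ∂(ν i : Measure ℝ)) l (𝓝 (∫ x, f x ∂(m : Measure ℝ))) := by
  rw [← hm.integral_extendBounded hL hf]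
  refine ((FiniteMeasure.tendsto_iff_forall_integral_tendsto.1 h)
    (extendBounded hL (restrictIcc L hf))).congr' ?_
  filter_upwards [hν] with i hi using hi.integral_extendBounded hL hf

/-- The mass bound makes the integrals Lipschitz in the test function, so their convergence extends
from `D` to all of `C([0, L])`. The limits determine every cluster point, and compactness of the
bounded measures on `[0, L]` turns the uniqueness of the cluster point into convergence. -/
theorem exists_tendsto_of_dense_integral {ι : Type*} {l : Filter ι} [l.NeBot]
    {ν : ι → FiniteMeasure ℝ} (hL : 0 ≤ L) (hν : ∀ᶠ i in l, IsBoundedOn L C (ν i))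
    {D : Set C(Icc 0 L, ℝ)} (hD : Dense D)
    (h : ∀ g ∈ D, ∃ c, Tendsto (fun i => ∫ x, extendBounded hL g x ∂(ν i : Measure ℝ)) l (𝓝 c)) :
    ∃ m, IsBoundedOn L C m ∧ Tendsto ν l (𝓝 m) := by
  have hall : ∀ g : C(Icc 0 L, ℝ),
      ∃ c, Tendsto (fun i => ∫ x, extendBounded hL g x ∂(ν i : Measure ℝ)) l (𝓝 c) :=
    exists_tendsto_of_dense (C := C)
      (hν.mono fun i hi g g' => hi.dist_integral_extendBounded_le hL g g') hD h
  choose c hc using hall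
  obtain ⟨m, hm, hcl⟩ := (isCompact_setOf_isBoundedOn L C).exists_clusterPt
    (f := map ν l) (le_principal_iff.2 hν)
  have hlim : ∀ x, IsBoundedOn L C x → ClusterPt x (map ν l) → ∀ f : ℝ →ᵇ ℝ,
      ∫ y, f y ∂(x : Measure ℝ) = c (restrictIcc L f.continuous) := by
    intro x hx hxc f
    have h1 : Tendsto (fun i => ∫ y, f y ∂(ν i : Measure ℝ)) l
        (𝓝 (c (restrictIcc L f.continuous))) :=
      (hc _).congr' (hν.mono fun i hi => hi.integral_extendBounded hL f.continuous)
    have h2 : MapClusterPt (∫ y, f y ∂(x : Measure ℝ)) l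
        (fun i => ∫ y, f y ∂(ν i : Measure ℝ)) :=
      MapClusterPt.continuousAt_comp (f := fun μ : FiniteMeasure ℝ => ∫ y, f y ∂(μ : Measure ℝ))
        (FiniteMeasure.continuous_integral_boundedContinuousFunction f).continuousAt hxc
    have h3 : ClusterPt (∫ y, f y ∂(x : Measure ℝ)) (𝓝 (c (restrictIcc L f.continuous))) :=
      ClusterPt.mono h2 h1
    exact eq_of_nhds_neBot h3
  refine ⟨m, hm, (isCompact_setOf_isBoundedOn L C).le_nhds_of_unique_clusterPt hν
    fun x hx hxc => FiniteMeasure.ext_of_forall_integral_eq fun f => ?_⟩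
  rw [hlim x hx hxc f, hlim m hm hcl f]

/-- The order of measures is preserved by weak limits. -/
theorem le_of_tendsto_of_isBoundedOn {ι : Type*} {l : Filter ι} [l.NeBot]
    {ν ν' : ι → FiniteMeasure ℝ} (hν' : ∀ᶠ i in l, IsBoundedOn L C (ν' i))
    (hle : ∀ᶠ i in l, (ν i : Measure ℝ) ≤ ν' i) (h : Tendsto ν l (𝓝 m))
    (h' : Tendsto ν' l (𝓝 m')) : (m : Measure ℝ) ≤ m' := by
  -- Ordered pairs are the pairs `(m, m + q)`. With bounded `m` and `q` they form a continuous image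
  -- of a compact set, hence a closed set.
  have hK : IsCompact ((fun p : FiniteMeasure ℝ × FiniteMeasure ℝ => (p.1, p.1 + p.2)) ''
      ({m | IsBoundedOn L C m} ×ˢ {m | IsBoundedOn L C m})) :=
    ((isCompact_setOf_isBoundedOn L C).prod (isCompact_setOf_isBoundedOn L C)).image
      (continuous_fst.prodMk (continuous_fst.add continuous_snd))
  have hmem : (m, m') ∈ (fun p : FiniteMeasure ℝ × FiniteMeasure ℝ => (p.1, p.1 + p.2)) ''
      ({m | IsBoundedOn L C m} ×ˢ {m | IsBoundedOn L C m}) := by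
    refine hK.isClosed.mem_of_tendsto (h.prodMk_nhds h') ?_
    filter_upwards [hν', hle] with i hi hi'
    have hd : (ν i : Measure ℝ) + ((ν' i : Measure ℝ) - ν i) = ν' i := by
      rw [add_comm, Measure.sub_add_cancel_of_le hi']
    refine ⟨(ν i, ⟨(ν' i : Measure ℝ) - ν i, inferInstance⟩),
      ⟨hi.of_le hi', hi.of_le Measure.sub_le⟩, ?_⟩
    exact Prod.ext rfl (FiniteMeasure.toMeasure_injective hd)
  obtain ⟨p, -, hp⟩ := hmem
  rw [Prod.mk.injEq] at hp
  rw [← hp.2, ← hp.1]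
  exact Measure.le_add_right le_rfl

/-- The difference of ordered measures is a positive measure whose mass is the difference of the
masses. The variation in time of all integrals is thereby controlled by the scalar mass. -/
theorem IsBoundedOn.abs_integral_sub_le (hm' : IsBoundedOn L C m')
    (hle : (m : Measure ℝ) ≤ m') (hf : Continuous f) {B : ℝ} (h : ∀ x ∈ Icc 0 L, |f x| ≤ B) :
    |∫ x, f x ∂(m' : Measure ℝ) - ∫ x, f x ∂(m : Measure ℝ)| ≤
      B * ((m' : Measure ℝ).real univ - (m : Measure ℝ).real univ) := by
  let q : FiniteMeasure ℝ := ⟨(m' : Measure ℝ) - m, inferInstance⟩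
  have hq : IsBoundedOn L C q := hm'.of_le Measure.sub_le
  have hadd : (m' : Measure ℝ) = m + q := by
    change _ = (m : Measure ℝ) + ((m' : Measure ℝ) - m)
    rw [add_comm, Measure.sub_add_cancel_of_le hle]
  have hm := hm'.of_le hle
  rw [hadd, integral_add_measure (hm.integrable hf) (hq.integrable hf), measureReal_add_apply,
    add_sub_cancel_left, add_sub_cancel_left]
  exact hq.abs_integral_le h

theorem exists_tendsto_of_approx {ι : Type*} {l : Filter ι} [l.NeBot] {F : ι → ℝ}
    (h : ∀ η > 0, ∃ G : ι → ℝ, (∃ c, Tendsto G l (𝓝 c)) ∧ ∀ᶠ i in l, |F i - G i| ≤ η) :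
    ∃ c, Tendsto F l (𝓝 c) := by
  refine CompleteSpace.complete (f := map F l) ?_
  rw [Metric.cauchy_iff]
  refine ⟨inferInstance, fun η hη => ?_⟩
  obtain ⟨G, ⟨c, hc⟩, hG⟩ := h (η / 4) (by positivity)
  have hev : ∀ᶠ i in l, dist (F i) c < η / 2 := by
    filter_upwards [hG, Metric.tendsto_nhds.1 hc (η / 4) (by positivity)] with i hi1 hi2
    rw [← Real.dist_eq] at hi1
    linarith [dist_triangle (F i) (G i) c]
  refine ⟨F '' {i | dist (F i) c < η / 2}, image_mem_map hev, ?_⟩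
  rintro _ ⟨i, hi, rfl⟩ _ ⟨j, hj, rfl⟩
  have hi' : dist (F i) c < η / 2 := hi
  have hj' : dist (F j) c < η / 2 := hj
  linarith [dist_triangle_right (F i) (F j) c]

/-- A version of Helly's selection theorem for measures whose mass is controlled in time. -/
theorem exists_subseq_tendsto_of_monotone {T : ℝ} (hL : 0 ≤ L) (hT : 0 ≤ T)
    {ν : ℕ → ℝ → FiniteMeasure ℝ} {U : ℝ → ℝ}
    (hν : ∀ n, ∀ t ∈ Icc 0 T, IsBoundedOn L C (ν n t)) (hU : ContinuousOn U (Icc 0 T))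
    (hmono : ∀ n, ∀ s ∈ Icc 0 T, ∀ t ∈ Icc 0 T, s ≤ t → (ν n s : Measure ℝ) ≤ ν n t)
    (hmass : ∀ n, ∀ s ∈ Icc 0 T, ∀ t ∈ Icc 0 T, s ≤ t →
      (ν n t : Measure ℝ).real univ - (ν n s : Measure ℝ).real univ ≤ U t - U s) :
    ∃ φ : ℕ → ℕ, StrictMono φ ∧ ∃ m : ℝ → FiniteMeasure ℝ, ∀ t ∈ Icc 0 T,
      IsBoundedOn L C (m t) ∧ Tendsto (fun n => ν (φ n) t) atTop (𝓝 (m t)) := by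
  obtain ⟨D, hDc, hD⟩ := TopologicalSpace.exists_countable_dense C(Icc 0 L, ℝ)
  have : Nonempty (Icc 0 T) := ⟨⟨0, left_mem_Icc.2 hT⟩⟩
  obtain ⟨Q, hQc, hQ⟩ := TopologicalSpace.exists_countable_dense (Icc 0 T)
  have := hDc.to_subtype
  have := hQc.to_subtype
  -- Countably many test functions and times give points in a product of compact intervals, so a
  -- single subsequence serves all of them.
  let x : ℕ → D × Q → ℝ := fun n p =>
    ∫ y, extendBounded hL (p.1 : C(Icc 0 L, ℝ)) y ∂(ν n (p.2 : Icc 0 T) : Measure ℝ)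
  have hbd : ∀ (g : C(Icc 0 L, ℝ)), ∀ y ∈ Icc 0 L, |extendBounded hL g y| ≤ ‖g‖ :=
    fun g y hy => by
      rw [extendBounded_of_mem hL _ hy]
      exact g.norm_coe_le_norm _
  have hx : ∀ n, x n ∈ Set.pi univ fun p : D × Q =>
      Icc (-(‖(p.1 : C(Icc 0 L, ℝ))‖ * C)) (‖(p.1 : C(Icc 0 L, ℝ))‖ * C) := fun n p _ => by
    have hn := hν n _ (p.2 : Icc 0 T).2
    exact abs_le.1 ((hn.abs_integral_le (hbd p.1)).trans
      (mul_le_mul_of_nonneg_left hn.real_univ_le (norm_nonneg _)))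
  obtain ⟨c, -, φ, hφ, hc⟩ := (isCompact_univ_pi fun p : D × Q => isCompact_Icc).tendsto_subseq hx
  rw [tendsto_pi_nhds] at hc
  have key : ∀ t ∈ Icc 0 T, ∃ m, IsBoundedOn L C m ∧ Tendsto (fun n => ν (φ n) t) atTop (𝓝 m) := by
    intro t ht
    refine exists_tendsto_of_dense_integral hL (Eventually.of_forall fun n => hν (φ n) t ht) hD
      fun g hg => exists_tendsto_of_approx fun η hη => ?_
    have hpos : 0 < η / (‖g‖ + 1) := by positivity
    -- An arbitrary time is compared with a nearby time in `Q`: the integrals differ by at most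
    -- `‖g‖` times the increment of `U`, uniformly in the index.
    have hUt : ContinuousAt (fun s : Icc 0 T => U s) ⟨t, ht⟩ :=
      (continuousOn_iff_continuous_domRestrict.1 hU).continuousAt
    obtain ⟨s, hsQ, hs⟩ := hQ.exists_mem_open
      (isOpen_interior (s := {s : Icc 0 T | dist (U s) (U t) < η / (‖g‖ + 1)}))
      ⟨⟨t, ht⟩, mem_interior_iff_mem_nhds.2 (Metric.tendsto_nhds.1 hUt _ hpos)⟩
    have hs' : dist (U s) (U t) < η / (‖g‖ + 1) :=
      interior_subset (s := {s : Icc 0 T | dist (U s) (U t) < η / (‖g‖ + 1)}) hs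
    refine ⟨fun n => x (φ n) (⟨g, hg⟩, ⟨s, hsQ⟩), ⟨_, hc _⟩, Eventually.of_forall fun n => ?_⟩
    have hle : ∀ r ∈ Icc 0 T, ∀ r' ∈ Icc 0 T, r ≤ r' →
        |∫ y, extendBounded hL g y ∂(ν (φ n) r' : Measure ℝ) -
          ∫ y, extendBounded hL g y ∂(ν (φ n) r : Measure ℝ)| ≤ ‖g‖ * |U r' - U r| :=
      fun r hr r' hr' hrr' =>
        ((hν (φ n) r' hr').abs_integral_sub_le (hmono _ r hr r' hr' hrr')
          (extendBounded hL g).continuous (hbd g)).trans (mul_le_mul_of_nonneg_left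
            ((hmass _ r hr r' hr' hrr').trans (le_abs_self _)) (norm_nonneg _))
    have hfin : ‖g‖ * |U s - U t| ≤ η := by
      rw [← Real.dist_eq]
      have h1 : (‖g‖ + 1) * dist (U s) (U t) < η := (lt_div_iff₀' (by positivity)).1 hs'
      have h2 := dist_nonneg (x := U s) (y := U t)
      linarith
    rcases le_total t s with hts | hst
    · rw [abs_sub_comm]
      exact (hle t ht s s.2 hts).trans hfin
    · rw [abs_sub_comm (U s)] at hfin
      exact (hle s s.2 t ht hst).trans hfin
  choose! m hm using key
  exact ⟨φ, hφ, m, hm⟩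

end WeakConvergence

/-! ### Time derivatives of monotone families of measures -/

section TimeDerivative

open scoped NNReal

variable {L : ℝ} {C : ℝ≥0}

/-- The integrals of countably many test functions are absolutely continuous in time, hence
differentiable off a common null set. Where `V` is differentiable too, the difference quotients are
positive measures of bounded mass, and convergence on a dense set yields a weak limit. -/
theorem ae_exists_tendsto_slope_of_monotone {T : ℝ} (hL : 0 ≤ L) (hT : 0 ≤ T)
    {m : ℝ → FiniteMeasure ℝ} {V : ℝ → ℝ} (hm : ∀ t ∈ Icc 0 T, IsBoundedOn L C (m t))
    (hV : AbsolutelyContinuousOnInterval V 0 T)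
    (hmono : ∀ s ∈ Icc 0 T, ∀ t ∈ Icc 0 T, s ≤ t → (m s : Measure ℝ) ≤ m t)
    (hmass : ∀ s ∈ Icc 0 T, ∀ t ∈ Icc 0 T, s ≤ t →
      (m t : Measure ℝ).real univ - (m s : Measure ℝ).real univ ≤ V t - V s) :
    ∀ᵐ t ∂volume.restrict (Icc 0 T), ∃ (C' : ℝ≥0) (q : FiniteMeasure ℝ), IsBoundedOn L C' q ∧
      ∀ f : ℝ → ℝ, Continuous f → Tendsto (fun s => (s - t)⁻¹ *
        (∫ x, f x ∂(m s : Measure ℝ) - ∫ x, f x ∂(m t : Measure ℝ))) (𝓝[≠] t)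
          (𝓝 (∫ x, f x ∂(q : Measure ℝ))) := by
  obtain ⟨D, hDc, hD⟩ := TopologicalSpace.exists_countable_dense C(Icc 0 L, ℝ)
  have hbd : ∀ (g : C(Icc 0 L, ℝ)), ∀ y ∈ Icc 0 L, |extendBounded hL g y| ≤ ‖g‖ :=
    fun g y hy => by
      rw [extendBounded_of_mem hL _ hy]
      exact g.norm_coe_le_norm _
  have hFac : ∀ g : C(Icc 0 L, ℝ), AbsolutelyContinuousOnInterval
      (fun t => ∫ x, extendBounded hL g x ∂(m t : Measure ℝ)) 0 T := fun g => by
    have h : AbsContWith dist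
        (fun t => ∫ x, extendBounded hL g x ∂(m t : Measure ℝ)) 0 T := by
      refine AbsContWith.of_le_add (C := ‖g‖) hV hV (fun _ _ => dist_nonneg) fun s hs t ht => ?_
      rw [uIcc_of_le hT] at hs ht
      have hle : ∀ r ∈ Icc 0 T, ∀ r' ∈ Icc 0 T, r ≤ r' →
          dist (∫ y, extendBounded hL g y ∂(m r' : Measure ℝ))
            (∫ y, extendBounded hL g y ∂(m r : Measure ℝ)) ≤
            ‖g‖ * (dist (V r') (V r) + dist (V r') (V r)) :=
        fun r hr r' hr' hrr' =>
          ((hm r' hr').abs_integral_sub_le (hmono r hr r' hr' hrr')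
            (extendBounded hL g).continuous (hbd g)).trans (mul_le_mul_of_nonneg_left
              ((hmass r hr r' hr' hrr').trans ((le_abs_self _).trans
                (le_add_of_nonneg_left (abs_nonneg _)))) (norm_nonneg _))
      rcases le_total s t with hst | hst
      · rw [dist_comm, dist_comm (V s)]
        exact hle s hs t ht hst
      · exact hle t ht s hs hst
    exact h
  have hne : ∀ c : ℝ, ∀ᵐ s : ℝ, s ≠ c := fun c => by simp [ae_iff, measure_singleton]
  rw [ae_restrict_iff' measurableSet_Icc]
  have hDae : ∀ᵐ t : ℝ, ∀ g ∈ D, t ∈ uIcc 0 T → DifferentiableAt ℝ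
      (fun t => ∫ x, extendBounded hL g x ∂(m t : Measure ℝ)) t :=
    (ae_ball_iff hDc).2 fun g _ => (hFac g).ae_differentiableAt
  filter_upwards [hDae, hV.ae_differentiableAt, hne 0, hne T] with t h1 h2 h3 h4 ht
  rw [uIcc_of_le hT] at h1 h2
  have hIcc : ∀ᶠ s in 𝓝[≠] t, s ∈ Icc 0 T :=
    nhdsWithin_le_nhds (Icc_mem_nhds (lt_of_le_of_ne ht.1 h3.symm) (lt_of_le_of_ne ht.2 h4))
  -- Ordering the two times makes the increment a positive measure for `s` on either side of `t`.
  -- Dividing by `|s - t|` then gives the signed difference quotient, since numerator and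
  -- denominator change sign together.
  let δ : ℝ → FiniteMeasure ℝ := fun s => ⟨(m (max s t) : Measure ℝ) - m (min s t), inferInstance⟩
  let q : ℝ → FiniteMeasure ℝ := fun s => |s - t|⁻¹.toNNReal • δ s
  have hminmax : ∀ s ∈ Icc 0 T, min s t ∈ Icc 0 T ∧ max s t ∈ Icc 0 T := fun s hs =>
    ⟨⟨le_min hs.1 ht.1, (min_le_left _ _).trans hs.2⟩,
      ⟨hs.1.trans (le_max_left _ _), max_le hs.2 ht.2⟩⟩
  have hle : ∀ s ∈ Icc 0 T, (m (min s t) : Measure ℝ) ≤ m (max s t) := fun s hs =>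
    hmono _ (hminmax s hs).1 _ (hminmax s hs).2 (min_le_max)
  have hadd : ∀ s ∈ Icc 0 T,
      (m (min s t) : Measure ℝ) + (δ s : Measure ℝ) = m (max s t) :=
    fun s hs => (add_comm _ _).trans (Measure.sub_add_cancel_of_le (hle s hs))
  have hqint : ∀ s ∈ Icc 0 T, ∀ f : ℝ → ℝ, Continuous f → ∫ x, f x ∂(q s : Measure ℝ) =
      (s - t)⁻¹ * (∫ x, f x ∂(m s : Measure ℝ) - ∫ x, f x ∂(m t : Measure ℝ)) := by
    intro s hs f hf
    have hb := hm _ (hminmax s hs).2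
    have hd : IsBoundedOn L C (δ s) := hb.of_le Measure.sub_le
    have e1 : ∫ x, f x ∂(q s : Measure ℝ) = |s - t|⁻¹ *
        ∫ x, f x ∂(δ s : Measure ℝ) := by
      change ∫ x, f x ∂(|s - t|⁻¹.toNNReal • (δ s : Measure ℝ)) = _
      rw [integral_smul_nnreal_measure, NNReal.smul_def, Real.coe_toNNReal _ (by positivity),
        smul_eq_mul]
    have e2 : ∫ x, f x ∂(m (max s t) : Measure ℝ) = ∫ x, f x ∂(m (min s t) : Measure ℝ) +
        ∫ x, f x ∂(δ s : Measure ℝ) := by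
      rw [← integral_add_measure ((hm _ (hminmax s hs).1).integrable hf) (hd.integrable hf),
        hadd s hs]
    rw [e1, ← sub_eq_of_eq_add' e2]
    rcases le_total s t with hst | hst
    · rw [max_eq_right hst, min_eq_left hst, abs_of_nonpos (sub_nonpos.2 hst), inv_neg]
      ring
    · rw [max_eq_left hst, min_eq_right hst, abs_of_nonneg (sub_nonneg.2 hst)]
  have hslope := (h2 ht).hasDerivAt.tendsto_slope
  have hqb : ∀ᶠ s in 𝓝[≠] t, IsBoundedOn L (|deriv V t| + 1).toNNReal (q s) := by
    have hbnd : ∀ᶠ s in 𝓝[≠] t, |slope V t s| < |deriv V t| + 1 :=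
      hslope.abs.eventually (gt_mem_nhds (lt_add_one _))
    filter_upwards [hIcc, hbnd, self_mem_nhdsWithin] with s hs hs' hst
    have hd : IsBoundedOn L C (δ s) := (hm _ (hminmax s hs).2).of_le Measure.sub_le
    refine ⟨?_, ?_⟩
    · rw [← NNReal.coe_le_coe, Real.coe_toNNReal _ (by positivity)]
      have e1 : ((q s).mass : ℝ) = ∫ x, (1 : ℝ) ∂(q s : Measure ℝ) := by
        rw [integral_const, smul_eq_mul, mul_one]
        rfl
      have e2 := (hm _ (hminmax s hs).2).abs_integral_sub_le (hle s hs)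
        (f := fun _ => (1 : ℝ)) continuous_const (B := 1) (by simp)
      have e3 := hmass _ (hminmax s hs).1 _ (hminmax s hs).2 min_le_max
      have e4 : |∫ x, (1 : ℝ) ∂(q s : Measure ℝ)| ≤ |slope V t s| := by
        rw [hqint s hs _ continuous_const, slope_def_field, div_eq_inv_mul, abs_mul, abs_mul]
        refine mul_le_mul_of_nonneg_left ?_ (abs_nonneg _)
        rcases le_total s t with h | h
        · rw [max_eq_right h, min_eq_left h] at e2 e3
          rw [abs_sub_comm, abs_sub_comm (V s)]
          refine e2.trans ?_
          rw [one_mul]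
          exact e3.trans (le_abs_self _)
        · rw [max_eq_left h, min_eq_right h] at e2 e3
          refine e2.trans ?_
          rw [one_mul]
          exact e3.trans (le_abs_self _)
      rw [e1]
      exact (le_abs_self _).trans (e4.trans hs'.le)
    · change (|s - t|⁻¹.toNNReal • δ s) _ = 0
      rw [FiniteMeasure.coeFn_smul, Pi.smul_apply, hd.2, smul_zero]
  obtain ⟨p, hp, hlim⟩ := exists_tendsto_of_dense_integral hL hqb hD fun g hg => by
    refine ⟨_, (h1 g hg ht).hasDerivAt.tendsto_slope.congr' ?_⟩
    filter_upwards [hIcc] with s hs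
    rw [hqint s hs _ (extendBounded hL g).continuous, slope_def_field, div_eq_inv_mul]
  refine ⟨_, p, hp, fun f hf => (tendsto_integral_of_tendsto hL hqb hp hlim hf).congr' ?_⟩
  filter_upwards [hIcc] with s hs using hqint s hs f hf

end TimeDerivative

/-! ### Signed measures -/

section Signed

variable {L A C : ℝ} {a b : ℝ}

theorem tvDist_comm (μ ν : SignedMeasure ℝ) : tvDist μ ν = tvDist ν μ := by
  rw [tvDist, tvDist, ← neg_sub, VectorMeasure.variation_neg]

theorem tvDist_nonneg (μ ν : SignedMeasure ℝ) : 0 ≤ tvDist μ ν := measureReal_nonneg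

/-- Write `a μ - b ν = (a - b) μ - b (ν - μ)`. As `ν - μ` is positive, its total variation is the
difference of the masses. -/
theorem tvDist_smul_le_of_le {μ ν : Measure ℝ} [IsFiniteMeasure μ] [IsFiniteMeasure ν]
    (hle : μ ≤ ν) : tvDist (a • μ.toSignedMeasure) (b • ν.toSignedMeasure) ≤
      |a - b| * μ.real univ + |b| * (ν.real univ - μ.real univ) := by
  have hadd : ν = μ + (ν - μ) := by rw [add_comm, Measure.sub_add_cancel_of_le hle]
  have hreal : ∀ s, ν.real s = μ.real s + (ν - μ).real s := fun s => by
    conv_lhs => rw [hadd]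
    exact measureReal_add_apply
  let q : Measure ℝ := |a - b|.toNNReal • μ + |b|.toNNReal • (ν - μ)
  have hq : ∀ s, q.real s = |a - b| * μ.real s + |b| * (ν - μ).real s := fun s => by
    rw [measureReal_add_apply, measureReal_nnreal_smul_apply, measureReal_nnreal_smul_apply,
      Real.coe_toNNReal _ (abs_nonneg _), Real.coe_toNNReal _ (abs_nonneg _)]
  have hvar : (a • μ.toSignedMeasure - b • ν.toSignedMeasure).variation ≤ q := by
    refine VectorMeasure.variation_le_of_forall_enorm_le fun s hs => ?_
    rw [← ofReal_norm, ← ENNReal.ofReal_toReal (measure_ne_top q s)]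
    refine ENNReal.ofReal_le_ofReal ?_
    change _ ≤ q.real s
    rw [hq]
    have : (a • μ.toSignedMeasure - b • ν.toSignedMeasure) s =
        (a - b) * μ.real s - b * (ν - μ).real s := by
      change a * μ.toSignedMeasure s - b * ν.toSignedMeasure s = _
      rw [Measure.toSignedMeasure_apply_measurable hs, Measure.toSignedMeasure_apply_measurable hs,
        hreal s]
      ring
    rw [this, Real.norm_eq_abs]
    refine (abs_sub _ _).trans (le_of_eq ?_)
    rw [abs_mul, abs_mul, abs_of_nonneg (measureReal_nonneg (μ := μ)),
      abs_of_nonneg (measureReal_nonneg (μ := ν - μ))]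
  have h1 : tvDist (a • μ.toSignedMeasure) (b • ν.toSignedMeasure) ≤ q.real univ :=
    ENNReal.toReal_mono (measure_ne_top _ _) (hvar univ)
  rw [hq] at h1
  rwa [hreal univ, add_sub_cancel_left]

theorem tvDist_smul_le {μ ν : Measure ℝ} [IsFiniteMeasure μ] [IsFiniteMeasure ν]
    (hle : μ ≤ ν ∨ ν ≤ μ) (ha : |a| ≤ A) (hb : |b| ≤ A) (hμ : μ.real univ ≤ C)
    (hν : ν.real univ ≤ C) : tvDist (a • μ.toSignedMeasure) (b • ν.toSignedMeasure) ≤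
      C * |a - b| + A * |μ.real univ - ν.real univ| := by
  rcases hle with h | h
  · refine (tvDist_smul_le_of_le h).trans ?_
    rw [abs_sub_comm (μ.real univ), mul_comm]
    exact add_le_add (mul_le_mul_of_nonneg_right hμ (abs_nonneg _))
      (mul_le_mul hb (le_abs_self _) (sub_nonneg.2
        (ENNReal.toReal_mono (measure_ne_top _ _) (h univ))) ((abs_nonneg _).trans hb))
  · rw [tvDist_comm]
    refine (tvDist_smul_le_of_le h).trans ?_
    rw [abs_sub_comm b, mul_comm]
    exact add_le_add (mul_le_mul_of_nonneg_right hν (abs_nonneg _))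
      (mul_le_mul ha (le_abs_self _) (sub_nonneg.2
        (ENNReal.toReal_mono (measure_ne_top _ _) (h univ))) ((abs_nonneg _).trans ha))

theorem isMeasureOn_smul_toSignedMeasure {μ : Measure ℝ} [IsFiniteMeasure μ] {X : Set ℝ}
    (hX : MeasurableSet X) (h : ∀ᵐ x ∂μ, x ∈ X) (a : ℝ) :
    IsMeasureOn X (a • μ.toSignedMeasure) := by
  rw [IsMeasureOn, VectorMeasure.restrict_smul, VectorMeasure.restrict_toSignedMeasure hX]
  congr 2
  exact Measure.restrict_eq_self_of_ae_mem h

end Signed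

/-! ### The damage measures -/

section DamageMeasure

variable {L ε : ℝ} {θ θ' : ℝ → ℝ}

/-- The measure of density `(1 - θ) / ε` on `(0, L)`, for a volume fraction `θ`. -/
noncomputable def damage (L ε : ℝ) (θ : ℝ → ℝ) : FiniteMeasure ℝ :=
  ⟨(volume.restrict (Ioo 0 L)).withDensity
    -- The truncation by `1` makes the measure finite for every function `θ`. It is inactive when
    -- `θ` is a volume fraction.
    fun x => ENNReal.ofReal (min 1 (1 - θ x)) * ENNReal.ofReal ε⁻¹, by
    refine isFiniteMeasure_withDensity (ne_top_of_le_ne_top (b := ∫⁻ _ in Ioo 0 L,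
      ENNReal.ofReal ε⁻¹) ?_ (lintegral_mono fun x => ?_))
    · rw [lintegral_const]
      exact ENNReal.mul_ne_top ENNReal.ofReal_ne_top (measure_ne_top _ _)
    · refine mul_le_of_le_one_left' ?_
      rw [← ENNReal.ofReal_one]
      exact ENNReal.ofReal_le_ofReal (min_le_left _ _)⟩

theorem IsVolumeFraction.coe_damage (hθ : IsVolumeFraction L θ) :
    (damage L ε θ : Measure ℝ) =
      (volume.restrict (Ioo 0 L)).withDensity fun x => ENNReal.ofReal ((1 - θ x) / ε) := by
  refine withDensity_congr_ae (hθ.2.mono fun x hx => ?_)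
  change ENNReal.ofReal (min 1 (1 - θ x)) * ENNReal.ofReal ε⁻¹ = ENNReal.ofReal ((1 - θ x) / ε)
  rw [min_eq_right (by linarith [hx.1]), ← ENNReal.ofReal_mul (by linarith [hx.2]), div_eq_mul_inv]

theorem IsVolumeFraction.aemeasurable_density (hθ : IsVolumeFraction L θ) (ε : ℝ) :
    AEMeasurable (fun x => ENNReal.ofReal ((1 - θ x) / ε)) (volume.restrict (Ioo 0 L)) :=
  ((aemeasurable_const.sub hθ.1).div_const ε).ennreal_ofReal

theorem IsVolumeFraction.integral_damage (hθ : IsVolumeFraction L θ) (hε : 0 < ε) (f : ℝ → ℝ) :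
    ∫ x, f x ∂(damage L ε θ : Measure ℝ) = ∫ x in Ioo 0 L, (1 - θ x) / ε * f x := by
  rw [hθ.coe_damage, integral_withDensity_eq_integral_toReal_smul₀ (hθ.aemeasurable_density ε)
    (Eventually.of_forall fun _ => ENNReal.ofReal_lt_top)]
  refine integral_congr_ae (hθ.2.mono fun x hx => ?_)
  have : 0 ≤ (1 - θ x) / ε := div_nonneg (by linarith [hx.2]) hε.le
  simp only [ENNReal.toReal_ofReal this, smul_eq_mul]

theorem IsVolumeFraction.damage_univ (hθ : IsVolumeFraction L θ) (hε : 0 < ε) :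
    (damage L ε θ : Measure ℝ).real univ = damagedVolume L θ / ε := by
  have h := hθ.integral_damage hε fun _ => 1
  rw [integral_const, smul_eq_mul, mul_one] at h
  rw [h, damagedVolume, ← integral_div]
  simp only [mul_one]

theorem ae_damage_mem (L ε : ℝ) (θ : ℝ → ℝ) : ∀ᵐ x ∂(damage L ε θ : Measure ℝ), x ∈ Ioo 0 L :=
  (withDensity_absolutelyContinuous _ _).ae_le (ae_restrict_mem measurableSet_Ioo)

theorem IsVolumeFraction.isBoundedOn_damage (hθ : IsVolumeFraction L θ) (hε : 0 < ε) {C : NNReal}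
    (h : damagedVolume L θ / ε ≤ C) : IsBoundedOn L C (damage L ε θ) := by
  refine ⟨?_, ?_⟩
  · rw [← hθ.damage_univ hε] at h
    exact NNReal.coe_le_coe.1 h
  · rw [FiniteMeasure.null_iff_toMeasure_null]
    exact ae_iff.1 ((ae_damage_mem L ε θ).mono fun x hx => Ioo_subset_Icc_self hx)

theorem IsVolumeFraction.damageMeasure_eq (hθ : IsVolumeFraction L θ) (hε : 0 < ε) :
    damageMeasure L ε θ = (damage L ε θ : Measure ℝ).toSignedMeasure := by
  have hnn : ∀ᵐ x ∂volume.restrict (Ioo 0 L), 0 ≤ (1 - θ x) / ε := hθ.2.mono fun x hx =>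
    div_nonneg (by linarith [hx.2]) hε.le
  have hi : Integrable (fun x => (1 - θ x) / ε) (volume.restrict (Ioo 0 L)) :=
    hθ.integrable_one_sub.div_const ε
  have h1 : ∫⁻ x in Ioo 0 L, ENNReal.ofReal ((1 - θ x) / ε) ≠ ⊤ :=
    (lt_of_le_of_lt (lintegral_mono fun x => Real.ofReal_le_enorm _) hi.2).ne
  have h2 := withDensityᵥ_toReal (hθ.aemeasurable_density ε) h1
  rw [damageMeasure, WithDensityᵥEq.congr_ae (hnn.mono fun x hx =>
    (ENNReal.toReal_ofReal hx).symm), h2]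
  have := isFiniteMeasure_withDensity h1
  exact Measure.toSignedMeasure_congr (hθ.coe_damage).symm

theorem IsVolumeFraction.damage_le (hθ : IsVolumeFraction L θ) (hθ' : IsVolumeFraction L θ')
    (hε : 0 < ε) (h : ∀ᵐ x ∂volume.restrict (Ioo 0 L), θ' x ≤ θ x) :
    (damage L ε θ : Measure ℝ) ≤ damage L ε θ' := by
  rw [hθ.coe_damage, hθ'.coe_damage]
  refine withDensity_mono (h.mono fun x hx => ENNReal.ofReal_le_ofReal ?_)
  exact div_le_div_of_nonneg_right (by linarith) hε.le

end DamageMeasure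

/-! ### Uniform estimates -/

section Estimates

variable {L T κ a₀ a₁ ε R : ℝ} {w : ℝ → H1 ⊤} {u : ℝ → H1 (body L)} {Θ a : ℝ → ℝ → ℝ}

/-- The compliance `1 / (ε a₀)` of the damaged material is of order `1 / ε` and is absorbed by the
rescaling of the damaged volume, leaving the coefficient `1 / a₀ - ε / a₁`, which tends to `1 / a₀`.
-/
theorem totalCompliance_eq (ha₀ : 0 < a₀) (hε : 0 < ε) (L a₁ : ℝ) (θ : ℝ → ℝ) :
    totalCompliance L (ε * a₀) a₁ θ =
      L / a₁ + (1 / a₀ - ε / a₁) * (damagedVolume L θ / ε) := by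
  rw [totalCompliance, add_right_inj]
  have : 1 / (ε * a₀) - 1 / a₁ = (1 / a₀ - ε / a₁) / ε := by
    field_simp
  rw [this]
  ring

/-- The factors `1 / ε` in the toughness and in the compliance cancel, so the squared threshold
stress has the finite limit `2κa₀`. -/
theorem damage_parameter_eq (ha₀ : 0 < a₀) (hε : 0 < ε) (κ a₁ : ℝ) :
    2 * (κ / ε) / (1 / (ε * a₀) - 1 / a₁) = 2 * κ / (1 / a₀ - ε / a₁) := by
  have : 1 / (ε * a₀) - 1 / a₁ = (1 / a₀ - ε / a₁) / ε := by
    field_simp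
  rw [this, mul_div_assoc', div_div_div_cancel_right₀ hε.ne']

theorem damage_coefficient_pos (ha₀ : 0 < a₀) (hε : 0 < ε) (hlt : ε * a₀ < a₁) :
    0 < 1 / a₀ - ε / a₁ := by
  have ha₁ : 0 < a₁ := (mul_pos hε ha₀).trans hlt
  rw [sub_pos, div_lt_div_iff₀ ha₁ ha₀]
  linarith

namespace IsBrittleEvolution

variable (h : IsBrittleEvolution L T (κ / ε) (ε * a₀) a₁ w u Θ a) (hL : 0 < L) (hκ : 0 < κ)
  (ha₀ : 0 < a₀) (hε : 0 < ε) (hlt : ε * a₀ < a₁) (hw : AbsolutelyContinuousOnInterval w 0 T)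
  (hR : ∀ t ∈ Icc 0 T, |stretch L (w t)| ≤ R)

include h hL ha₀ hε hlt hw hR in
theorem griffith_inequality {s t : ℝ} (hs : s ∈ Icc 0 T) (ht : t ∈ Icc 0 T) (hst : s ≤ t) :
    (totalCompliance L (ε * a₀) a₁ (Θ t) - totalCompliance L (ε * a₀) a₁ (Θ s)) *
      (2 * κ / (1 / a₀ - ε / a₁) * (totalCompliance L (ε * a₀) a₁ (Θ s) *
        totalCompliance L (ε * a₀) a₁ (Θ t)) - stretch L (w t) ^ 2 -
        2 * R * (absVar (fun t => stretch L (w t)) t - absVar (fun t => stretch L (w t)) s)) ≤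
      0 := by
  have hα : 0 < ε * a₀ := mul_pos hε ha₀
  rw [← damage_parameter_eq ha₀ hε]
  exact sub_mul_threshold_le (C := fun t => totalCompliance L (ε * a₀) a₁ (Θ t))
    (hw.comp_lipschitz (stretch L).lipschitz) hR (h.totalCompliance_monotoneOn hα hlt)
    (div_pos hL (hα.trans hlt))
    (fun t ht => (h.volumeFraction t ht).le_totalCompliance hα hlt)
    (fun t ht => h.balance hL hα hlt hw ht) hs ht hst

include h hL ha₀ hε hlt hR in
-- The condition `hsmall` settles the case of a completely damaged bar, about which minimality is
-- silent. It amounts to `R² a₀ ε² ≤ 2κL²` and so holds for small `ε`.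
theorem stretch_sq_le_mul_totalCompliance_sq (hsmall : R ^ 2 * (ε * a₀) ≤ 2 * (κ / ε) * L ^ 2)
    {t : ℝ} (ht : t ∈ Icc 0 T) : stretch L (w t) ^ 2 ≤
      2 * κ / (1 / a₀ - ε / a₁) * totalCompliance L (ε * a₀) a₁ (Θ t) ^ 2 := by
  have hα : 0 < ε * a₀ := mul_pos hε ha₀
  have ha₁ := hα.trans hlt
  have hB := one_div_sub_pos hα hlt
  have h1 := h.stretch_sq_le hL hα hlt ht (by
    have e1 : (1 / (ε * a₀) - 1 / a₁) * (ε * a₀) ^ 2 = ε * a₀ - (ε * a₀) ^ 2 / a₁ := by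
      field_simp
    rw [mul_assoc, e1]
    refine le_trans ?_ hsmall
    have e2 : stretch L (w t) ^ 2 ≤ R ^ 2 := sq_le_sq' (by linarith [(abs_le.1 (hR t ht)).1])
      (abs_le.1 (hR t ht)).2
    have e3 : 0 ≤ (ε * a₀) ^ 2 / a₁ := by positivity
    have e4 : (ε * a₀) ^ 2 / a₁ ≤ ε * a₀ := by
      rw [div_le_iff₀ ha₁, sq]
      exact mul_le_mul_of_nonneg_left hlt.le hα.le
    exact mul_le_mul e2 (by linarith) (by linarith) (sq_nonneg _))
  rw [← damage_parameter_eq ha₀ hε, div_mul_eq_mul_div, le_div_iff₀ hB]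
  exact h1

include h hL hκ ha₀ hε hlt hw hR in
-- This is the estimate uniform in `ε`. The coefficient `1 / a₀ - ε / a₁` in the compliance cancels
-- the one in the threshold, leaving `2κ` on the left, and the lower bound `L / a₁` of the
-- compliance does not involve `ε`.
theorem damagedVolume_div_sub_le (hsmall : R ^ 2 * (ε * a₀) ≤ 2 * (κ / ε) * L ^ 2)
    {s t : ℝ} (hs : s ∈ Icc 0 T) (ht : t ∈ Icc 0 T) (hst : s ≤ t) :
    damagedVolume L (Θ t) / ε - damagedVolume L (Θ s) / ε ≤ 2 * R * a₁ / (κ * L) *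
      (absVar (fun t => stretch L (w t)) t - absVar (fun t => stretch L (w t)) s) := by
  have hα : 0 < ε * a₀ := mul_pos hε ha₀
  have ha₁ := hα.trans hlt
  have hb := damage_coefficient_pos ha₀ hε hlt
  have h1 := lam_mul_sub_le (C := fun t => totalCompliance L (ε * a₀) a₁ (Θ t))
    (lam := 2 * κ / (1 / a₀ - ε / a₁)) (by positivity)
    (hw.comp_lipschitz (stretch L).lipschitz) hR (h.totalCompliance_monotoneOn hα hlt)
    (div_pos hL ha₁) (fun t ht => (h.volumeFraction t ht).le_totalCompliance hα hlt)
    (fun t ht => h.stretch_sq_le_mul_totalCompliance_sq hL ha₀ hε hlt hR hsmall ht) hs ht hst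
    (h.griffith_inequality hL ha₀ hε hlt hw hR hs ht hst)
  simp only [totalCompliance_eq ha₀ hε] at h1
  generalize 1 / a₀ - ε / a₁ = b at h1 hb
  have e1 : 2 * κ / b * (L / a₁ + b * (damagedVolume L (Θ t) / ε) -
      (L / a₁ + b * (damagedVolume L (Θ s) / ε))) =
      2 * κ * (damagedVolume L (Θ t) / ε - damagedVolume L (Θ s) / ε) := by
    have := hb.ne'
    field_simp
    ring
  rw [e1] at h1
  have e2 : ∀ V, 2 * R * a₁ / (κ * L) * V = 4 * R / (L / a₁) * V / (2 * κ) := fun V => by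
    field_simp
    ring
  rw [e2, le_div_iff₀ (by positivity)]
  linarith

include h hL hκ ha₀ hε hlt hR in
theorem initial_damagedVolume_div_le (hT : 0 < T) :
    damagedVolume L (Θ 0) / ε ≤ R ^ 2 * a₁ / (2 * κ * L) := by
  have hα : 0 < ε * a₀ := mul_pos hε ha₀
  have ha₁ := hα.trans hlt
  have h1 := h.initial_damagedVolume_le hL hα hlt hT
  have h0 := hR 0 (left_mem_Icc.2 hT.le)
  have e2 : stretch L (w 0) ^ 2 ≤ R ^ 2 := sq_le_sq' (by linarith [(abs_le.1 h0).1])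
    (abs_le.1 h0).2
  have e3 : 1 / 2 * (stretch L (w 0) ^ 2 / (L / a₁)) = stretch L (w 0) ^ 2 * (a₁ / (2 * L)) := by
    field_simp
  have e4 : R ^ 2 * a₁ / (2 * κ * L) = R ^ 2 * (a₁ / (2 * L)) / κ := by
    field_simp
  rw [e4, le_div_iff₀ hκ]
  rw [e3] at h1
  have e5 : κ / ε * damagedVolume L (Θ 0) = damagedVolume L (Θ 0) / ε * κ := by ring
  rw [← e5]
  exact h1.trans (mul_le_mul_of_nonneg_right e2 (by positivity))

end IsBrittleEvolution

end Estimates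

/-! ### Distribution functions of finite measures -/

section DistributionFunction

open scoped NNReal

variable {L : ℝ} {C : ℝ≥0} {c c' : FiniteMeasure ℝ}

/-- Dominated convergence of indicators. The general `S` covers both one-sided limits: the right
limit retains the atom at the point, the left limit loses it. -/
theorem tendsto_real_Iic {l : Filter ℝ} [l.IsCountablyGenerated] (c : FiniteMeasure ℝ) {S : Set ℝ}
    (hS : MeasurableSet S) (h1 : ∀ y ∈ S, ∀ᶠ x in l, y ≤ x) (h2 : ∀ y ∉ S, ∀ᶠ x in l, x < y) :
    Tendsto (fun x => (c : Measure ℝ).real (Iic x)) l (𝓝 ((c : Measure ℝ).real S)) := by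
  simp only [← integral_indicator_one hS, ← integral_indicator_one measurableSet_Iic]
  refine tendsto_integral_filter_of_dominated_convergence (fun _ => 1)
    (Eventually.of_forall fun x =>
      (measurable_one.indicator measurableSet_Iic).aestronglyMeasurable)
    (Eventually.of_forall fun x => Eventually.of_forall fun y => ?_) (integrable_const _)
    (Eventually.of_forall fun y => tendsto_const_nhds.congr' ?_)
  · by_cases h : y ∈ Iic x <;> simp [h]
  · by_cases hy : y ∈ S
    · filter_upwards [h1 y hy] with x hx
      simp [hy, hx]
    · filter_upwards [h2 y hy] with x hx
      simp [hy, hx]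

theorem tendsto_real_Iic_nhdsGT (c : FiniteMeasure ℝ) (a : ℝ) :
    Tendsto (fun x => (c : Measure ℝ).real (Iic x)) (𝓝[>] a) (𝓝 ((c : Measure ℝ).real (Iic a))) :=
  tendsto_real_Iic c measurableSet_Iic
    (fun y hy => by
      filter_upwards [self_mem_nhdsWithin] with x hx
      exact le_trans hy (le_of_lt hx))
    (fun y hy => nhdsWithin_le_nhds (gt_mem_nhds (not_le.1 hy)))

theorem tendsto_real_Iic_nhdsLT (c : FiniteMeasure ℝ) (a : ℝ) :
    Tendsto (fun x => (c : Measure ℝ).real (Iic x)) (𝓝[<] a) (𝓝 ((c : Measure ℝ).real (Iio a))) :=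
  tendsto_real_Iic c measurableSet_Iio
    (fun y hy => nhdsWithin_le_nhds ((lt_mem_nhds hy).mono fun x hx => hx.le))
    (fun y hy => by
      filter_upwards [self_mem_nhdsWithin] with x hx
      exact lt_of_lt_of_le hx (not_lt.1 hy))

theorem ae_measure_singleton_eq_zero (c : FiniteMeasure ℝ) :
    ∀ᵐ x : ℝ, (c : Measure ℝ) {x} = 0 := by
  have h : Set.Countable {x : ℝ | 0 < (c : Measure ℝ) {y | id y = x}} :=
    Measure.countable_meas_level_set_pos measurable_id
  refine (h.ae_notMem volume).mono fun x hx => ?_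
  have h1 : ¬ 0 < (c : Measure ℝ) {y | id y = x} := hx
  have h2 : {y : ℝ | id y = x} = {x} := by
    ext
    simp
  rw [h2] at h1
  exact nonpos_iff_eq_zero.1 (not_lt.1 h1)

theorem eventually_real_lt_of_isClosed {ι : Type*} {l : Filter ι} {ν : ι → FiniteMeasure ℝ}
    (h : Tendsto ν l (𝓝 c)) {F : Set ℝ} (hF : IsClosed F) {x : ℝ}
    (hx : (c : Measure ℝ).real F < x) : ∀ᶠ i in l, (ν i : Measure ℝ).real F < x := by
  have h1 : (c : Measure ℝ) F < ENNReal.ofReal x :=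
    (ENNReal.lt_ofReal_iff_toReal_lt (measure_ne_top _ _)).2 hx
  filter_upwards [eventually_lt_of_limsup_lt
    ((FiniteMeasure.limsup_measure_closed_le_of_tendsto h hF).trans_lt h1)] with i hi
  exact (ENNReal.lt_ofReal_iff_toReal_lt (measure_ne_top _ _)).1 hi

theorem tendsto_real_univ {ι : Type*} {l : Filter ι} {ν : ι → FiniteMeasure ℝ}
    (h : Tendsto ν l (𝓝 c)) :
    Tendsto (fun i => (ν i : Measure ℝ).real univ) l (𝓝 ((c : Measure ℝ).real univ)) :=
  (NNReal.continuous_coe.tendsto _).comp h.mass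

/-- The upper bound is the portmanteau inequality for the closed set `Iic x`. The lower bound comes
from the closed set `Ici x`, convergence of the total mass and the absence of an atom at `x`. -/
theorem tendsto_real_Iic_of_tendsto {ι : Type*} {l : Filter ι} {ν : ι → FiniteMeasure ℝ}
    (h : Tendsto ν l (𝓝 c)) {x : ℝ} (hx : (c : Measure ℝ) {x} = 0) :
    Tendsto (fun i => (ν i : Measure ℝ).real (Iic x)) l (𝓝 ((c : Measure ℝ).real (Iic x))) := by
  have hsplit : ∀ m : FiniteMeasure ℝ, (m : Measure ℝ).real univ =
      (m : Measure ℝ).real (Iic x) + (m : Measure ℝ).real (Ioi x) := fun m => by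
    rw [← measureReal_union (Iic_disjoint_Ioi le_rfl) measurableSet_Ioi, Iic_union_Ioi]
  have hIci : (c : Measure ℝ).real (Ici x) = (c : Measure ℝ).real (Ioi x) := by
    have h1 : (c : Measure ℝ).real {x} = 0 := by rw [measureReal_def, hx, ENNReal.toReal_zero]
    rw [← Ioi_union_left, measureReal_union (by simp) (measurableSet_singleton x), h1, add_zero]
  refine tendsto_order.2 ⟨fun y hy => ?_, fun y hy => eventually_real_lt_of_isClosed h isClosed_Iic hy⟩
  set δ := (c : Measure ℝ).real (Iic x) - y with hδ
  have hδ' : 0 < δ := sub_pos.2 hy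
  filter_upwards [eventually_real_lt_of_isClosed h (isClosed_Ici (a := x))
    (x := (c : Measure ℝ).real (Ioi x) + δ / 2) (by linarith),
    (tendsto_real_univ h).eventually (lt_mem_nhds
      (show (c : Measure ℝ).real univ - δ / 2 < (c : Measure ℝ).real univ by linarith))] with i h1 h2
  have h3 : (ν i : Measure ℝ).real (Ioi x) ≤ (ν i : Measure ℝ).real (Ici x) :=
    measureReal_mono Ioi_subset_Ici_self
  rw [hsplit (ν i), hsplit c] at h2
  linarith

end DistributionFunction

/-! ### Functions of bounded variation given by measures -/

section BoundedVariation

open scoped NNReal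

variable {L A C c₀ c₀' σ σ' : ℝ} {c c' : FiniteMeasure ℝ}

theorem memLp_affine_cdf (L c₀ σ : ℝ) (c : FiniteMeasure ℝ) :
    MemLp (fun x => c₀ + σ * (c : Measure ℝ).real (Iic x)) 1 (leb (body L)) := by
  have hm : Monotone fun x => (c : Measure ℝ).real (Iic x) := fun x y hxy =>
    measureReal_mono (Iic_subset_Iic.2 hxy)
  refine MemLp.of_bound (measurable_const.add (hm.measurable.const_mul σ)).aestronglyMeasurable
    (|c₀| + |σ| * (c : Measure ℝ).real univ) (Eventually.of_forall fun x => ?_)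
  rw [Real.norm_eq_abs]
  refine (abs_add_le _ _).trans (add_le_add le_rfl ?_)
  rw [abs_mul, abs_of_nonneg (measureReal_nonneg (μ := (c : Measure ℝ)))]
  exact mul_le_mul_of_nonneg_left (measureReal_mono (subset_univ _)) (abs_nonneg _)

/-- Integration by parts for the distribution function of a measure. -/
theorem integral_cdf_mul_deriv (c : FiniteMeasure ℝ) {φ : ℝ → ℝ} (hφ : ContDiff ℝ 1 φ)
    (hφ' : HasCompactSupport φ) :
    ∫ x, (c : Measure ℝ).real (Iic x) * deriv φ x = -∫ x, φ x ∂(c : Measure ℝ) := by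
  have hint : Integrable (fun x => deriv φ x) :=
    (hφ.continuous_deriv le_rfl).integrable_of_hasCompactSupport hφ'.deriv
  have hS : MeasurableSet {p : ℝ × ℝ | p.2 ≤ p.1} := measurableSet_le measurable_snd measurable_fst
  -- Fubini on the set `y ≤ x`: integrating `deriv φ x` first in `y` gives the distribution function
  -- times `deriv φ x`, and first in `x` gives `-φ y`.
  have hI : Integrable (Function.uncurry fun x y => {p : ℝ × ℝ | p.2 ≤ p.1}.indicator
      (fun p => deriv φ p.1 * 1) (x, y)) (volume.prod (c : Measure ℝ)) :=
    (hint.mul_prod (integrable_const (1 : ℝ))).indicator hS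
  have h := integral_integral_swap hI
  have e1 : ∀ x, ∫ y, {p : ℝ × ℝ | p.2 ≤ p.1}.indicator (fun p => deriv φ p.1 * 1) (x, y)
      ∂(c : Measure ℝ) = (c : Measure ℝ).real (Iic x) * deriv φ x := fun x => by
    have : ∀ y, {p : ℝ × ℝ | p.2 ≤ p.1}.indicator (fun p => deriv φ p.1 * 1) (x, y) =
        (Iic x).indicator (fun _ => deriv φ x) y := fun y => by
      by_cases hy : y ≤ x <;> simp [hy]
    simp only [this]
    rw [integral_indicator_const _ measurableSet_Iic, smul_eq_mul]
  have e2 : ∀ y, ∫ x, {p : ℝ × ℝ | p.2 ≤ p.1}.indicator (fun p => deriv φ p.1 * 1) (x, y) =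
      -φ y := fun y => by
    have : ∀ x, {p : ℝ × ℝ | p.2 ≤ p.1}.indicator (fun p => deriv φ p.1 * 1) (x, y) =
        (Ici y).indicator (fun x => deriv φ x) x := fun x => by
      by_cases hy : y ≤ x <;> simp [hy]
    simp only [this]
    rw [integral_indicator measurableSet_Ici, integral_Ici_eq_integral_Ioi,
      hφ'.integral_Ioi_deriv_eq hφ]
  simp only [e1, e2] at h
  rw [h, integral_neg]

/-- The function `x ↦ c₀ + σ c((-∞, x])`. -/
noncomputable def BV.ofMeasure (L c₀ σ : ℝ) (c : FiniteMeasure ℝ) : BV (body L) where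
  val := (memLp_affine_cdf L c₀ σ c).toLp _
  D := σ • ((c : Measure ℝ).restrict (Ioo 0 L)).toSignedMeasure
  isMeasureOn_D := isMeasureOn_smul_toSignedMeasure measurableSet_Ioo
    (ae_restrict_mem measurableSet_Ioo) σ
  integral_eq := fun φ => by
    have hφ : ContDiff ℝ 1 fun x => φ x := (test_contDiff φ).of_le (by simp)
    have hφ' := test_hasCompactSupport φ
    have hsub := test_tsupport_subset φ
    have hint : Integrable (fun x => deriv φ x) :=
      (hφ.continuous_deriv le_rfl).integrable_of_hasCompactSupport hφ'.deriv
    have hm : Monotone fun x => (c : Measure ℝ).real (Iic x) := fun x y hxy =>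
      measureReal_mono (Iic_subset_Iic.2 hxy)
    have hi2 : Integrable fun x => (c : Measure ℝ).real (Iic x) * deriv φ x :=
      hint.bdd_mul (c := (c : Measure ℝ).real univ) hm.measurable.aestronglyMeasurable
        (Eventually.of_forall fun x => by
          rw [Real.norm_eq_abs, abs_of_nonneg measureReal_nonneg]
          exact measureReal_mono (subset_univ _))
    have h1 : ∫ x in (body L : Set ℝ), (memLp_affine_cdf L c₀ σ c).toLp _ x * deriv φ x =
        ∫ x in (body L : Set ℝ), (c₀ + σ * (c : Measure ℝ).real (Iic x)) * deriv φ x :=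
      integral_congr_ae ((memLp_affine_cdf L c₀ σ c).coeFn_toLp.mono fun x hx => by
        simp only [hx])
    have h2 : ∫ x, deriv φ x = 0 := integral_eq_zero_of_hasDerivAt_of_integrable
      (fun x => (hφ.differentiable one_ne_zero x).hasDerivAt) hint
      (hφ.continuous.integrable_of_hasCompactSupport hφ')
    rw [h1, setIntegral_eq_of_tsupport_subset ((tsupport_deriv_subset (f := φ)).trans hsub),
      VectorMeasure.integral_smul_vectorMeasure, VectorMeasure.integral_toSignedMeasure,
      smul_eq_mul]
    have h4 : ∫ x in Ioo 0 L, φ x ∂(c : Measure ℝ) = ∫ x, φ x ∂(c : Measure ℝ) :=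
      setIntegral_eq_integral_of_forall_compl_eq_zero fun x hx =>
        image_eq_zero_of_notMem_tsupport fun h' => hx (hsub h')
    rw [h4]
    have h3 : ∀ x, (c₀ + σ * (c : Measure ℝ).real (Iic x)) * deriv φ x =
      c₀ * deriv φ x + σ * ((c : Measure ℝ).real (Iic x) * deriv φ x) := fun x => by ring
    simp only [h3]
    rw [integral_add (hint.const_mul _) (hi2.const_mul _), integral_const_mul, integral_const_mul,
      h2, integral_cdf_mul_deriv c hφ hφ']
    ring

theorem BV.coeFn_ofMeasure (L c₀ σ : ℝ) (c : FiniteMeasure ℝ) :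
    ∀ᵐ x ∂leb (body L), (BV.ofMeasure L c₀ σ c).val x = c₀ + σ * (c : Measure ℝ).real (Iic x) :=
  (memLp_affine_cdf L c₀ σ c).coeFn_toLp

theorem abs_real_sub_le {μ ν : Measure ℝ} [IsFiniteMeasure μ] [IsFiniteMeasure ν]
    (hle : μ ≤ ν ∨ ν ≤ μ) {s : Set ℝ} (hs : MeasurableSet s) :
    |μ.real s - ν.real s| ≤ |μ.real univ - ν.real univ| := by
  have key : ∀ {μ ν : Measure ℝ} [IsFiniteMeasure μ] [IsFiniteMeasure ν], μ ≤ ν →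
      |μ.real s - ν.real s| ≤ |μ.real univ - ν.real univ| := by
    intro μ ν _ _ h
    have h1 : ∀ t, μ.real t ≤ ν.real t := fun t => ENNReal.toReal_mono (measure_ne_top _ _) (h t)
    rw [abs_of_nonpos (sub_nonpos.2 (h1 _)), abs_of_nonpos (sub_nonpos.2 (h1 _)),
      ← measureReal_add_measureReal_compl (μ := μ) hs,
      ← measureReal_add_measureReal_compl (μ := ν) hs]
    linarith [h1 sᶜ]
  rcases hle with h | h
  · exact key h
  · rw [abs_sub_comm, abs_sub_comm (μ.real univ)]
    exact key h

theorem BV.distance_nonneg {Ω : TopologicalSpace.Opens ℝ} (u v : BV Ω) : 0 ≤ BV.distance u v :=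
  add_nonneg (norm_nonneg _) (tvDist_nonneg _ _)

/-- The quantity `δ` below bounds the difference of `σ` times the distribution function at every
point, as well as the total variation of the difference of the derivatives. The first costs a factor
`L` in `L¹`, which explains `L + 1`. -/
theorem BV.distance_ofMeasure_le (hL : 0 < L) (hle : (c : Measure ℝ) ≤ c' ∨ (c' : Measure ℝ) ≤ c)
    (hσ : |σ| ≤ A) (hσ' : |σ'| ≤ A) (hc : (c : Measure ℝ).real univ ≤ C)
    (hc' : (c' : Measure ℝ).real univ ≤ C) :
    BV.distance (BV.ofMeasure L c₀ σ c) (BV.ofMeasure L c₀' σ' c') ≤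
      L * |c₀ - c₀'| + (L + 1) * (C * |σ - σ'| +
        A * |(c : Measure ℝ).real univ - (c' : Measure ℝ).real univ|) := by
  have hA : 0 ≤ A := (abs_nonneg _).trans hσ
  have hC : 0 ≤ C := measureReal_nonneg.trans hc
  set δ := C * |σ - σ'| + A * |(c : Measure ℝ).real univ - (c' : Measure ℝ).real univ| with hδ
  have hδ0 : 0 ≤ δ := by positivity
  have h1 : ‖(BV.ofMeasure L c₀ σ c).val - (BV.ofMeasure L c₀' σ' c').val‖ ≤
      L * (|c₀ - c₀'| + δ) := by
    refine (Lp.norm_le_of_ae_bound (C := |c₀ - c₀'| + δ) (by positivity) ?_).trans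
      (mul_le_mul_of_nonneg_right ?_ (by positivity))
    · filter_upwards [Lp.coeFn_sub (BV.ofMeasure L c₀ σ c).val (BV.ofMeasure L c₀' σ' c').val,
        BV.coeFn_ofMeasure L c₀ σ c, BV.coeFn_ofMeasure L c₀' σ' c'] with x e1 e2 e3
      rw [e1, Pi.sub_apply, e2, e3, Real.norm_eq_abs]
      have e4 : c₀ + σ * (c : Measure ℝ).real (Iic x) -
          (c₀' + σ' * (c' : Measure ℝ).real (Iic x)) = (c₀ - c₀') +
          ((c : Measure ℝ).real (Iic x) * (σ - σ') +
          σ' * ((c : Measure ℝ).real (Iic x) - (c' : Measure ℝ).real (Iic x))) := by ring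
      rw [e4]
      refine (abs_add_le _ _).trans (add_le_add le_rfl ((abs_add_le _ _).trans ?_))
      rw [abs_mul, abs_mul, abs_of_nonneg (measureReal_nonneg (μ := (c : Measure ℝ)))]
      exact add_le_add (mul_le_mul_of_nonneg_right ((measureReal_mono (subset_univ _)).trans hc)
        (abs_nonneg _)) (mul_le_mul hσ' (abs_real_sub_le hle measurableSet_Iic) (abs_nonneg _) hA)
    · rw [ENNReal.toReal_one, inv_one, Real.rpow_one]
      exact leb_real_le hL univ
  have h2 : tvDist (BV.ofMeasure L c₀ σ c).D (BV.ofMeasure L c₀' σ' c').D ≤ δ := by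
    refine (tvDist_smul_le (A := A) (C := C) ?_ hσ hσ' ?_ ?_).trans ?_
    · exact hle.imp (fun h => Measure.restrict_mono_measure h _)
        (fun h => Measure.restrict_mono_measure h _)
    · rw [measureReal_restrict_apply_univ]
      exact (measureReal_mono (subset_univ _)).trans hc
    · rw [measureReal_restrict_apply_univ]
      exact (measureReal_mono (subset_univ _)).trans hc'
    · rw [measureReal_restrict_apply_univ, measureReal_restrict_apply_univ]
      exact add_le_add le_rfl (mul_le_mul_of_nonneg_left
        (abs_real_sub_le hle measurableSet_Ioo) hA)
  rw [BV.distance]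
  linarith

/-- A function with a limit at the boundary point `x₀` of an interval has this limit as trace. -/
theorem hasTrace_of_tendsto {f g : ℝ → ℝ} {x₀ α : ℝ} {l : Filter ℝ} {Ω : Set ℝ}
    (hΩ : MeasurableSet Ω) (hl : 𝓝[Ω] x₀ ≤ l) (hfg : ∀ᵐ x ∂volume.restrict Ω, f x = g x)
    (hg : Tendsto g l (𝓝 α)) : HasTrace Ω f x₀ α := by
  rw [HasTrace, Metric.tendsto_nhds]
  intro η hη
  have h1 : ∀ᶠ x in 𝓝[Ω] x₀, dist (g x) α < η / 4 := hl (Metric.tendsto_nhds.1 hg _ (by positivity))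
  obtain ⟨ρ, hρ, hball⟩ := Metric.mem_nhdsWithin_iff.1 h1
  filter_upwards [Ioo_mem_nhdsGT hρ] with r hr
  have hm : MeasurableSet (Ω ∩ Metric.ball x₀ r) := hΩ.inter measurableSet_ball
  have hvol : volume.real (Ω ∩ Metric.ball x₀ r) ≤ 2 * r := by
    refine (measureReal_mono inter_subset_right measure_ball_lt_top.ne).trans ?_
    rw [Real.volume_real_ball hr.1.le]
  have h2 : ‖∫ x in Ω ∩ Metric.ball x₀ r, |f x - α|‖ ≤
      η / 4 * volume.real (Ω ∩ Metric.ball x₀ r) := by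
    refine norm_setIntegral_le_of_norm_le_const_ae
      ((measure_mono inter_subset_right).trans_lt measure_ball_lt_top) ?_
    filter_upwards [ae_restrict_of_ae_restrict_of_subset inter_subset_left hfg,
      ae_restrict_mem hm] with x hx hx'
    rw [Real.norm_eq_abs, abs_abs, hx, ← Real.dist_eq]
    exact le_of_lt (hball ⟨Metric.ball_subset_ball hr.2.le hx'.2, hx'.1⟩)
  rw [Real.dist_eq, sub_zero, abs_mul, abs_of_pos (inv_pos.2 hr.1), ← Real.norm_eq_abs]
  have h3 : r⁻¹ * ‖∫ x in Ω ∩ Metric.ball x₀ r, |f x - α|‖ ≤ r⁻¹ * (η / 4 * (2 * r)) :=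
    mul_le_mul_of_nonneg_left (h2.trans (mul_le_mul_of_nonneg_left hvol (by positivity)))
      (inv_nonneg.2 hr.1.le)
  have h4 : r⁻¹ * (η / 4 * (2 * r)) = η / 2 := by
    have := hr.1.ne'
    field_simp
    ring
  linarith

/-- The inner trace at `0` already contains the atom of `c` at `0`, while the trace at `L` excludes
the atom at `L`. Neither atom belongs to the derivative on the open interval. -/
theorem BV.hasTrace_ofMeasure_zero (L c₀ σ : ℝ) (c : FiniteMeasure ℝ) :
    HasTrace (Ioo 0 L) (BV.ofMeasure L c₀ σ c).val 0
      (c₀ + σ * (c : Measure ℝ).real (Iic 0)) :=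
  hasTrace_of_tendsto measurableSet_Ioo (nhdsWithin_mono _ Ioo_subset_Ioi_self)
    (BV.coeFn_ofMeasure L c₀ σ c) (((tendsto_real_Iic_nhdsGT c 0).const_mul σ).const_add c₀)

theorem BV.hasTrace_ofMeasure_right (L c₀ σ : ℝ) (c : FiniteMeasure ℝ) :
    HasTrace (Ioo 0 L) (BV.ofMeasure L c₀ σ c).val L
      (c₀ + σ * (c : Measure ℝ).real (Iio L)) :=
  hasTrace_of_tendsto measurableSet_Ioo (nhdsWithin_mono _ Ioo_subset_Iio_self)
    (BV.coeFn_ofMeasure L c₀ σ c) (((tendsto_real_Iic_nhdsLT c L).const_mul σ).const_add c₀)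

end BoundedVariation

/-! ### The compliance measures -/

section ComplianceMeasure

open scoped NNReal

variable {L a₀ a₁ b k : ℝ} {C : ℝ≥0} {m m' : FiniteMeasure ℝ}

/-- Lebesgue measure on `(0, L)`. -/
noncomputable def lebFinite (L : ℝ) : FiniteMeasure ℝ := ⟨volume.restrict (Ioo 0 L), inferInstance⟩

/-- The measure `b m + k 𝓛¹` on `(0, L)`. -/
noncomputable def complianceMeasure (L b k : ℝ) (m : FiniteMeasure ℝ) : FiniteMeasure ℝ :=
  b.toNNReal • m + k.toNNReal • lebFinite L

theorem complianceMeasure_real (hb : 0 ≤ b) (hk : 0 ≤ k) (m : FiniteMeasure ℝ) (s : Set ℝ) :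
    (complianceMeasure L b k m : Measure ℝ).real s =
      b * (m : Measure ℝ).real s + k * (volume.restrict (Ioo 0 L)).real s := by
  change (b.toNNReal • (m : Measure ℝ) + k.toNNReal • volume.restrict (Ioo 0 L)).real s = _
  rw [measureReal_add_apply, measureReal_nnreal_smul_apply, measureReal_nnreal_smul_apply,
    Real.coe_toNNReal _ hb, Real.coe_toNNReal _ hk]

theorem lebFinite_real_univ (hL : 0 < L) : (volume.restrict (Ioo 0 L)).real univ = L := by
  rw [measureReal_restrict_apply_univ, Real.volume_real_Ioo_of_le hL.le, sub_zero]

theorem complianceMeasure_real_univ (hL : 0 < L) (hb : 0 ≤ b) (hk : 0 ≤ k) (m : FiniteMeasure ℝ) :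
    (complianceMeasure L b k m : Measure ℝ).real univ =
      b * (m : Measure ℝ).real univ + k * L := by
  rw [complianceMeasure_real hb hk, lebFinite_real_univ hL]

theorem complianceMeasure_mono (h : (m : Measure ℝ) ≤ m') :
    (complianceMeasure L b k m : Measure ℝ) ≤ complianceMeasure L b k m' := by
  change b.toNNReal • (m : Measure ℝ) + k.toNNReal • volume.restrict (Ioo 0 L) ≤
    b.toNNReal • (m' : Measure ℝ) + k.toNNReal • volume.restrict (Ioo 0 L)
  gcongr

theorem IsBoundedOn.complianceMeasure (hL : 0 < L) (hm : IsBoundedOn L C m) (hk : 0 ≤ k) {B : ℝ}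
    (hb : 0 ≤ b) (hB : b ≤ B) :
    IsBoundedOn L (B * C + k * L).toNNReal (complianceMeasure L b k m) := by
  refine ⟨?_, ?_⟩
  · rw [← NNReal.coe_le_coe]
    have h : ((BrittleDamage.complianceMeasure L b k m).mass : ℝ) = _ :=
      complianceMeasure_real_univ hL hb hk m
    rw [h]
    refine le_trans ?_ (Real.le_coe_toNNReal _)
    exact add_le_add (mul_le_mul hB hm.real_univ_le measureReal_nonneg (hb.trans hB)) le_rfl
  · have h0 : lebFinite L (Icc 0 L)ᶜ = 0 := by
      rw [FiniteMeasure.null_iff_toMeasure_null]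
      change volume.restrict (Ioo 0 L) (Icc 0 L)ᶜ = 0
      exact ae_iff.1 ((ae_restrict_mem measurableSet_Ioo).mono fun x hx => Ioo_subset_Icc_self hx)
    change (b.toNNReal • m + k.toNNReal • lebFinite L) (Icc 0 L)ᶜ = 0
    rw [FiniteMeasure.coeFn_add, Pi.add_apply, FiniteMeasure.coeFn_smul, FiniteMeasure.coeFn_smul,
      Pi.smul_apply, Pi.smul_apply, hm.2, h0, smul_zero, smul_zero, add_zero]

theorem compliance_eq (ha₀ : 0 < a₀) (ha₁ : 0 < a₁) (m : FiniteMeasure ℝ) :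
    compliance L a₀ a₁ (m : Measure ℝ).toSignedMeasure =
      (complianceMeasure L a₀⁻¹ a₁⁻¹ m : Measure ℝ).toSignedMeasure := by
  ext s hs
  rw [Measure.toSignedMeasure_apply_measurable hs,
    complianceMeasure_real (inv_nonneg.2 ha₀.le) (inv_nonneg.2 ha₁.le)]
  change a₀⁻¹ * (m : Measure ℝ).toSignedMeasure s +
    a₁⁻¹ * (volume.restrict (Ioo 0 L)).toSignedMeasure s = _
  rw [Measure.toSignedMeasure_apply_measurable hs, Measure.toSignedMeasure_apply_measurable hs]

theorem tendsto_complianceMeasure {ι : Type*} {l : Filter ι} {ν : ι → FiniteMeasure ℝ} {β : ι → ℝ}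
    (hν : Tendsto ν l (𝓝 m)) (hβ : Tendsto β l (𝓝 b)) (L k : ℝ) :
    Tendsto (fun i => complianceMeasure L (β i) k (ν i)) l (𝓝 (complianceMeasure L b k m)) :=
  (((continuous_real_toNNReal.tendsto b).comp hβ).smul hν).add tendsto_const_nhds

/-- The boundary part of a measure on `[0, L]`. -/
theorem restrict_pair_eq (hL : 0 < L) (m : FiniteMeasure ℝ) (k : ℝ) :
    (k • (m : Measure ℝ).toSignedMeasure).restrict {0, L} =
      VectorMeasure.dirac L (k * (m : Measure ℝ).real {L}) -
        VectorMeasure.dirac 0 (-(k * (m : Measure ℝ).real {0})) := by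
  have hp : MeasurableSet ({0, L} : Set ℝ) := (Set.toFinite _).measurableSet
  ext s hs
  rw [VectorMeasure.restrict_apply _ hp hs]
  change k * (m : Measure ℝ).toSignedMeasure (s ∩ {0, L}) =
    VectorMeasure.dirac L (k * (m : Measure ℝ).real {L}) s -
      VectorMeasure.dirac 0 (-(k * (m : Measure ℝ).real {0})) s
  rw [Measure.toSignedMeasure_apply_measurable (hs.inter hp)]
  by_cases h0 : (0 : ℝ) ∈ s <;> by_cases h1 : L ∈ s
  · have h : s ∩ {0, L} = {0} ∪ {L} := by
      rw [inter_eq_right.2 (by simp [insert_subset_iff, h0, h1])]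
      rfl
    rw [VectorMeasure.dirac_apply_of_mem hs h0, VectorMeasure.dirac_apply_of_mem hs h1, h,
      measureReal_union (by simp [hL.ne]) (measurableSet_singleton L)]
    ring
  · have h : s ∩ {0, L} = {0} := by
      rw [inter_insert_of_mem h0, inter_singleton_eq_empty.2 h1, insert_empty_eq]
    rw [VectorMeasure.dirac_apply_of_mem hs h0, VectorMeasure.dirac_apply_of_notMem h1, h]
    ring
  · have h : s ∩ {0, L} = {L} := by
      rw [inter_insert_of_notMem h0, inter_singleton_of_mem h1]
    rw [VectorMeasure.dirac_apply_of_notMem h0, VectorMeasure.dirac_apply_of_mem hs h1, h]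
    ring
  · have h : s ∩ {0, L} = ∅ := by
      rw [inter_insert_of_notMem h0, inter_singleton_eq_empty.2 h1]
    rw [VectorMeasure.dirac_apply_of_notMem h0, VectorMeasure.dirac_apply_of_notMem h1, h,
      measureReal_empty]
    ring

/-- The boundary values of a measure on `[0, L]` of compliance. -/
theorem IsBoundedOn.complianceMeasure_real_Iic (hL : 0 < L) (hm : IsBoundedOn L C m) (hb : 0 ≤ b)
    (hk : 0 ≤ k) : (BrittleDamage.complianceMeasure L b k m : Measure ℝ).real (Iic 0) =
      b * (m : Measure ℝ).real {0} := by
  have h1 := (hm.complianceMeasure hL hk hb le_rfl).ae_mem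
  have h2 : (BrittleDamage.complianceMeasure L b k m : Measure ℝ).real (Iic 0) =
      (BrittleDamage.complianceMeasure L b k m : Measure ℝ).real {0} := by
    refine measureReal_congr (h1.mono fun x hx => propext ⟨fun h => ?_, fun h => ?_⟩)
    · exact le_antisymm h hx.1
    · exact le_of_eq h
  rw [h2, complianceMeasure_real hb hk]
  simp [measureReal_def]

theorem IsBoundedOn.complianceMeasure_real_Iio (hL : 0 < L) (hm : IsBoundedOn L C m) (hb : 0 ≤ b)
    (hk : 0 ≤ k) : (BrittleDamage.complianceMeasure L b k m : Measure ℝ).real (Iio L) =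
      (BrittleDamage.complianceMeasure L b k m : Measure ℝ).real univ - b * (m : Measure ℝ).real {L} := by
  have h1 := (hm.complianceMeasure hL hk hb le_rfl).ae_mem
  have h2 : (BrittleDamage.complianceMeasure L b k m : Measure ℝ).real (Iio L)ᶜ =
      (BrittleDamage.complianceMeasure L b k m : Measure ℝ).real {L} := by
    refine measureReal_congr (h1.mono fun x hx => propext ⟨fun h => ?_, fun h => ?_⟩)
    · exact le_antisymm hx.2 (not_lt.1 h)
    · exact not_lt.2 (le_of_eq h.symm)
  have h3 : (BrittleDamage.complianceMeasure L b k m : Measure ℝ).real {L} =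
      b * (m : Measure ℝ).real {L} := by
    rw [complianceMeasure_real hb hk]
    simp [measureReal_def]
  rw [← measureReal_add_measureReal_compl (measurableSet_Iio (a := L)), h2, h3]
  ring

end ComplianceMeasure

/-! ### Displacements of evolutions -/

section Displacement

open scoped NNReal

variable {L T κ a₀ a₁ ε k : ℝ} {w : ℝ → H1 ⊤} {u : ℝ → H1 (body L)} {Θ a : ℝ → ℝ → ℝ} {θ : ℝ → ℝ}

theorem IsVolumeFraction.totalCompliance_eq_real (hL : 0 < L) (ha₀ : 0 < a₀) (hε : 0 < ε)
    (hlt : ε * a₀ < a₁) (hθ : IsVolumeFraction L θ) :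
    totalCompliance L (ε * a₀) a₁ θ =
      (complianceMeasure L (1 / a₀ - ε / a₁) a₁⁻¹ (damage L ε θ) : Measure ℝ).real univ := by
  have ha₁ : 0 < a₁ := (mul_pos hε ha₀).trans hlt
  rw [complianceMeasure_real_univ hL (damage_coefficient_pos ha₀ hε hlt).le
    (inv_nonneg.2 ha₁.le), hθ.damage_univ hε, totalCompliance_eq ha₀ hε]
  ring

theorem IsVolumeFraction.setIntegral_mixCompliance (ha₀ : 0 < a₀) (hε : 0 < ε)
    (hlt : ε * a₀ < a₁) (hθ : IsVolumeFraction L θ) {s : Set ℝ} (hs : MeasurableSet s) :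
    ∫ x in s, mixCompliance (ε * a₀) a₁ (θ x) ∂volume.restrict (Ioo 0 L) =
      (complianceMeasure L (1 / a₀ - ε / a₁) a₁⁻¹ (damage L ε θ) : Measure ℝ).real s := by
  have ha₁ : 0 < a₁ := (mul_pos hε ha₀).trans hlt
  have h1 : ∀ x, mixCompliance (ε * a₀) a₁ (θ x) =
      (1 / a₀ - ε / a₁) * ((1 - θ x) / ε) + a₁⁻¹ := fun x => by
    rw [mixCompliance]
    field_simp
    ring
  have hi : Integrable (fun x => (1 - θ x) / ε) (volume.restrict (Ioo 0 L)) :=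
    hθ.integrable_one_sub.div_const ε
  have h2 : ∫ x in s, (1 - θ x) / ε ∂volume.restrict (Ioo 0 L) =
      (damage L ε θ : Measure ℝ).real s := by
    rw [← integral_indicator_one hs, hθ.integral_damage hε, ← integral_indicator hs]
    refine integral_congr_ae (Eventually.of_forall fun x => ?_)
    by_cases hx : x ∈ s <;> simp [hx]
  simp only [h1]
  rw [integral_add (hi.integrableOn.const_mul _) (integrable_const _), integral_const_mul, h2,
    complianceMeasure_real (damage_coefficient_pos ha₀ hε hlt).le (inv_nonneg.2 ha₁.le),
    integral_const, smul_eq_mul, measureReal_restrict_apply_univ, mul_comm a₁⁻¹]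

namespace IsBrittleEvolution

variable (h : IsBrittleEvolution L T k (ε * a₀) a₁ w u Θ a) (hL : 0 < L)
  (ha₀ : 0 < a₀) (hε : 0 < ε) (hlt : ε * a₀ < a₁)

include h hL ha₀ hε hlt in
theorem setIntegral_der {t : ℝ} (ht : t ∈ Icc 0 T) {s : Set ℝ} (hs : MeasurableSet s) :
    ∫ x in s, (u t).der x ∂volume.restrict (Ioo 0 L) =
      stretch L (w t) / totalCompliance L (ε * a₀) a₁ (Θ t) *
        (complianceMeasure L (1 / a₀ - ε / a₁) a₁⁻¹ (damage L ε (Θ t)) : Measure ℝ).real s := by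
  rw [← (h.volumeFraction t ht).setIntegral_mixCompliance ha₀ hε hlt hs, ← integral_const_mul]
  exact integral_congr_ae (ae_restrict_of_ae (h.der_eq hL (mul_pos hε ha₀) hlt ht))

include h hL ha₀ hε hlt in
theorem withDensityᵥ_der {t : ℝ} (ht : t ∈ Icc 0 T) :
    (volume.restrict (Ioo 0 L)).withDensityᵥ (fun x => (u t).der x) =
      (stretch L (w t) / totalCompliance L (ε * a₀) a₁ (Θ t)) •
        (complianceMeasure L (1 / a₀ - ε / a₁) a₁⁻¹
          (damage L ε (Θ t)) : Measure ℝ).toSignedMeasure := by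
  have hi : Integrable (fun x => (u t).der x) (volume.restrict (Ioo 0 L)) :=
    (Lp.memLp (u t).der).integrable (by norm_num)
  ext s hs
  rw [withDensityᵥ_apply hi hs, h.setIntegral_der hL ha₀ hε hlt ht hs]
  change _ = _ * (Measure.toSignedMeasure _) s
  rw [Measure.toSignedMeasure_apply_measurable hs]

include h hL ha₀ hε hlt in
-- The approximate displacement has the same shape as `BV.ofMeasure`, so passing to the limit
-- involves only the stress and the compliance measure.
theorem val_eq {t : ℝ} (ht : t ∈ Icc 0 T) : ∀ᵐ x ∂volume.restrict (Ioo 0 L),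
    (u t).val x = trace0 (w t) + stretch L (w t) / totalCompliance L (ε * a₀) a₁ (Θ t) *
      (complianceMeasure L (1 / a₀ - ε / a₁) a₁⁻¹
        (damage L ε (Θ t)) : Measure ℝ).real (Iic x) := by
  filter_upwards [((h.dirichlet t ht).val_eq hL).1, ae_restrict_mem measurableSet_Ioo] with x hx hx'
  have h1 : ∫ y in Iic x, (u t).der y ∂volume.restrict (Ioo 0 L) =
      ∫ y in Ioc 0 x, (u t).der y ∂volume.restrict (Ioo 0 L) := by
    rw [Measure.restrict_restrict measurableSet_Iic, Measure.restrict_restrict measurableSet_Ioc]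
    congr 2
    ext y
    simp only [mem_inter_iff, mem_Iic, mem_Ioo, mem_Ioc]
    tauto
  rw [hx, prim_eq _ hx'.1.le, ← h.setIntegral_der hL ha₀ hε hlt ht measurableSet_Iic, h1]
  rfl

end IsBrittleEvolution

end Displacement

/-! ### Limits at a fixed time -/

section FixedTime

open scoped NNReal

variable {L c₀ σ a₁ : ℝ} {C : ℝ≥0} {c m : FiniteMeasure ℝ} {ν : ℕ → FiniteMeasure ℝ} {s : ℕ → ℝ}

theorem weakStarTendsto_smul (hL : 0 < L) (hν : ∀ n, IsBoundedOn L C (ν n))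
    (hm : IsBoundedOn L C m) (h : Tendsto ν atTop (𝓝 m)) (hs : Tendsto s atTop (𝓝 σ)) :
    WeakStarTendsto (Icc 0 L) (fun n => s n • (ν n : Measure ℝ).toSignedMeasure)
      (σ • (m : Measure ℝ).toSignedMeasure) := by
  intro φ hφ
  simp only [VectorMeasure.integral_smul_vectorMeasure, VectorMeasure.integral_toSignedMeasure]
  exact hs.smul (tendsto_integral_of_tendsto hL.le (Eventually.of_forall hν) hm h hφ.1)

/-- Distribution functions converge away from the atoms of the limit, hence almost everywhere, and
dominated convergence gives `L¹` convergence. Test functions in `C₀` of the open interval vanish at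
`0` and `L`, so they do not see mass that concentrates at the boundary. -/
theorem bvWeakStarTendsto_ofMeasure (hL : 0 < L) {v : ℕ → H1 (body L)}
    (hν : ∀ n, IsBoundedOn L C (ν n)) (hc : IsBoundedOn L C c) (h : Tendsto ν atTop (𝓝 c))
    (hs : Tendsto s atTop (𝓝 σ))
    (hval : ∀ n, ∀ᵐ x ∂volume.restrict (Ioo 0 L),
      (v n).val x = c₀ + s n * (ν n : Measure ℝ).real (Iic x))
    (hder : ∀ n, (volume.restrict (Ioo 0 L)).withDensityᵥ (fun x => (v n).der x) =
      s n • (ν n : Measure ℝ).toSignedMeasure) :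
    BVWeakStarTendsto v (BV.ofMeasure L c₀ σ c) := by
  refine ⟨?_, ?_⟩
  · have hb : ∀ (m : FiniteMeasure ℝ), IsBoundedOn L C m → ∀ x,
        |(m : Measure ℝ).real (Iic x)| ≤ C := fun m hm x => by
      rw [abs_of_nonneg measureReal_nonneg]
      exact (measureReal_mono (subset_univ _)).trans hm.real_univ_le
    have hmeas : ∀ m : FiniteMeasure ℝ, Measurable fun x => (m : Measure ℝ).real (Iic x) :=
      fun m => Monotone.measurable fun x y hxy => measureReal_mono (Iic_subset_Iic.2 hxy)
    obtain ⟨B, hB⟩ := hs.abs.bddAbove_range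
    have key : Tendsto (fun n => ∫ x in Ioo 0 L, |s n * (ν n : Measure ℝ).real (Iic x) -
        σ * (c : Measure ℝ).real (Iic x)|) atTop (𝓝 (∫ _ in Ioo 0 L, (0 : ℝ))) := by
      refine tendsto_integral_of_dominated_convergence (fun _ => B * C + |σ| * C) (fun n => ?_)
        (integrable_const _) (fun n => Eventually.of_forall fun x => ?_) ?_
      · exact (((hmeas _).const_mul _).sub ((hmeas _).const_mul _)).abs.aestronglyMeasurable
      · rw [Real.norm_eq_abs, abs_abs]
        refine (abs_sub _ _).trans ?_
        rw [abs_mul, abs_mul]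
        exact add_le_add (mul_le_mul (hB ⟨n, rfl⟩) (hb _ (hν n) x) (abs_nonneg _)
          ((abs_nonneg _).trans (hB ⟨n, rfl⟩)))
          (mul_le_mul_of_nonneg_left (hb _ hc x) (abs_nonneg _))
      · filter_upwards [ae_restrict_of_ae (ae_measure_singleton_eq_zero c)] with x hx
        have h1 := ((hs.mul (tendsto_real_Iic_of_tendsto h hx)).sub_const
          (σ * (c : Measure ℝ).real (Iic x))).abs
        rwa [sub_self, abs_zero] at h1
    rw [integral_zero] at key
    refine key.congr fun n => integral_congr_ae ?_
    filter_upwards [hval n, BV.coeFn_ofMeasure L c₀ σ c] with x h1 h2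
    rw [h1, h2, add_sub_add_left_eq_sub]
  · intro φ hφ
    have h0 : ∀ x ∈ Icc 0 L, x ∉ Ioo 0 L → φ x = 0 := fun x hx hx' => by
      refine hφ.2 x ⟨?_, hx'⟩
      rw [frontier_Ioo hL]
      by_contra hne
      simp only [mem_insert_iff, mem_singleton_iff, not_or] at hne
      exact hx' ⟨lt_of_le_of_ne hx.1 (Ne.symm hne.1), lt_of_le_of_ne hx.2 hne.2⟩
    have h1 : ∫ x in Ioo 0 L, φ x ∂(c : Measure ℝ) = ∫ x, φ x ∂(c : Measure ℝ) := by
      rw [← integral_indicator measurableSet_Ioo]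
      refine integral_congr_ae (hc.ae_mem.mono fun x hx => ?_)
      by_cases hx' : x ∈ Ioo 0 L
      · exact indicator_of_mem hx' _
      · simp only [indicator_of_notMem hx', h0 x hx hx']
    simp only [hder, BV.ofMeasure, VectorMeasure.integral_smul_vectorMeasure,
      VectorMeasure.integral_toSignedMeasure, h1]
    exact hs.smul (tendsto_integral_of_tendsto hL.le (Eventually.of_forall hν) hc h hφ.1)

/-- As `1 - θ` has values in `[0, 1]` and integral of order `ε`, its `L²` norm is of order `√ε`;
thus the volume fraction of sound material tends to `1` and only the stress survives in the limit.
-/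
theorem tendsto_integral_strain {θ : ℕ → ℝ → ℝ} {ε : ℕ → ℝ} (hθ : ∀ n, IsVolumeFraction L (θ n))
    (hε_pos : ∀ n, 0 < ε n) (hε : Tendsto ε atTop (𝓝 0))
    (hC : ∀ n, damagedVolume L (θ n) / ε n ≤ C) (hs : Tendsto s atTop (𝓝 σ)) {g : ℝ → ℝ}
    (hg : MemLp g 2 (volume.restrict (Ioo 0 L))) :
    Tendsto (fun n => ∫ x in Ioo 0 L, s n / a₁ * θ n x * g x) atTop
      (𝓝 (∫ x in Ioo 0 L, σ / a₁ * g x)) := by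
  have hg1 : Integrable g (volume.restrict (Ioo 0 L)) := hg.integrable (by norm_num)
  have hg2 : Integrable (fun x => g x ^ 2) (volume.restrict (Ioo 0 L)) := hg.integrable_sq
  have hi : ∀ n, Integrable (fun x => θ n x * g x) (volume.restrict (Ioo 0 L)) := fun n =>
    hg1.bdd_mul (c := 1) (hθ n).1.aestronglyMeasurable ((hθ n).2.mono fun x hx => by
      rw [Real.norm_eq_abs, abs_of_nonneg hx.1]
      exact hx.2)
  have hb : ∀ n, |∫ x in Ioo 0 L, (θ n x * g x - g x)| ≤
      √(ε n) * ((C + ∫ x in Ioo 0 L, g x ^ 2) / 2) := fun n => by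
    have hpos := Real.sqrt_pos.2 (hε_pos n)
    have hsq := Real.sq_sqrt (hε_pos n).le
    have hi1 : Integrable (fun x => (1 - θ n x) / ε n) (volume.restrict (Ioo 0 L)) :=
      (hθ n).integrable_one_sub.div_const _
    -- Young's inequality with weight `√ε`, together with `(1 - θ)² ≤ 1 - θ`.
    have h1 : ∀ᵐ x ∂volume.restrict (Ioo 0 L), ‖θ n x * g x - g x‖ ≤
        √(ε n) / 2 * ((1 - θ n x) / ε n + g x ^ 2) := (hθ n).2.mono fun x hx => by
      have e0 : 0 ≤ 1 - θ n x := by linarith [hx.2]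
      have e1 : ‖θ n x * g x - g x‖ = (1 - θ n x) * |g x| := by
        have e4 : θ n x * g x - g x = -((1 - θ n x) * g x) := by ring
        rw [Real.norm_eq_abs, e4, abs_neg, abs_mul, abs_of_nonneg e0]
      have e2 : √(ε n) / 2 * ((1 - θ n x) / ε n + g x ^ 2) =
          ((1 - θ n x) + ε n * |g x| ^ 2) / (2 * √(ε n)) := by
        rw [sq_abs]
        have := hpos.ne'
        have := (hε_pos n).ne'
        field_simp
        rw [hsq]
      have e3 : (1 - θ n x) ^ 2 ≤ 1 - θ n x := by nlinarith [hx.1]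
      rw [e1, e2, le_div_iff₀ (by positivity)]
      nlinarith [sq_nonneg ((1 - θ n x) - √(ε n) * |g x|)]
    have h2 := norm_integral_le_of_norm_le ((hi1.add hg2).const_mul (√(ε n) / 2)) h1
    rw [Real.norm_eq_abs] at h2
    refine h2.trans ?_
    have h3 : ∫ x in Ioo 0 L, √(ε n) / 2 * ((1 - θ n x) / ε n + g x ^ 2) =
        √(ε n) / 2 * (damagedVolume L (θ n) / ε n + ∫ x in Ioo 0 L, g x ^ 2) := by
      rw [integral_const_mul, integral_add hi1 hg2, integral_div, damagedVolume]
    have h4 : √(ε n) / 2 * (damagedVolume L (θ n) / ε n + ∫ x in Ioo 0 L, g x ^ 2) ≤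
        √(ε n) / 2 * (C + ∫ x in Ioo 0 L, g x ^ 2) :=
      mul_le_mul_of_nonneg_left (by linarith [hC n]) (by positivity)
    refine (le_of_eq h3).trans (h4.trans (le_of_eq ?_))
    ring
  have hsqrt : Tendsto (fun n => √(ε n) * ((C + ∫ x in Ioo 0 L, g x ^ 2) / 2)) atTop (𝓝 0) := by
    have h1 := (Real.continuous_sqrt.tendsto 0).comp hε
    rw [Real.sqrt_zero] at h1
    simpa using h1.mul_const ((C + ∫ x in Ioo 0 L, g x ^ 2) / 2)
  have h0 : Tendsto (fun n => ∫ x in Ioo 0 L, θ n x * g x) atTop (𝓝 (∫ x in Ioo 0 L, g x)) := by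
    have h1 := squeeze_zero_norm (fun n => (Real.norm_eq_abs _).trans_le (hb n)) hsqrt
    have h2 := h1.add_const (∫ x in Ioo 0 L, g x)
    rw [zero_add] at h2
    refine h2.congr fun n => ?_
    rw [integral_sub (hi n) hg1, sub_add_cancel]
  rw [integral_const_mul]
  refine ((hs.div_const a₁).mul h0).congr fun n => ?_
  rw [← integral_const_mul]
  simp only [mul_assoc]

end FixedTime

/-! ### The limit of the damage measures -/

section LimitDamage

open scoped NNReal

variable {L T κ a₀ a₁ R K : ℝ} {C : ℝ≥0} {w : ℝ → H1 ⊤} {m : ℝ → FiniteMeasure ℝ}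

/-- The total effective compliance. -/
noncomputable def effCompliance (L a₀ a₁ : ℝ) (m : FiniteMeasure ℝ) : ℝ :=
  (complianceMeasure L a₀⁻¹ a₁⁻¹ m : Measure ℝ).real univ

/-- The properties of the limits of the damage measures. -/
structure IsLimitDamage (L T κ a₀ a₁ R K : ℝ) (C : ℝ≥0) (w : ℝ → H1 ⊤)
    (m : ℝ → FiniteMeasure ℝ) : Prop where
  bounded : ∀ t ∈ Icc 0 T, IsBoundedOn L C (m t)
  mono : ∀ s ∈ Icc 0 T, ∀ t ∈ Icc 0 T, s ≤ t → (m s : Measure ℝ) ≤ m t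
  mass_sub_le : ∀ s ∈ Icc 0 T, ∀ t ∈ Icc 0 T, s ≤ t →
    (m t : Measure ℝ).real univ - (m s : Measure ℝ).real univ ≤
      K * absVar (fun t => stretch L (w t)) t - K * absVar (fun t => stretch L (w t)) s
  stretch_le : ∀ t ∈ Icc 0 T, |stretch L (w t)| ≤ R
  threshold : ∀ t ∈ Icc 0 T, stretch L (w t) ^ 2 ≤ 2 * κ * a₀ * effCompliance L a₀ a₁ (m t) ^ 2
  griffith : ∀ s ∈ Icc 0 T, ∀ t ∈ Icc 0 T, s ≤ t →
    (effCompliance L a₀ a₁ (m t) - effCompliance L a₀ a₁ (m s)) *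
      (2 * κ * a₀ * (effCompliance L a₀ a₁ (m s) * effCompliance L a₀ a₁ (m t)) -
        stretch L (w t) ^ 2 - 2 * R * (absVar (fun t => stretch L (w t)) t -
          absVar (fun t => stretch L (w t)) s)) ≤ 0

theorem tendsto_damage_coefficient {ε : ℕ → ℝ} (hε : Tendsto ε atTop (𝓝 0)) (a₀ a₁ : ℝ) :
    Tendsto (fun n => 1 / a₀ - ε n / a₁) atTop (𝓝 a₀⁻¹) := by
  have h := (hε.div_const a₁).const_sub a₀⁻¹
  rw [zero_div, sub_zero] at h
  simpa only [one_div] using h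

theorem tendsto_totalCompliance (hL : 0 < L) (ha₀ : 0 < a₀) {ε : ℕ → ℝ} (hε_pos : ∀ n, 0 < ε n)
    (hε_lt : ∀ n, ε n * a₀ < a₁) (hε : Tendsto ε atTop (𝓝 0)) {θ : ℕ → ℝ → ℝ}
    (hθ : ∀ n, IsVolumeFraction L (θ n)) {m : FiniteMeasure ℝ}
    (h : Tendsto (fun n => damage L (ε n) (θ n)) atTop (𝓝 m)) :
    Tendsto (fun n => totalCompliance L (ε n * a₀) a₁ (θ n)) atTop
      (𝓝 (effCompliance L a₀ a₁ m)) := by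
  simp only [(hθ _).totalCompliance_eq_real hL ha₀ (hε_pos _) (hε_lt _)]
  exact tendsto_real_univ (tendsto_complianceMeasure h (tendsto_damage_coefficient hε a₀ a₁) L _)

/-- The mass estimates are uniform in `ε`, so the Helly argument applies with a multiple of the
variation of the elongation as modulus. Every property recorded in `IsLimitDamage` is a closed
condition on the approximations. -/
theorem exists_limit_damage (hL : 0 < L) (hT : 0 < T) (hκ : 0 < κ) (ha₀ : 0 < a₀) (ha₁ : 0 < a₁)
    (hw : AbsolutelyContinuousOnInterval w 0 T) {ε : ℕ → ℝ} (hε_pos : ∀ n, 0 < ε n)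
    (hε_lt : ∀ n, ε n * a₀ < a₁) (hε : Tendsto ε atTop (𝓝 0))
    {u : ℕ → ℝ → H1 (body L)} {Θ a : ℕ → ℝ → ℝ → ℝ}
    (hevol : ∀ n, IsBrittleEvolution L T (κ / ε n) (ε n * a₀) a₁ w (u n) (Θ n) (a n)) :
    ∃ (R K : ℝ) (C : ℝ≥0) (m : ℝ → FiniteMeasure ℝ) (φ : ℕ → ℕ), StrictMono φ ∧
      IsLimitDamage L T κ a₀ a₁ R K C w m ∧
      (∀ n, ∀ t ∈ Icc 0 T, damagedVolume L (Θ (φ n) t) / ε (φ n) ≤ C) ∧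
      ∀ t ∈ Icc 0 T, Tendsto (fun n => damage L (ε (φ n)) (Θ (φ n) t)) atTop (𝓝 (m t)) := by
  have hd : AbsolutelyContinuousOnInterval (fun t => stretch L (w t)) 0 T :=
    hw.comp_lipschitz (stretch L).lipschitz
  set V := absVar fun t => stretch L (w t) with hVdef
  have hV : AbsolutelyContinuousOnInterval V 0 T := absVar_absolutelyContinuous hT.le hd
  have hIcc : uIcc 0 T = Icc 0 T := uIcc_of_le hT.le
  have h0 : (0 : ℝ) ∈ Icc 0 T := left_mem_Icc.2 hT.le
  have hT' : T ∈ Icc 0 T := right_mem_Icc.2 hT.le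
  obtain ⟨R, hR⟩ : ∃ R, ∀ t ∈ Icc 0 T, |stretch L (w t)| ≤ R := by
    have hc := hd.continuousOn
    rw [hIcc] at hc
    obtain ⟨R, hR⟩ := isCompact_Icc.exists_bound_of_continuousOn hc
    exact ⟨R, hR⟩
  have hR0 : 0 ≤ R := (abs_nonneg _).trans (hR 0 h0)
  -- The stress constraint is available only for small `ε`; the first `N` indices are discarded by a
  -- shift.
  obtain ⟨N, hN⟩ : ∃ N, ∀ n, N ≤ n → R ^ 2 * (ε n * a₀) ≤ 2 * (κ / ε n) * L ^ 2 := by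
    have h1 : Tendsto (fun n => R ^ 2 * a₀ * (ε n) ^ 2) atTop (𝓝 0) := by
      simpa using (hε.pow 2).const_mul (R ^ 2 * a₀)
    obtain ⟨N, hN⟩ := eventually_atTop.1
      (h1.eventually (gt_mem_nhds (show 0 < 2 * κ * L ^ 2 by positivity)))
    refine ⟨N, fun n hn => ?_⟩
    have e1 : 2 * (κ / ε n) * L ^ 2 = 2 * κ * L ^ 2 / ε n := by ring
    rw [e1, le_div_iff₀ (hε_pos n)]
    have e2 := hN n hn
    have e3 : R ^ 2 * (ε n * a₀) * ε n = R ^ 2 * a₀ * ε n ^ 2 := by ring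
    linarith
  set K := 2 * R * a₁ / (κ * L) with hK
  have hK0 : 0 ≤ K := by positivity
  -- A bound for all the masses: the initial mass plus the largest possible growth on `[0, T]`.
  set B := R ^ 2 * a₁ / (2 * κ * L) + K * (V T - V 0) with hB
  have hVm : ∀ t ∈ Icc 0 T, V t ≤ V T := fun t ht => absVar_mono hd ht hT' ht.2
  have hΘ : ∀ n, ∀ t ∈ Icc 0 T, IsVolumeFraction L (Θ n t) := fun n t ht =>
    (hevol n).volumeFraction t ht
  have hmass : ∀ n, ∀ s ∈ Icc 0 T, ∀ t ∈ Icc 0 T, s ≤ t →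
      damagedVolume L (Θ (n + N) t) / ε (n + N) - damagedVolume L (Θ (n + N) s) / ε (n + N) ≤
        K * V t - K * V s := fun n s hs t ht hst => by
    rw [← mul_sub]
    exact (hevol (n + N)).damagedVolume_div_sub_le hL hκ ha₀ (hε_pos _) (hε_lt _) hw hR
      (hN _ (Nat.le_add_left N n)) hs ht hst
  have hbdd : ∀ n, ∀ t ∈ Icc 0 T,
      damagedVolume L (Θ (n + N) t) / ε (n + N) ≤ B.toNNReal := fun n t ht => by
    have e1 := hmass n 0 h0 t ht ht.1
    have e2 := (hevol (n + N)).initial_damagedVolume_div_le hL hκ ha₀ (hε_pos _) (hε_lt _) hR hT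
    have e3 : K * V t ≤ K * V T := mul_le_mul_of_nonneg_left (hVm t ht) hK0
    refine le_trans ?_ (Real.le_coe_toNNReal _)
    rw [hB, mul_sub]
    linarith
  have hKV : ContinuousOn (fun t => K * V t) (Icc 0 T) := by
    have hc := hV.continuousOn
    rw [hIcc] at hc
    exact continuousOn_const.mul hc
  obtain ⟨ψ, hψ, m, hm⟩ := exists_subseq_tendsto_of_monotone (C := B.toNNReal)
    (ν := fun n t => damage L (ε (n + N)) (Θ (n + N) t)) (U := fun t => K * V t) hL.le hT.le
    (fun n t ht => (hΘ _ t ht).isBoundedOn_damage (hε_pos _) (hbdd n t ht)) hKV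
    (fun n s hs t ht hst => (hΘ _ s hs).damage_le (hΘ _ t ht) (hε_pos _)
      (((hevol (n + N)).monotone s hs t ht hst).mono fun x hx => hx.2))
    (fun n s hs t ht hst => by
      rw [(hΘ _ s hs).damage_univ (hε_pos _), (hΘ _ t ht).damage_univ (hε_pos _)]
      exact hmass n s hs t ht hst)
  have hφ : StrictMono fun n => ψ n + N := fun i j hij => Nat.add_lt_add_right (hψ hij) N
  have hεφ : Tendsto (fun n => ε (ψ n + N)) atTop (𝓝 0) := hε.comp hφ.tendsto_atTop
  have hlamb : Tendsto (fun n => 2 * κ / (1 / a₀ - ε (ψ n + N) / a₁)) atTop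
      (𝓝 (2 * κ * a₀)) := by
    have := (tendsto_const_nhds (x := 2 * κ)).div (tendsto_damage_coefficient hεφ a₀ a₁)
      (inv_ne_zero ha₀.ne')
    rwa [div_inv_eq_mul] at this
  have htot : ∀ t ∈ Icc 0 T, Tendsto
      (fun n => totalCompliance L (ε (ψ n + N) * a₀) a₁ (Θ (ψ n + N) t)) atTop
      (𝓝 (effCompliance L a₀ a₁ (m t))) := fun t ht =>
    tendsto_totalCompliance hL ha₀ (fun n => hε_pos _) (fun n => hε_lt _) hεφ
      (fun n => hΘ _ t ht) (hm t ht).2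
  refine ⟨R, K, B.toNNReal, m, fun n => ψ n + N, hφ, ⟨fun t ht => (hm t ht).1,
    fun s hs t ht hst => ?_, fun s hs t ht hst => ?_, hR, fun t ht => ?_,
    fun s hs t ht hst => ?_⟩, fun n t ht => hbdd _ t ht, fun t ht => (hm t ht).2⟩
  · exact le_of_tendsto_of_isBoundedOn
      (Eventually.of_forall fun n =>
        (hΘ _ t ht).isBoundedOn_damage (hε_pos _) (hbdd (ψ n) t ht))
      (Eventually.of_forall fun n => (hΘ _ s hs).damage_le (hΘ _ t ht) (hε_pos _)
        (((hevol (ψ n + N)).monotone s hs t ht hst).mono fun x hx => hx.2)) (hm s hs).2 (hm t ht).2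
  · refine le_of_tendsto ((tendsto_real_univ (hm t ht).2).sub (tendsto_real_univ (hm s hs).2))
      (Eventually.of_forall fun n => ?_)
    rw [(hΘ _ s hs).damage_univ (hε_pos _), (hΘ _ t ht).damage_univ (hε_pos _)]
    exact hmass _ s hs t ht hst
  · exact ge_of_tendsto (hlamb.mul ((htot t ht).pow 2)) (Eventually.of_forall fun n =>
      (hevol (ψ n + N)).stretch_sq_le_mul_totalCompliance_sq hL ha₀ (hε_pos _) (hε_lt _) hR
        (hN _ (Nat.le_add_left _ _)) ht)
  · exact le_of_tendsto (((htot t ht).sub (htot s hs)).mul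
      (((hlamb.mul ((htot s hs).mul (htot t ht))).sub_const _).sub_const _))
      (Eventually.of_forall fun n => (hevol (ψ n + N)).griffith_inequality hL ha₀ (hε_pos _)
        (hε_lt _) hw hR hs ht hst)

end LimitDamage

/-! ### The limit evolution -/

section LimitEvolution

open scoped NNReal

variable {L T κ a₀ a₁ R K : ℝ} {C : ℝ≥0} {w : ℝ → H1 ⊤} {m : ℝ → FiniteMeasure ℝ}

theorem effCompliance_eq (hL : 0 < L) (ha₀ : 0 < a₀) (ha₁ : 0 < a₁) (m : FiniteMeasure ℝ) :
    effCompliance L a₀ a₁ m = a₀⁻¹ * (m : Measure ℝ).real univ + a₁⁻¹ * L :=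
  complianceMeasure_real_univ hL (inv_nonneg.2 ha₀.le) (inv_nonneg.2 ha₁.le) m

theorem le_effCompliance (hL : 0 < L) (ha₀ : 0 < a₀) (ha₁ : 0 < a₁) (m : FiniteMeasure ℝ) :
    a₁⁻¹ * L ≤ effCompliance L a₀ a₁ m := by
  rw [effCompliance_eq hL ha₀ ha₁]
  exact le_add_of_nonneg_left (mul_nonneg (inv_nonneg.2 ha₀.le) measureReal_nonneg)

theorem abs_div_sub_div_le {d d' S S' s₀ R : ℝ} (hs₀ : 0 < s₀) (hS : s₀ ≤ S) (hS' : s₀ ≤ S')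
    (hd' : |d'| ≤ R) : |d / S - d' / S'| ≤ s₀⁻¹ * |d - d'| + R * (s₀⁻¹ * s₀⁻¹) * |S - S'| := by
  have h1 : 0 < S := hs₀.trans_le hS
  have h2 : 0 < S' := hs₀.trans_le hS'
  have e : d / S - d' / S' = S⁻¹ * (d - d') - d' * (S⁻¹ * S'⁻¹) * (S - S') := by
    field_simp
    ring
  have i1 : S⁻¹ ≤ s₀⁻¹ := inv_anti₀ hs₀ hS
  have i2 : S'⁻¹ ≤ s₀⁻¹ := inv_anti₀ hs₀ hS'
  have p1 := inv_pos.2 h1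
  have p2 := inv_pos.2 h2
  have p0 := inv_pos.2 hs₀
  rw [e]
  refine (abs_sub _ _).trans ?_
  rw [abs_mul, abs_mul, abs_mul, abs_of_pos p1, abs_of_pos (mul_pos p1 p2)]
  refine add_le_add (mul_le_mul_of_nonneg_right i1 (abs_nonneg _))
    (mul_le_mul_of_nonneg_right ?_ (abs_nonneg _))
  exact mul_le_mul hd' (mul_le_mul i1 i2 p2.le p0.le) (mul_pos p1 p2).le
    ((abs_nonneg _).trans hd')

theorem absolutelyContinuous_of_dist_le {f V : ℝ → ℝ} {B : ℝ} (hT : 0 ≤ T)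
    (hV : AbsolutelyContinuousOnInterval V 0 T)
    (h : ∀ s ∈ Icc 0 T, ∀ t ∈ Icc 0 T, |f s - f t| ≤ B * |V s - V t|) :
    AbsolutelyContinuousOnInterval f 0 T := by
  have h' : AbsContWith dist f 0 T := by
    refine AbsContWith.of_le_add (C := |B|) hV hV (fun _ _ => dist_nonneg) fun s hs t ht => ?_
    rw [uIcc_of_le hT] at hs ht
    rw [Real.dist_eq, Real.dist_eq]
    refine (h s hs t ht).trans (mul_le_mul (le_abs_self B) ?_ (abs_nonneg _) (abs_nonneg _))
    exact le_add_of_nonneg_left (abs_nonneg _)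
  exact h'

theorem absContWith_of_le {X Y : Type*} [PseudoMetricSpace Y] {d : X → X → ℝ} {f : ℝ → X}
    {g : ℝ → Y} {V : ℝ → ℝ} {A B : ℝ} (hT : 0 ≤ T) (hg : AbsolutelyContinuousOnInterval g 0 T)
    (hV : AbsolutelyContinuousOnInterval V 0 T) (hd : ∀ x y, 0 ≤ d x y)
    (h : ∀ s ∈ Icc 0 T, ∀ t ∈ Icc 0 T,
      d (f s) (f t) ≤ A * dist (g s) (g t) + B * |V s - V t|) :
    AbsContWith d f 0 T := by
  refine AbsContWith.of_le_add (C := |A| + |B|) hg hV hd fun s hs t ht => ?_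
  rw [uIcc_of_le hT] at hs ht
  refine (h s hs t ht).trans ?_
  rw [Real.dist_eq]
  have p1 := dist_nonneg (x := g s) (y := g t)
  have p2 := abs_nonneg (V s - V t)
  have q1 := mul_le_mul_of_nonneg_right (le_abs_self A) p1
  have q2 := mul_le_mul_of_nonneg_right (le_abs_self B) p2
  have q3 := mul_nonneg (abs_nonneg A) p2
  have q4 := mul_nonneg (abs_nonneg B) p1
  linarith

/-- The stress in the limit. -/
noncomputable def limitStress (L a₀ a₁ : ℝ) (w : ℝ → H1 ⊤) (m : ℝ → FiniteMeasure ℝ) (t : ℝ) : ℝ :=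
  stretch L (w t) / effCompliance L a₀ a₁ (m t)

namespace IsLimitDamage

variable (h : IsLimitDamage L T κ a₀ a₁ R K C w m)
include h

theorem le_or_le {s t : ℝ} (hs : s ∈ Icc 0 T) (ht : t ∈ Icc 0 T) :
    (m s : Measure ℝ) ≤ m t ∨ (m t : Measure ℝ) ≤ m s :=
  (le_total s t).imp (h.mono s hs t ht) (h.mono t ht s hs)

theorem abs_mass_sub_le {s t : ℝ} (hs : s ∈ Icc 0 T) (ht : t ∈ Icc 0 T) :
    |(m s : Measure ℝ).real univ - (m t : Measure ℝ).real univ| ≤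
      |K| * |absVar (fun t => stretch L (w t)) s - absVar (fun t => stretch L (w t)) t| := by
  have key : ∀ {s t}, s ∈ Icc 0 T → t ∈ Icc 0 T → s ≤ t →
      |(m t : Measure ℝ).real univ - (m s : Measure ℝ).real univ| ≤
      |K| * |absVar (fun t => stretch L (w t)) t - absVar (fun t => stretch L (w t)) s| := by
    intro s t hs ht hst
    have h1 := h.mass_sub_le s hs t ht hst
    have h2 : (m s : Measure ℝ).real univ ≤ (m t : Measure ℝ).real univ :=
      ENNReal.toReal_mono (measure_ne_top _ _) (h.mono s hs t ht hst univ)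
    rw [abs_of_nonneg (sub_nonneg.2 h2), ← abs_mul, mul_sub]
    exact h1.trans (le_abs_self _)
  rcases le_total s t with hst | hst
  · rw [abs_sub_comm, abs_sub_comm (absVar _ s)]
    exact key hs ht hst
  · exact key ht hs hst

theorem abs_effCompliance_sub_le (hL : 0 < L) (ha₀ : 0 < a₀) (ha₁ : 0 < a₁) {s t : ℝ}
    (hs : s ∈ Icc 0 T) (ht : t ∈ Icc 0 T) :
    |effCompliance L a₀ a₁ (m s) - effCompliance L a₀ a₁ (m t)| ≤
      a₀⁻¹ * |K| * |absVar (fun t => stretch L (w t)) s - absVar (fun t => stretch L (w t)) t| := by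
  rw [effCompliance_eq hL ha₀ ha₁, effCompliance_eq hL ha₀ ha₁, add_sub_add_right_eq_sub,
    ← mul_sub, abs_mul, abs_of_pos (inv_pos.2 ha₀), mul_assoc]
  exact mul_le_mul_of_nonneg_left (h.abs_mass_sub_le hs ht) (inv_nonneg.2 ha₀.le)

/-- The stress is a quotient whose numerator and denominator both have increments controlled by the
variation of the elongation, and the denominator stays above `L / a₁`. -/
theorem exists_abs_limitStress_sub_le (hL : 0 < L) (ha₀ : 0 < a₀) (ha₁ : 0 < a₁)
    (hw : AbsolutelyContinuousOnInterval w 0 T) :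
    ∃ B, ∀ s ∈ Icc 0 T, ∀ t ∈ Icc 0 T,
      |limitStress L a₀ a₁ w m s - limitStress L a₀ a₁ w m t| ≤
      B * |absVar (fun t => stretch L (w t)) s - absVar (fun t => stretch L (w t)) t| := by
  refine ⟨(a₁⁻¹ * L)⁻¹ + R * ((a₁⁻¹ * L)⁻¹ * (a₁⁻¹ * L)⁻¹) * (a₀⁻¹ * |K|), fun s hs t ht => ?_⟩
  have hs₀ : 0 < a₁⁻¹ * L := by positivity
  have hR0 : 0 ≤ R := (abs_nonneg _).trans (h.stretch_le s hs)
  refine (abs_div_sub_div_le hs₀ (le_effCompliance hL ha₀ ha₁ (m s))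
    (le_effCompliance hL ha₀ ha₁ (m t)) (h.stretch_le t ht)).trans ?_
  rw [add_mul, mul_assoc _ (a₀⁻¹ * |K|)]
  have hd : AbsolutelyContinuousOnInterval (fun t => stretch L (w t)) 0 T :=
    hw.comp_lipschitz (stretch L).lipschitz
  exact add_le_add (mul_le_mul_of_nonneg_left (dist_le_dist_absVar hd hs ht)
    (inv_nonneg.2 hs₀.le)) (mul_le_mul_of_nonneg_left
      (h.abs_effCompliance_sub_le hL ha₀ ha₁ hs ht) (by positivity))

theorem abs_limitStress_le (hL : 0 < L) (ha₀ : 0 < a₀) (ha₁ : 0 < a₁) {t : ℝ}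
    (ht : t ∈ Icc 0 T) : |limitStress L a₀ a₁ w m t| ≤ R * (a₁⁻¹ * L)⁻¹ := by
  have hs₀ : 0 < a₁⁻¹ * L := by positivity
  have h1 := le_effCompliance hL ha₀ ha₁ (m t)
  rw [limitStress, abs_div, abs_of_pos (hs₀.trans_le h1), div_eq_mul_inv]
  exact mul_le_mul (h.stretch_le t ht) (inv_anti₀ hs₀ h1) (inv_nonneg.2 (hs₀.trans_le h1).le)
    ((abs_nonneg _).trans (h.stretch_le t ht))

theorem absContWith_damage (hT : 0 ≤ T) (hw : AbsolutelyContinuousOnInterval w 0 T) :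
    AbsContWith tvDist (fun t => (m t : Measure ℝ).toSignedMeasure) 0 T := by
  have hV := absVar_absolutelyContinuous hT (hw.comp_lipschitz (stretch L).lipschitz)
  refine absContWith_of_le (A := 0) (B := 1 * |K|) hT hw hV tvDist_nonneg fun s hs t ht => ?_
  have h1 := tvDist_smul_le (a := 1) (b := 1) (A := 1) (C := C) (h.le_or_le hs ht)
    (by simp) (by simp) (h.bounded s hs).real_univ_le (h.bounded t ht).real_univ_le
  rw [one_smul, one_smul, sub_self, abs_zero, mul_zero, zero_add] at h1
  refine h1.trans ?_
  rw [zero_mul, zero_add, mul_assoc]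
  exact mul_le_mul_of_nonneg_left (h.abs_mass_sub_le hs ht) zero_le_one

theorem absContWith_plasticStrain (hL : 0 < L) (hT : 0 ≤ T) (ha₀ : 0 < a₀) (ha₁ : 0 < a₁)
    (hw : AbsolutelyContinuousOnInterval w 0 T) :
    AbsContWith tvDist
      (fun t => (limitStress L a₀ a₁ w m t / a₀) • (m t : Measure ℝ).toSignedMeasure) 0 T := by
  have hV := absVar_absolutelyContinuous hT (hw.comp_lipschitz (stretch L).lipschitz)
  obtain ⟨B, hB⟩ := h.exists_abs_limitStress_sub_le hL ha₀ ha₁ hw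
  refine absContWith_of_le (A := 0) (B := C * (B / a₀) + R * (a₁⁻¹ * L)⁻¹ / a₀ * |K|) hT hw hV
    tvDist_nonneg fun s hs t ht => ?_
  have hbd : ∀ r ∈ Icc 0 T, |limitStress L a₀ a₁ w m r / a₀| ≤ R * (a₁⁻¹ * L)⁻¹ / a₀ :=
    fun r hr => by
      rw [abs_div, abs_of_pos ha₀]
      exact div_le_div_of_nonneg_right (h.abs_limitStress_le hL ha₀ ha₁ hr) ha₀.le
  refine (tvDist_smul_le (h.le_or_le hs ht) (hbd s hs) (hbd t ht) (h.bounded s hs).real_univ_le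
    (h.bounded t ht).real_univ_le).trans ?_
  rw [zero_mul, zero_add, add_mul, mul_assoc (C : ℝ), mul_assoc (R * (a₁⁻¹ * L)⁻¹ / a₀),
    ← sub_div, abs_div, abs_of_pos ha₀]
  refine add_le_add (mul_le_mul_of_nonneg_left ?_ C.coe_nonneg) (mul_le_mul_of_nonneg_left
    (h.abs_mass_sub_le hs ht) ((abs_nonneg _).trans (hbd s hs)))
  rw [div_mul_eq_mul_div]
  exact div_le_div_of_nonneg_right (hB s hs t ht) ha₀.le

/-- The displacement needs the modulus of `w` itself, through its boundary value at `0`; the other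
limit quantities depend on `w` only through its elongation. -/
theorem absContWith_displacement (hL : 0 < L) (hT : 0 ≤ T) (ha₀ : 0 < a₀) (ha₁ : 0 < a₁)
    (hw : AbsolutelyContinuousOnInterval w 0 T) :
    AbsContWith BV.distance (fun t => BV.ofMeasure L (trace0 (w t)) (limitStress L a₀ a₁ w m t)
      (complianceMeasure L a₀⁻¹ a₁⁻¹ (m t))) 0 T := by
  have hV := absVar_absolutelyContinuous hT (hw.comp_lipschitz (stretch L).lipschitz)
  obtain ⟨B, hB⟩ := h.exists_abs_limitStress_sub_le hL ha₀ ha₁ hw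
  set S := (a₀⁻¹ * C + a₁⁻¹ * L).toNNReal with hS
  set A := R * (a₁⁻¹ * L)⁻¹ with hA
  have hb : ∀ r ∈ Icc 0 T, IsBoundedOn L S (complianceMeasure L a₀⁻¹ a₁⁻¹ (m r)) := fun r hr =>
    (h.bounded r hr).complianceMeasure hL (inv_nonneg.2 ha₁.le) (inv_nonneg.2 ha₀.le) le_rfl
  refine absContWith_of_le (A := L * (√L / L + √L)) (B := (L + 1) * (S * B + A * (a₀⁻¹ * |K|)))
    hT hw hV BV.distance_nonneg fun s hs t ht => ?_
  refine (BV.distance_ofMeasure_le hL ((h.le_or_le hs ht).imp complianceMeasure_mono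
    complianceMeasure_mono) (h.abs_limitStress_le hL ha₀ ha₁ hs)
    (h.abs_limitStress_le hL ha₀ ha₁ ht) (hb s hs).real_univ_le (hb t ht).real_univ_le).trans ?_
  rw [mul_assoc L, mul_assoc (L + 1), add_mul (S * B : ℝ), mul_assoc (S : ℝ), mul_assoc A]
  have hA0 : 0 ≤ A := (abs_nonneg _).trans (h.abs_limitStress_le hL ha₀ ha₁ hs)
  exact add_le_add (mul_le_mul_of_nonneg_left (abs_trace0_sub_le hL _ _) hL.le)
    (mul_le_mul_of_nonneg_left (add_le_add
      (mul_le_mul_of_nonneg_left (hB s hs t ht) S.coe_nonneg)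
      (mul_le_mul_of_nonneg_left (h.abs_effCompliance_sub_le hL ha₀ ha₁ hs ht) hA0))
      (by positivity))

theorem limitStress_sq_le (hL : 0 < L) (ha₀ : 0 < a₀) (ha₁ : 0 < a₁) {t : ℝ}
    (ht : t ∈ Icc 0 T) : limitStress L a₀ a₁ w m t ^ 2 ≤ 2 * κ * a₀ := by
  have hpos : 0 < effCompliance L a₀ a₁ (m t) :=
    lt_of_lt_of_le (by positivity) (le_effCompliance hL ha₀ ha₁ (m t))
  rw [limitStress, div_pow, div_le_iff₀ (by positivity)]
  exact h.threshold t ht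

/-- Below the threshold the damage does not evolve. -/
theorem eventually_damage_eq (hL : 0 < L) (ha₀ : 0 < a₀) (ha₁ : 0 < a₁)
    (hw : AbsolutelyContinuousOnInterval w 0 T) {t : ℝ} (ht : t ∈ Ioo 0 T)
    (hlt : limitStress L a₀ a₁ w m t ^ 2 < 2 * κ * a₀) : ∀ᶠ s in 𝓝 t, m s = m t := by
  have hT : 0 ≤ T := (ht.1.trans ht.2).le
  have htI : t ∈ Icc 0 T := Ioo_subset_Icc_self ht
  have hd : AbsolutelyContinuousOnInterval (fun t => stretch L (w t)) 0 T :=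
    hw.comp_lipschitz (stretch L).lipschitz
  set V := absVar fun t => stretch L (w t) with hVdef
  have hV : AbsolutelyContinuousOnInterval V 0 T := absVar_absolutelyContinuous hT hd
  have hSac : AbsolutelyContinuousOnInterval (fun t => effCompliance L a₀ a₁ (m t)) 0 T :=
    absolutelyContinuous_of_dist_le hT hV fun s hs t ht =>
      h.abs_effCompliance_sub_le hL ha₀ ha₁ hs ht
  have hat : ∀ f : ℝ → ℝ, AbsolutelyContinuousOnInterval f 0 T → Tendsto f (𝓝 t) (𝓝 (f t)) :=
    fun f hf => by
      have hc := hf.continuousOn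
      rw [uIcc_of_le hT] at hc
      exact (hc.continuousAt (Icc_mem_nhds ht.1 ht.2)).tendsto
  have hmin : Tendsto (fun s => min s t) (𝓝 t) (𝓝 t) := by
    have := (continuous_id.min (continuous_const (y := t))).tendsto t
    rwa [id, min_self] at this
  have hmax : Tendsto (fun s => max s t) (𝓝 t) (𝓝 t) := by
    have := (continuous_id.max (continuous_const (y := t))).tendsto t
    rwa [id, max_self] at this
  have hpos : 0 < effCompliance L a₀ a₁ (m t) :=
    lt_of_lt_of_le (by positivity) (le_effCompliance hL ha₀ ha₁ (m t))
  -- The bracket of the Griffith inequality for the ordered pair `min s t`, `max s t` is continuous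
  -- in `s` at `t`. Its value there is positive exactly because the stress is below the threshold,
  -- so no increase of the compliance is possible near `t`.
  have hF := (((((hat _ hSac).comp hmin).mul ((hat _ hSac).comp hmax)).const_mul
    (2 * κ * a₀)).sub (((hat _ hd).comp hmax).pow 2)).sub
      ((((hat _ hV).comp hmax).sub ((hat _ hV).comp hmin)).const_mul (2 * R))
  have hFpos : 0 < 2 * κ * a₀ * (effCompliance L a₀ a₁ (m t) * effCompliance L a₀ a₁ (m t)) -
      stretch L (w t) ^ 2 - 2 * R * (V t - V t) := by
    rw [limitStress, div_pow, div_lt_iff₀ (by positivity)] at hlt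
    rw [sub_self, mul_zero, sub_zero]
    nlinarith
  filter_upwards [hF.eventually (lt_mem_nhds hFpos), Icc_mem_nhds ht.1 ht.2] with s hs hsI
  have hu : min s t ∈ Icc 0 T := ⟨le_min hsI.1 htI.1, (min_le_left _ _).trans hsI.2⟩
  have hv : max s t ∈ Icc 0 T := ⟨hsI.1.trans (le_max_left _ _), max_le hsI.2 htI.2⟩
  have h1 := h.griffith _ hu _ hv min_le_max
  have h2 : effCompliance L a₀ a₁ (m (max s t)) ≤ effCompliance L a₀ a₁ (m (min s t)) := by
    by_contra hcon
    exact absurd h1 (not_le.2 (mul_pos (sub_pos.2 (not_le.1 hcon)) hs))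
  have hle := h.mono _ hu _ hv min_le_max
  rw [effCompliance_eq hL ha₀ ha₁, effCompliance_eq hL ha₀ ha₁, add_le_add_iff_right,
    mul_le_mul_iff_right₀ (inv_pos.2 ha₀)] at h2
  -- Ordered finite measures of equal mass coincide.
  have heq : m (min s t) = m (max s t) := by
    refine FiniteMeasure.toMeasure_injective (Measure.eq_of_le_of_measure_univ_eq hle ?_)
    exact le_antisymm (hle univ)
      ((ENNReal.toReal_le_toReal (measure_ne_top _ _) (measure_ne_top _ _)).1 h2)
  rcases le_total s t with hst | hst
  · rwa [min_eq_left hst, max_eq_right hst] at heq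
  · rw [min_eq_right hst, max_eq_left hst] at heq
    exact heq.symm

/-- The difference quotients of the compliance. -/
theorem integral_slope_compliance {s t : ℝ} (hs : s ∈ Icc 0 T) (ht : t ∈ Icc 0 T) {f : ℝ → ℝ}
    (hf : Continuous f) :
    ∫ᵛ x, f x ∂<•((s - t)⁻¹ • (compliance L a₀ a₁ (m s : Measure ℝ).toSignedMeasure -
      compliance L a₀ a₁ (m t : Measure ℝ).toSignedMeasure)) = a₀⁻¹ * ((s - t)⁻¹ *
        (∫ x, f x ∂(m s : Measure ℝ) - ∫ x, f x ∂(m t : Measure ℝ))) := by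
  have hi : ∀ r ∈ Icc 0 T, (m r : Measure ℝ).toSignedMeasure.Integrable f := fun r hr => by
    rw [VectorMeasure.Integrable, Measure.variation_toSignedMeasure]
    exact (h.bounded r hr).integrable hf
  have e : compliance L a₀ a₁ (m s : Measure ℝ).toSignedMeasure -
      compliance L a₀ a₁ (m t : Measure ℝ).toSignedMeasure =
      a₀⁻¹ • ((m s : Measure ℝ).toSignedMeasure - (m t : Measure ℝ).toSignedMeasure) := by
    rw [compliance, compliance, add_sub_add_right_eq_sub, smul_sub]
  rw [e, VectorMeasure.integral_smul_vectorMeasure, VectorMeasure.integral_smul_vectorMeasure,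
    VectorMeasure.integral_sub_vectorMeasure (hi s hs) (hi t ht),
    VectorMeasure.integral_toSignedMeasure, VectorMeasure.integral_toSignedMeasure,
    smul_eq_mul, smul_eq_mul]
  ring

/-- The Griffith evolution law. -/
theorem ae_exists_compliance_rate (hL : 0 < L) (hT : 0 ≤ T) (ha₀ : 0 < a₀) (ha₁ : 0 < a₁)
    (hw : AbsolutelyContinuousOnInterval w 0 T) :
    ∀ᵐ t ∂volume.restrict (Icc 0 T), ∃ c' : SignedMeasure ℝ,
      IsMeasureOn (Icc 0 L) c' ∧ 0 ≤ c' ∧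
      HasWeakStarTimeDerivAt (Icc 0 L)
        (fun s => compliance L a₀ a₁ (m s : Measure ℝ).toSignedMeasure) c' t ∧
      (2 * κ * a₀ - limitStress L a₀ a₁ w m t ^ 2) • c' = 0 := by
  have hd : AbsolutelyContinuousOnInterval (fun t => stretch L (w t)) 0 T :=
    hw.comp_lipschitz (stretch L).lipschitz
  have hV := absVar_absolutelyContinuous hT hd
  have hKV : AbsolutelyContinuousOnInterval
      (fun t => K * absVar (fun t => stretch L (w t)) t) 0 T :=
    absolutelyContinuous_of_dist_le (B := |K|) hT hV fun s _ t _ => by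
      rw [← mul_sub, abs_mul]
  have hne : ∀ c : ℝ, ∀ᵐ s ∂volume.restrict (Icc 0 T), s ≠ c := fun c =>
    ae_restrict_of_ae (by simp [ae_iff, measure_singleton])
  filter_upwards [ae_exists_tendsto_slope_of_monotone hL.le hT h.bounded hKV h.mono h.mass_sub_le,
    hne 0, hne T, ae_restrict_mem measurableSet_Icc] with t hq h0 h1 htI
  have ht : t ∈ Ioo 0 T := ⟨lt_of_le_of_ne htI.1 h0.symm, lt_of_le_of_ne htI.2 h1⟩
  -- At the threshold the scalar factor vanishes and only existence of the rate is at stake. Below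
  -- it the measure is locally constant in time and the rate is zero.
  rcases (h.limitStress_sq_le hL ha₀ ha₁ htI).eq_or_lt with heq | hlt
  · obtain ⟨C', q, hqb, hqlim⟩ := hq
    refine ⟨a₀⁻¹ • (q : Measure ℝ).toSignedMeasure,
      isMeasureOn_smul_toSignedMeasure measurableSet_Icc hqb.ae_mem _, ?_, fun f hf => ?_, ?_⟩
    · intro s hs
      change 0 ≤ a₀⁻¹ * (q : Measure ℝ).toSignedMeasure s
      rw [Measure.toSignedMeasure_apply_measurable hs]
      exact mul_nonneg (inv_nonneg.2 ha₀.le) measureReal_nonneg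
    · rw [VectorMeasure.integral_smul_vectorMeasure, VectorMeasure.integral_toSignedMeasure,
        smul_eq_mul]
      refine ((hqlim f hf.1).const_mul a₀⁻¹).congr' ?_
      filter_upwards [nhdsWithin_le_nhds (Icc_mem_nhds ht.1 ht.2)] with s hs
      exact (h.integral_slope_compliance hs htI hf.1).symm
    · rw [heq, sub_self, zero_smul]
  · refine ⟨0, VectorMeasure.restrict_zero, le_rfl, fun f hf => ?_, smul_zero _⟩
    refine tendsto_const_nhds.congr' ?_
    filter_upwards [nhdsWithin_le_nhds (h.eventually_damage_eq hL ha₀ ha₁ hw ht hlt)] with s hs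
    simp only [hs, sub_self, smul_zero]

end IsLimitDamage

end LimitEvolution

/-! ### Convergence to the limit evolution -/

section LimitEvolution

open scoped NNReal

variable {L T κ a₀ a₁ R K : ℝ} {C : ℝ≥0} {w : ℝ → H1 ⊤} {m : ℝ → FiniteMeasure ℝ}

theorem BV.D_ofMeasure_complianceMeasure (ha₀ : 0 < a₀) (ha₁ : 0 < a₁) (c₀ σ : ℝ)
    (m : FiniteMeasure ℝ) :
    (BV.ofMeasure L c₀ σ (complianceMeasure L a₀⁻¹ a₁⁻¹ m)).D =
      σ • (compliance L a₀ a₁ (m : Measure ℝ).toSignedMeasure).restrict (Ioo 0 L) := by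
  rw [compliance_eq ha₀ ha₁, VectorMeasure.restrict_toSignedMeasure measurableSet_Ioo]
  rfl

theorem smul_restrict_compliance (L a₀ a₁ σ : ℝ) (μ : SignedMeasure ℝ) :
    σ • (compliance L a₀ a₁ μ).restrict (Ioo 0 L) =
      (σ / a₁) • lebSigned L + ((σ / a₀) • μ).restrict (Ioo 0 L) := by
  have h : (lebSigned L).restrict (Ioo 0 L) = lebSigned L := by
    rw [lebSigned, VectorMeasure.restrict_toSignedMeasure measurableSet_Ioo]
    congr 1
    exact Measure.restrict_eq_self_of_ae_mem (ae_restrict_mem measurableSet_Ioo)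
  rw [compliance, VectorMeasure.restrict_add, VectorMeasure.restrict_smul,
    VectorMeasure.restrict_smul, VectorMeasure.restrict_smul, h, smul_add, smul_smul, smul_smul,
    add_comm, div_eq_mul_inv, div_eq_mul_inv]

theorem integral_const_mul_der_eq_zero (hL : 0 < L) (σ : ℝ) {v : H1 (body L)}
    (hv : v ∈ H10 (body L)) : ∫ x in Ioo 0 L, σ * v.der x = 0 := by
  rw [integral_const_mul, ← totalInt_apply, (H10.val_eq hL hv).2, mul_zero]

theorem tendsto_stress (hL : 0 < L) (ha₀ : 0 < a₀) (ha₁ : 0 < a₁) {ε : ℕ → ℝ}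
    (hε_pos : ∀ n, 0 < ε n) (hε_lt : ∀ n, ε n * a₀ < a₁) (hε : Tendsto ε atTop (𝓝 0))
    {θ : ℕ → ℝ → ℝ} (hθ : ∀ n, IsVolumeFraction L (θ n)) {t : ℝ}
    (h : Tendsto (fun n => damage L (ε n) (θ n)) atTop (𝓝 (m t))) :
    Tendsto (fun n => stretch L (w t) / totalCompliance L (ε n * a₀) a₁ (θ n)) atTop
      (𝓝 (limitStress L a₀ a₁ w m t)) :=
  tendsto_const_nhds.div (tendsto_totalCompliance hL ha₀ hε_pos hε_lt hε hθ h)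
    (lt_of_lt_of_le (by positivity) (le_effCompliance hL ha₀ ha₁ (m t))).ne'

theorem bvWeakStarTendsto_displacement (hL : 0 < L) (ha₀ : 0 < a₀) (ha₁ : 0 < a₁) {ε k : ℕ → ℝ}
    (hε_pos : ∀ n, 0 < ε n) (hε_lt : ∀ n, ε n * a₀ < a₁) (hε : Tendsto ε atTop (𝓝 0))
    {u : ℕ → ℝ → H1 (body L)} {Θ a : ℕ → ℝ → ℝ → ℝ}
    (hevol : ∀ n, IsBrittleEvolution L T (k n) (ε n * a₀) a₁ w (u n) (Θ n) (a n)) {t : ℝ}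
    (ht : t ∈ Icc 0 T) (hC : ∀ n, damagedVolume L (Θ n t) / ε n ≤ C)
    (hm : IsBoundedOn L C (m t))
    (h : Tendsto (fun n => damage L (ε n) (Θ n t)) atTop (𝓝 (m t))) :
    BVWeakStarTendsto (fun n => u n t) (BV.ofMeasure L (trace0 (w t)) (limitStress L a₀ a₁ w m t)
      (complianceMeasure L a₀⁻¹ a₁⁻¹ (m t))) := by
  have hθ : ∀ n, IsVolumeFraction L (Θ n t) := fun n => (hevol n).volumeFraction t ht
  have hk : (0 : ℝ) ≤ a₁⁻¹ := inv_nonneg.2 ha₁.le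
  refine bvWeakStarTendsto_ofMeasure hL
    (ν := fun n => complianceMeasure L (1 / a₀ - ε n / a₁) a₁⁻¹ (damage L (ε n) (Θ n t)))
    (fun n => ((hθ n).isBoundedOn_damage (hε_pos n) (hC n)).complianceMeasure (B := a₀⁻¹) hL hk
      (damage_coefficient_pos ha₀ (hε_pos n) (hε_lt n)).le ?_)
    (hm.complianceMeasure hL hk (inv_nonneg.2 ha₀.le) le_rfl)
    (tendsto_complianceMeasure h (tendsto_damage_coefficient hε a₀ a₁) L _)
    (tendsto_stress hL ha₀ ha₁ hε_pos hε_lt hε hθ h)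
    (fun n => (hevol n).val_eq hL ha₀ (hε_pos n) (hε_lt n) ht)
    (fun n => (hevol n).withDensityᵥ_der hL ha₀ (hε_pos n) (hε_lt n) ht)
  rw [one_div]
  exact sub_le_self _ (div_nonneg (hε_pos n).le ha₁.le)

theorem weakStarTendsto_smul_damageMeasure (hL : 0 < L) {ε s : ℕ → ℝ} {σ : ℝ}
    (hε_pos : ∀ n, 0 < ε n) {θ : ℕ → ℝ → ℝ} (hθ : ∀ n, IsVolumeFraction L (θ n))
    (hC : ∀ n, damagedVolume L (θ n) / ε n ≤ C) {m : FiniteMeasure ℝ} (hm : IsBoundedOn L C m)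
    (h : Tendsto (fun n => damage L (ε n) (θ n)) atTop (𝓝 m)) (hs : Tendsto s atTop (𝓝 σ)) :
    WeakStarTendsto (Icc 0 L) (fun n => s n • damageMeasure L (ε n) (θ n))
      (σ • (m : Measure ℝ).toSignedMeasure) := by
  simp only [(hθ _).damageMeasure_eq (hε_pos _)]
  exact weakStarTendsto_smul hL (fun n => (hθ n).isBoundedOn_damage (hε_pos n) (hC n)) hm h hs

namespace IsLimitDamage

variable (h : IsLimitDamage L T κ a₀ a₁ R K C w m)
include h

/-- Stress times total compliance is the imposed elongation. Hence the trace at `0` exceeds the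
value of `w` by the atom of the plastic strain there, and the trace at `L` falls short of it by the
atom at `L`. -/
theorem relaxed_dirichlet (hL : 0 < L) (ha₀ : 0 < a₀) (ha₁ : 0 < a₁) {t : ℝ} (ht : t ∈ Icc 0 T) :
    ∃ (W : ℝ → ℝ) (α β : ℝ), IsContinuousRep (w t) W ∧
      HasTrace (Ioo 0 L) (BV.ofMeasure L (trace0 (w t)) (limitStress L a₀ a₁ w m t)
        (complianceMeasure L a₀⁻¹ a₁⁻¹ (m t))).val 0 α ∧
      HasTrace (Ioo 0 L) (BV.ofMeasure L (trace0 (w t)) (limitStress L a₀ a₁ w m t)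
        (complianceMeasure L a₀⁻¹ a₁⁻¹ (m t))).val L β ∧
      ((limitStress L a₀ a₁ w m t / a₀) • (m t : Measure ℝ).toSignedMeasure).restrict {0, L} =
        VectorMeasure.dirac L (W L - β) - VectorMeasure.dirac 0 (W 0 - α) := by
  have hb : (0 : ℝ) ≤ a₀⁻¹ := inv_nonneg.2 ha₀.le
  have hk : (0 : ℝ) ≤ a₁⁻¹ := inv_nonneg.2 ha₁.le
  have hpos : 0 < effCompliance L a₀ a₁ (m t) :=
    lt_of_lt_of_le (by positivity) (le_effCompliance hL ha₀ ha₁ (m t))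
  have hd : limitStress L a₀ a₁ w m t * (complianceMeasure L a₀⁻¹ a₁⁻¹ (m t) : Measure ℝ).real univ
      = stretch L (w t) := div_mul_cancel₀ _ hpos.ne'
  refine ⟨rep (w t), _, _, isContinuousRep_rep _, BV.hasTrace_ofMeasure_zero _ _ _ _,
    BV.hasTrace_ofMeasure_right _ _ _ _, ?_⟩
  rw [restrict_pair_eq hL, rep_zero, rep_right hL,
    (h.bounded t ht).complianceMeasure_real_Iic hL hb hk,
    (h.bounded t ht).complianceMeasure_real_Iio hL hb hk, mul_sub, hd]
  congr 2 <;> ring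

theorem limitStress_mem (hL : 0 < L) (ha₀ : 0 < a₀) (ha₁ : 0 < a₁) {t : ℝ} (ht : t ∈ Icc 0 T) :
    limitStress L a₀ a₁ w m t ∈ Icc (-√(2 * κ * a₀)) (√(2 * κ * a₀)) :=
  abs_le.1 (Real.abs_le_sqrt (h.limitStress_sq_le hL ha₀ ha₁ ht))

theorem compliance_mono (ha₀ : 0 < a₀) (ha₁ : 0 < a₁) {s t : ℝ} (hs : s ∈ Icc 0 T)
    (ht : t ∈ Icc 0 T) (hst : s ≤ t) :
    compliance L a₀ a₁ (m s : Measure ℝ).toSignedMeasure ≤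
      compliance L a₀ a₁ (m t : Measure ℝ).toSignedMeasure := by
  rw [compliance_eq ha₀ ha₁, compliance_eq ha₀ ha₁,
    Measure.toSignedMeasure_le_toSignedMeasure_iff]
  exact complianceMeasure_mono (h.mono s hs t ht hst)

theorem absolutelyContinuous_limitStress (hL : 0 < L) (hT : 0 ≤ T) (ha₀ : 0 < a₀) (ha₁ : 0 < a₁)
    (hw : AbsolutelyContinuousOnInterval w 0 T) :
    AbsolutelyContinuousOnInterval (limitStress L a₀ a₁ w m) 0 T := by
  obtain ⟨B, hB⟩ := h.exists_abs_limitStress_sub_le hL ha₀ ha₁ hw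
  exact absolutelyContinuous_of_dist_le hT
    (absVar_absolutelyContinuous hT (hw.comp_lipschitz (stretch L).lipschitz)) hB

theorem absolutelyContinuous_elasticStrain (hL : 0 < L) (hT : 0 ≤ T) (ha₀ : 0 < a₀)
    (ha₁ : 0 < a₁) (hw : AbsolutelyContinuousOnInterval w 0 T) :
    AbsolutelyContinuousOnInterval (fun t => limitStress L a₀ a₁ w m t / a₁) 0 T := by
  obtain ⟨B, hB⟩ := h.exists_abs_limitStress_sub_le hL ha₀ ha₁ hw
  refine absolutelyContinuous_of_dist_le (B := B / a₁) hT
    (absVar_absolutelyContinuous hT (hw.comp_lipschitz (stretch L).lipschitz))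
    fun s hs t ht => ?_
  rw [← sub_div, abs_div, abs_of_pos ha₁, div_mul_eq_mul_div]
  exact div_le_div_of_nonneg_right (hB s hs t ht) ha₁.le

end IsLimitDamage

end LimitEvolution

end BrittleDamage

/-! ### The main theorem -/

open BrittleDamage in
theorem theorem1p1 (L T κ a₀ a₁ : ℝ) (hL : 0 < L) (hT : 0 < T) (hκ : 0 < κ) (ha₀ : 0 < a₀)
    (ha₁ : 0 < a₁)
    (w : ℝ → H1 ⊤) (hw : AbsolutelyContinuousOnInterval w 0 T)
    (ε : ℕ → ℝ) (hε_pos : ∀ n, 0 < ε n) (hε_lt : ∀ n, ε n * a₀ < a₁)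
    (hε : Tendsto ε atTop (𝓝 0))
    (uε : ℕ → ℝ → H1 (body L)) (Θε aε : ℕ → ℝ → ℝ → ℝ)
    (hevol : ∀ n,
      IsBrittleEvolution L T (κ / ε n) (ε n * a₀) a₁ w (uε n) (Θε n) (aε n)) :
    -- the stresses are homogeneous in space
    ∃ σε : ℕ → ℝ → ℝ,
      (∀ n, ∀ t ∈ Icc 0 T, ∀ᵐ x ∂volume.restrict (Ioo 0 L),
        aε n t x * (uε n t).der x = σε n t) ∧
      ∃ φ : ℕ → ℕ, StrictMono φ ∧
      ∃ (u : ℝ → BV (body L)) (e : ℝ → ℝ) (p : ℝ → SignedMeasure ℝ) (σ : ℝ → ℝ)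
        (μ : ℝ → SignedMeasure ℝ),
        -- absolute continuity
        AbsContWith BV.distance u 0 T ∧
        AbsolutelyContinuousOnInterval e 0 T ∧
        AbsContWith tvDist p 0 T ∧
        AbsolutelyContinuousOnInterval σ 0 T ∧
        AbsContWith tvDist μ 0 T ∧
        (∀ t ∈ Icc 0 T,
          IsMeasureOn (Icc 0 L) (p t) ∧
          IsMeasureOn (Icc 0 L) (μ t) ∧
          -- convergences
          BVWeakStarTendsto (fun n => uε (φ n) t) (u t) ∧
          WeakStarTendsto (Icc 0 L)
            (fun n => damageMeasure L (ε (φ n)) (Θε (φ n) t)) (μ t) ∧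
          Tendsto (fun n => σε (φ n) t) atTop (𝓝 (σ t)) ∧
          (∀ g : ℝ → ℝ, MemLp g 2 (volume.restrict (Ioo 0 L)) →
            Tendsto (fun n => ∫ x in Ioo 0 L, σε (φ n) t / a₁ * Θε (φ n) t x * g x) atTop
              (𝓝 (∫ x in Ioo 0 L, e t * g x))) ∧
          WeakStarTendsto (Icc 0 L)
            (fun n => (σε (φ n) t / a₀) • damageMeasure L (ε (φ n)) (Θε (φ n) t)) (p t) ∧
          -- additive decomposition
          (u t).D = e t • lebSigned L + (p t).restrict (Ioo 0 L) ∧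
          -- relaxed Dirichlet condition
          (∃ (W : ℝ → ℝ) (α β : ℝ), IsContinuousRep (w t) W ∧
            HasTrace (Ioo 0 L) (u t).val 0 α ∧ HasTrace (Ioo 0 L) (u t).val L β ∧
            (p t).restrict {0, L} =
              VectorMeasure.dirac L (W L - β) - VectorMeasure.dirac 0 (W 0 - α)) ∧
          -- constitutive equation
          σ t = a₁ * e t ∧
          -- equilibrium equation
          (∀ v ∈ H10 (body L), ∫ x in Ioo 0 L, σ t * v.der x = 0) ∧
          -- stress constraint
          σ t ∈ Icc (-√(2 * κ * a₀)) (√(2 * κ * a₀))) ∧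
        -- the compliance is non-negative and non-decreasing
        (∀ t ∈ Icc 0 T, 0 ≤ compliance L a₀ a₁ (μ t)) ∧
        (∀ s ∈ Icc 0 T, ∀ t ∈ Icc 0 T, s ≤ t →
          compliance L a₀ a₁ (μ s) ≤ compliance L a₀ a₁ (μ t)) ∧
        -- constitutive equation of the damaged medium
        (∀ t ∈ Icc 0 T,
          (u t).D = σ t • (compliance L a₀ a₁ (μ t)).restrict (Ioo 0 L)) ∧
        -- Griffith evolution law
        (∀ᵐ t ∂volume.restrict (Icc 0 T), ∃ c' : SignedMeasure ℝ,
          IsMeasureOn (Icc 0 L) c' ∧ 0 ≤ c' ∧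
          HasWeakStarTimeDerivAt (Icc 0 L) (fun s => compliance L a₀ a₁ (μ s)) c' t ∧
          (2 * κ * a₀ - σ t ^ 2) • c' = 0) := by
  obtain ⟨R, K, C, m, φ, hφ, h, hC, hm⟩ :=
    exists_limit_damage hL hT hκ ha₀ ha₁ hw hε_pos hε_lt hε hevol
  have hεφ : Tendsto (fun n => ε (φ n)) atTop (𝓝 0) := hε.comp hφ.tendsto_atTop
  have hθ : ∀ n, ∀ t ∈ Icc 0 T, IsVolumeFraction L (Θε (φ n) t) := fun n t ht =>
    (hevol (φ n)).volumeFraction t ht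
  have hσ : ∀ t ∈ Icc 0 T, Tendsto
      (fun n => stretch L (w t) / totalCompliance L (ε (φ n) * a₀) a₁ (Θε (φ n) t)) atTop
      (𝓝 (limitStress L a₀ a₁ w m t)) := fun t ht =>
    tendsto_stress hL ha₀ ha₁ (fun n => hε_pos (φ n)) (fun n => hε_lt (φ n)) hεφ
      (fun n => hθ n t ht) (hm t ht)
  -- All limit quantities are explicit in the limit damage measure `m` and the datum `w`, so no
  -- further subsequence is extracted.
  refine ⟨fun n t => stretch L (w t) / totalCompliance L (ε n * a₀) a₁ (Θε n t),
    fun n t ht => (hevol n).stress_eq hL (mul_pos (hε_pos n) ha₀) (hε_lt n) ht, φ, hφ,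
    fun t => BV.ofMeasure L (trace0 (w t)) (limitStress L a₀ a₁ w m t)
      (complianceMeasure L a₀⁻¹ a₁⁻¹ (m t)),
    fun t => limitStress L a₀ a₁ w m t / a₁,
    fun t => (limitStress L a₀ a₁ w m t / a₀) • (m t : Measure ℝ).toSignedMeasure,
    limitStress L a₀ a₁ w m, fun t => (m t : Measure ℝ).toSignedMeasure,
    h.absContWith_displacement hL hT.le ha₀ ha₁ hw,
    h.absolutelyContinuous_elasticStrain hL hT.le ha₀ ha₁ hw,
    h.absContWith_plasticStrain hL hT.le ha₀ ha₁ hw,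
    h.absolutelyContinuous_limitStress hL hT.le ha₀ ha₁ hw,
    h.absContWith_damage hT.le hw, fun t ht => ⟨?_, ?_, ?_, ?_, hσ t ht, ?_, ?_, ?_, ?_, ?_, ?_, ?_⟩,
    fun t _ => ?_, fun s hs t ht hst => h.compliance_mono ha₀ ha₁ hs ht hst,
    fun t _ => BV.D_ofMeasure_complianceMeasure ha₀ ha₁ _ _ _,
    h.ae_exists_compliance_rate hL hT.le ha₀ ha₁ hw⟩
  · exact isMeasureOn_smul_toSignedMeasure measurableSet_Icc (h.bounded t ht).ae_mem _
  · have h1 := isMeasureOn_smul_toSignedMeasure measurableSet_Icc (h.bounded t ht).ae_mem 1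
    rwa [one_smul] at h1
  · exact bvWeakStarTendsto_displacement hL ha₀ ha₁ (fun n => hε_pos (φ n))
      (fun n => hε_lt (φ n)) hεφ (fun n => hevol (φ n)) ht (fun n => hC n t ht) (h.bounded t ht)
      (hm t ht)
  · have h1 := weakStarTendsto_smul_damageMeasure hL (fun n => hε_pos (φ n)) (fun n => hθ n t ht)
      (fun n => hC n t ht) (h.bounded t ht) (hm t ht) (tendsto_const_nhds (x := (1 : ℝ)))
    simpa only [one_smul] using h1
  · exact fun g hg => tendsto_integral_strain (fun n => hθ n t ht) (fun n => hε_pos (φ n)) hεφ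
      (fun n => hC n t ht) (hσ t ht) hg
  · exact weakStarTendsto_smul_damageMeasure hL (fun n => hε_pos (φ n)) (fun n => hθ n t ht)
      (fun n => hC n t ht) (h.bounded t ht) (hm t ht) ((hσ t ht).div_const a₀)
  · exact (BV.D_ofMeasure_complianceMeasure ha₀ ha₁ _ _ _).trans
      (smul_restrict_compliance L a₀ a₁ _ _)
  · exact h.relaxed_dirichlet hL ha₀ ha₁ ht
  · exact (mul_div_cancel₀ _ ha₁.ne').symm
  · exact fun v hv => integral_const_mul_der_eq_zero hL _ hv
  · exact h.limitStress_mem hL ha₀ ha₁ ht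
  · rw [compliance_eq ha₀ ha₁]
    exact Measure.zero_le_toSignedMeasure _
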